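/- Let $(X,\mu)$ be a $\sigma$-finite measure space and let $A$ be a non-negative self-adjoint operator on the real Hilbert space $L^2(X)=L^2(X,\mu;\mathbb R)$ with spectral resolution $\{E_A(\lambda)\}_{\lambda\in\mathbb R}$. For Borel $\phi:\mathbb R\to\mathbb R$ put $\phi(A)=\int_{\sigma(A)}\phi(\lambda)\,dE_A(\lambda)$ with domain $\{f\in L^2(X):\int_{\sigma(A)}|\phi(\lambda)|^2\,d\|E_A(\lambda)f\|_{L^2}^2<\infty\}$. Let $H^1(A)$ be the domain of $(I+A)^{1/2}$, with norm $\|f\|_{H^1(A)}=\|(I+A)^{1/2}f\|_{L^2}$. Let $\alpha>0$ and assume: (A) there is $C>0$ with $\|e^{-tA}f\|_{L^\infty}\le C t^{-\alpha}\|f\|_{L^2}$ for all $t>0$ and $f\in L^2(X)$; (B) if $\alpha>1/2$, then for every $q$ with $\frac{4\alpha}{4\alpha-1}<q<4\alpha$ there is $C>0$ with $\|e^{-tA}f\|_{L^q}\le C\|f\|_{L^q}$ and $\|e^{-tA}f\|_{L^\infty}\le C t^{-2\alpha/q}\|f\|_{L^q}$ for all $t>0$ and $f\in L^2(X)\cap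 L^q(X)$. Let $p\in(1,\infty)$, with $p\le \frac{2\alpha}{2\alpha-1}$ if $\alpha>1/2$. Let $F\in C^1(\mathbb R;\mathbb R)$ satisfy $F(0)=0$ and $|F(z_1)-F(z_2)|\le C(|z_1|+|z_2|)^{p-1}|z_1-z_2|$ for all $z_1,z_2\in\mathbb R$ and some constant $C$. For $t,\lambda\ge0$ let $$\mathcal D(t,\lambda)=\begin{cases} e^{-t/2}\,\dfrac{\sinh\big(t\sqrt{1/4-\lambda}\big)}{\sqrt{1/4-\lambda}}, & \lambda<\tfrac14,\\ t e^{-t/2}, & \lambda=\tfrac14,\\ e^{-t/2}\,\dfrac{\sin\big(t\sqrt{\lambda-1/4}\big)}{\sqrt{\lambda-1/4}}, & \lambda>\tfrac14,\end{cases}$$ and let $\mathcal D(t,A)$ and $\partial_t\mathcal D(t,A)$ be the operators with symbols $\mathcal D(t,\cdot)$ and $\partial_t\mathcal D(t,\cdot)$. For $T>0$ and $(u_0,u_1)\in H^1(A)\times L^2(X)$, a (mild) solution on $[0,T]$ of $$\partial_t^2u+Au+\partial_tu=F(u),\qquad u(0)=u_0,\quad \partial_tu(0)=u_1,$$ is a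 function $u\in C([0,T];H^1(A))\cap C^1([0,T];L^2(X))$ such that for all $t\in[0,T]$ $$u(t)=\mathcal D(t,A)(u_0+u_1)+\partial_t\mathcal D(t,A)u_0+\int_0^t\mathcal D(t-\tau,A)F(u(\tau))\,d\tau .$$ Then for every $(u_0,u_1)\in H^1(A)\times L^2(X)$ there is a time $T>0$, depending (for given $X,\mu,A,\alpha,p,F$) only on $\|u_0\|_{H^1(A)}$ and $\|u_1\|_{L^2}$, such that there is a unique solution on $[0,T]$ with data $(u_0,u_1)$. Moreover, let $$T_{\max}=T_{\max}(u_0,u_1):=\sup\{T>0:\text{ there is a unique solution on }[0,T]\text{ with data }(u_0,u_1)\}\in(0,\infty].$$ There is a function $u$ on $[0,T_{\max})$ whose restriction to $[0,T]$ is a solution for every $0<T<T_{\max}$, and if $T_{\max}<\infty$, then every such $u$ satisfies $$\lim_{t\to T_{\max}}\big(\|u(t)\|_{H^1(A)}+\|u_t(t)\|_{L^2}\big)=\infty .$$ -/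

import Mathlib

open MeasureTheory Set Filter Topology
open scoped ENNReal InnerProductSpace

noncomputable section

namespace DampedWave

section Spectral

variable {H : Type*} [NormedAddCommGroup H] [InnerProductSpace ℝ H] [CompleteSpace H]

/-- A resolution of the identity `{E(l)}` on a real Hilbert space: an increasing, strongly
right-continuous family of orthogonal projections running from `0` to the identity. -/
structure ResolutionOfIdentity (H : Type*) [NormedAddCommGroup H] [InnerProductSpace ℝ H]
    [CompleteSpace H] where
  proj : ℝ → H →L[ℝ] H
  isStarProjection : ∀ a, IsStarProjection (proj a)
  proj_mul_proj : ∀ a b, a ≤ b → proj a * proj b = proj a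
  right_continuous : ∀ (f : H) (a : ℝ), ContinuousWithinAt (fun l => proj l f) (Ici a) a
  tendsto_atBot : ∀ f : H, Tendsto (fun l => proj l f) atBot (𝓝 0)
  tendsto_atTop : ∀ f : H, Tendsto (fun l => proj l f) atTop (𝓝 f)

namespace ResolutionOfIdentity

theorem norm_proj_le (E : ResolutionOfIdentity H) (a : ℝ) (f : H) : ‖E.proj a f‖ ≤ ‖f‖ := by
  have h1 : ‖E.proj a‖ ≤ 1 := (E.isStarProjection a).norm_le
  calc ‖E.proj a f‖ ≤ ‖E.proj a‖ * ‖f‖ := (E.proj a).le_opNorm f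
    _ ≤ 1 * ‖f‖ := by gcongr
    _ = ‖f‖ := one_mul _

/-- The distribution function `l ↦ ‖E(l) f‖²`. -/
def distribution (E : ResolutionOfIdentity H) (f : H) : StieltjesFunction ℝ where
  toFun l := ‖E.proj l f‖ ^ 2
  mono' a b hab := by
    have h : E.proj a f = E.proj a (E.proj b f) := by
      conv_lhs => rw [← E.proj_mul_proj a b hab]
      rfl
    have h2 : ‖E.proj a f‖ ≤ ‖E.proj b f‖ := by
      rw [h]
      exact E.norm_proj_le a _
    exact pow_le_pow_left₀ (norm_nonneg _) h2 2
  right_continuous' a := (E.right_continuous f a).norm.pow 2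

/-- The spectral measure `d‖E(l) f‖²` of the vector `f`. -/
def measure (E : ResolutionOfIdentity H) (f : H) : Measure ℝ := (E.distribution f).measure

/-- `f` lies in the domain of `∫ φ(l) dE(l)`, that is, `∫ |φ(l)|² d‖E(l) f‖² < ∞`. -/
def MemDom (E : ResolutionOfIdentity H) (φ : ℝ → ℝ) (f : H) : Prop :=
  ∫⁻ l, ENNReal.ofReal (φ l ^ 2) ∂(E.measure f) < ∞

/-- The integral `∫ φ(l) d⟪E(l) f, h⟫`; the real polarization identity expresses
`d⟪E(l) f, h⟫` through the positive measures `d‖E(l)(f + h)‖²` and `d‖E(l)(f - h)‖²`. -/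
def weakIntegral (E : ResolutionOfIdentity H) (φ : ℝ → ℝ) (f h : H) : ℝ :=
  (1 / 4) * ((∫ l, φ l ∂(E.measure (f + h))) - ∫ l, φ l ∂(E.measure (f - h)))

/-- `f` is in the domain of `∫ φ(l) dE(l)` and `(∫ φ(l) dE(l)) f = g`, where the value is tested
against the (dense) domain of the operator. -/
def HasValue (E : ResolutionOfIdentity H) (φ : ℝ → ℝ) (f g : H) : Prop :=
  E.MemDom φ f ∧ ∀ h : H, E.MemDom φ h → ⟪g, h⟫_ℝ = E.weakIntegral φ f h

/-- `E` is the spectral resolution of the identity for the operator `A`: `A = ∫ l dE(l)`,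
including equality of the domains. -/
def IsResolutionOf (E : ResolutionOfIdentity H) (A : H →ₗ.[ℝ] H) : Prop :=
  ∀ f g : H, (f, g) ∈ A.graph ↔ E.HasValue (fun l => l) f g

/-- The resolution of the identity of the zero operator. -/
instance : Inhabited (ResolutionOfIdentity H) where
  default :=
    { proj := fun l => if 0 ≤ l then 1 else 0
      isStarProjection := fun a => by
        by_cases h : 0 ≤ a
        · simp [h]
        · simp [h]
      proj_mul_proj := fun a b hab => by
        by_cases h : 0 ≤ a
        · simp [h, h.trans hab]
        · simp [h]
      right_continuous := fun f a => by
        by_cases h : 0 ≤ a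
        · refine (continuousWithinAt_const (b := f)).congr (fun y hy => ?_) ?_
          · simp [h.trans hy]
          · simp [h]
        · have h' : ∀ᶠ y in 𝓝[Ici a] a, y < 0 :=
            nhdsWithin_le_nhds (Iio_mem_nhds (not_le.mp h))
          refine (continuousWithinAt_const (b := (0 : H))).congr_of_eventuallyEq ?_ ?_
          · filter_upwards [h'] with y hy
            simp [not_le.mpr hy]
          · simp [h]
      tendsto_atBot := fun f => by
        refine tendsto_const_nhds.congr' ?_
        filter_upwards [eventually_lt_atBot (0 : ℝ)] with y hy
        simp [not_le.mpr hy]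
      tendsto_atTop := fun f => by
        refine tendsto_const_nhds.congr' ?_
        filter_upwards [eventually_ge_atTop (0 : ℝ)] with y hy
        simp [hy] }

end ResolutionOfIdentity

open Classical in
/-- The spectral resolution `E_A` of the identity for `A` (a junk value if there is none,
which does not happen for self-adjoint `A`). -/
def spectralResolution (A : H →ₗ.[ℝ] H) : ResolutionOfIdentity H :=
  if h : ∃ E : ResolutionOfIdentity H, E.IsResolutionOf A then h.choose else default

/-- `f ∈ Dom(φ(A))`. -/
def MemDomFun (A : H →ₗ.[ℝ] H) (φ : ℝ → ℝ) (f : H) : Prop :=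
  (spectralResolution A).MemDom φ f

open Classical in
/-- `φ(A) f = (∫ φ(l) dE_A(l)) f`, for `f ∈ Dom(φ(A))` (and `0` otherwise). -/
def opFun (A : H →ₗ.[ℝ] H) (φ : ℝ → ℝ) (f : H) : H :=
  if h : ∃ g : H, (spectralResolution A).HasValue φ f g then h.choose else 0

/-- `A` is non-negative: `⟪A f, f⟫ ≥ 0` on the domain of `A`. -/
def IsNonneg (A : H →ₗ.[ℝ] H) : Prop := ∀ f : A.domain, 0 ≤ ⟪A f, (f : H)⟫_ℝ

/-- `f ∈ H^s(A)`, i.e. `f ∈ Dom((I + A)^{s/2})`. -/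
def MemSobolev (A : H →ₗ.[ℝ] H) (s : ℝ) (f : H) : Prop :=
  MemDomFun A (fun l => (1 + l) ^ (s / 2)) f

/-- `‖f‖_{H^s(A)} = ‖(I + A)^{s/2} f‖`, for `f ∈ H^s(A)`. -/
def sobolevNorm (A : H →ₗ.[ℝ] H) (s : ℝ) (f : H) : ℝ :=
  ‖opFun A (fun l => (1 + l) ^ (s / 2)) f‖

/-- `e^{-tA} f`. -/
def heat (A : H →ₗ.[ℝ] H) (t : ℝ) (f : H) : H := opFun A (fun l => Real.exp (-(t * l))) f

/-- The symbol `𝒟(t, l)` of the damped wave propagator (only `l ≥ 0` matters). -/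
def symbolD (t l : ℝ) : ℝ :=
  if l < 1 / 4 then
    Real.exp (-t / 2) * Real.sinh (t * √(1 / 4 - l)) / √(1 / 4 - l)
  else if l = 1 / 4 then
    t * Real.exp (-t / 2)
  else
    Real.exp (-t / 2) * Real.sin (t * √(l - 1 / 4)) / √(l - 1 / 4)

/-- `𝒟(t, A) f`. -/
def propD (A : H →ₗ.[ℝ] H) (t : ℝ) (f : H) : H := opFun A (symbolD t) f

/-- `∂ₜ𝒟(t, A) f`, the operator with symbol `∂ₜ𝒟(t, l)`. -/
def propDtD (A : H →ₗ.[ℝ] H) (t : ℝ) (f : H) : H :=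
  opFun A (fun l => deriv (fun s => symbolD s l) t) f

/-- The linear solution `u_L(t) = 𝒟(t, A)(u₀ + u₁) + ∂ₜ𝒟(t, A) u₀`. -/
def linearSolution (A : H →ₗ.[ℝ] H) (u₀ u₁ : H) (t : ℝ) : H :=
  propD A t (u₀ + u₁) + propDtD A t u₀

/-- `u ∈ C([0,T]; H^1(A)) ∩ C^1([0,T]; H)`. -/
def InSolutionSpace (A : H →ₗ.[ℝ] H) (T : ℝ) (u : ℝ → H) : Prop :=
  (∀ t ∈ Icc 0 T, MemSobolev A 1 (u t)) ∧
  (∀ t ∈ Icc 0 T,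
    Tendsto (fun s => sobolevNorm A 1 (u s - u t)) (𝓝[Icc 0 T] t) (𝓝 0)) ∧
  ContDiffOn ℝ 1 u (Icc 0 T)

end Spectral

section Equation

variable {X : Type*} [MeasurableSpace X] {μ : Measure X}

/-- The heat semigroup satisfies `‖e^{-tA}‖_{L² → L^∞} ≲ t^{-α}` for `t > 0`. -/
def HeatDecay (A : Lp ℝ 2 μ →ₗ.[ℝ] Lp ℝ 2 μ) (α : ℝ) : Prop :=
  ∃ C : ℝ, 0 < C ∧ ∀ t : ℝ, 0 < t → ∀ f : Lp ℝ 2 μ,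
    eLpNorm (heat A t f : Lp ℝ 2 μ) ∞ μ ≤ ENNReal.ofReal (C * t ^ (-α)) * eLpNorm f 2 μ

/-- If `α > 1/2`, then `‖e^{-tA}‖_{L^q → L^q} ≲ 1` and `‖e^{-tA}‖_{L^q → L^∞} ≲ t^{-2α/q}` for
`t > 0` and every `4α/(4α-1) < q < 4α`; the bounds are those of `e^{-tA}` on `L² ∩ L^q`. -/
def HeatLqBounds (A : Lp ℝ 2 μ →ₗ.[ℝ] Lp ℝ 2 μ) (α : ℝ) : Prop :=
  1 / 2 < α → ∀ q : ℝ, 4 * α / (4 * α - 1) < q → q < 4 * α →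
    ∃ C : ℝ, 0 < C ∧ ∀ t : ℝ, 0 < t → ∀ f : Lp ℝ 2 μ, MemLp f (ENNReal.ofReal q) μ →
      eLpNorm (heat A t f : Lp ℝ 2 μ) (ENNReal.ofReal q) μ
          ≤ ENNReal.ofReal C * eLpNorm f (ENNReal.ofReal q) μ ∧
      eLpNorm (heat A t f : Lp ℝ 2 μ) ∞ μ
          ≤ ENNReal.ofReal (C * t ^ (-(2 * α / q))) * eLpNorm f (ENNReal.ofReal q) μ

/-- The nonlinearity: `F(0) = 0`, `F ∈ C¹(ℝ)` and
`|F(z₁) - F(z₂)| ≤ C (|z₁| + |z₂|)^{p-1} |z₁ - z₂|`. -/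
def IsNonlinearity (F : ℝ → ℝ) (p : ℝ) : Prop :=
  F 0 = 0 ∧ ContDiff ℝ 1 F ∧
  ∃ C : ℝ, ∀ z₁ z₂ : ℝ, |F z₁ - F z₂| ≤ C * (|z₁| + |z₂|) ^ (p - 1) * |z₁ - z₂|

open Classical in
/-- `F(f) = F ∘ f` as an element of `L²` (and `0` if it is not in `L²`). -/
def superposition (F : ℝ → ℝ) (f : Lp ℝ 2 μ) : Lp ℝ 2 μ :=
  if h : MemLp (fun x => F (f x)) 2 μ then h.toLp _ else 0

/-- `u` is a mild solution on `[0,T]` with data `(u₀, u₁)`: it lies in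
`C([0,T]; H^1(A)) ∩ C^1([0,T]; L²)`, the Duhamel integral makes sense in `L²`, and
`u(t) = u_L(t) + ∫₀ᵗ 𝒟(t-τ, A) F(u(τ)) dτ`. -/
def IsMildSolution (A : Lp ℝ 2 μ →ₗ.[ℝ] Lp ℝ 2 μ) (F : ℝ → ℝ) (u₀ u₁ : Lp ℝ 2 μ) (T : ℝ)
    (u : ℝ → Lp ℝ 2 μ) : Prop :=
  InSolutionSpace A T u ∧
  (∀ τ ∈ Icc 0 T, MemLp (fun x => F (u τ x)) 2 μ) ∧
  ∀ t ∈ Icc 0 T,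
    IntervalIntegrable (fun τ => propD A (t - τ) (superposition F (u τ))) volume 0 t ∧
    u t = linearSolution A u₀ u₁ t + ∫ τ in (0)..t, propD A (t - τ) (superposition F (u τ))

/-- There is a unique mild solution on `[0,T]`. -/
def ExistsUniqueMildSolution (A : Lp ℝ 2 μ →ₗ.[ℝ] Lp ℝ 2 μ) (F : ℝ → ℝ) (u₀ u₁ : Lp ℝ 2 μ)
    (T : ℝ) : Prop :=
  ∃ u : ℝ → Lp ℝ 2 μ, IsMildSolution A F u₀ u₁ T u ∧
    ∀ v : ℝ → Lp ℝ 2 μ, IsMildSolution A F u₀ u₁ T v → EqOn v u (Icc 0 T)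

/-- The maximal existence time `T_max(u₀, u₁) ∈ [0, ∞]`. -/
def maximalTime (A : Lp ℝ 2 μ →ₗ.[ℝ] Lp ℝ 2 μ) (F : ℝ → ℝ) (u₀ u₁ : Lp ℝ 2 μ) : ℝ≥0∞ :=
  sSup {S | ∃ T : ℝ, 0 < T ∧ ExistsUniqueMildSolution A F u₀ u₁ T ∧ S = ENNReal.ofReal T}

/-- `u` is the solution on `[0, T_max)`. -/
def IsMaximalSolution (A : Lp ℝ 2 μ →ₗ.[ℝ] Lp ℝ 2 μ) (F : ℝ → ℝ) (u₀ u₁ : Lp ℝ 2 μ)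
    (u : ℝ → Lp ℝ 2 μ) : Prop :=
  ∀ T : ℝ, 0 < T → ENNReal.ofReal T < maximalTime A F u₀ u₁ → IsMildSolution A F u₀ u₁ T u

end Equation

end DampedWave

end

noncomputable section

namespace DampedWave

/-! ### Spectral measures and the bounded functional calculus -/

namespace ResolutionOfIdentity

variable {H : Type*} [NormedAddCommGroup H] [InnerProductSpace ℝ H] [CompleteSpace H]
  (E : ResolutionOfIdentity H)

/-! $H^1(A)$ is the range of the bounded injective operator $(I+A)^{-1/2}$, and
$\|(I+A)^{-1/2}v\|_{H^1(A)}=\|v\|_{L^2}$. Writing $u=(I+A)^{-1/2}v$ therefore turns the equation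
into a first-order system for the pair $U=(v,\partial_tu)\in L^2\times L^2$. The linear part is a
strongly continuous group $S(t)$ of $2\times2$ matrices of bounded functions of $A$ (`waveOp`), and
the nonlinearity is $\Phi(v,w)=(0,F((I+A)^{-1/2}v))$. In the moving frame $W(t)=S(-t)U(t)$ the mild
equation is the ODE $W'=S(-t)\Phi(S(t)W)$, in which no unbounded operator remains.

If $\Phi$ is Lipschitz on bounded sets, Picard-Lindelöf solves this ODE with a time step that
depends only on bounds for the starting time and the norm of the starting value
(`exists_local_solution`), and Gronwall gives uniqueness. The uniform step yields the existence
time, and also the blow-up: a small energy norm at one time close to $T_{\max}$ would allow a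
restart that passes $T_{\max}$. The two lemmas `isMildSolution_of_isSolution` and
`exists_isSolution_of_isMildSolution` identify ODE solutions with mild solutions.

By Hölder's inequality, the Lipschitz property follows from the Sobolev embedding $H^1(A)\subset
L^{2p}$ (`exists_bessel_bound`), which is the analytic core. It rests on
$(I+A)^{-1/2}=\Gamma(1/2)^{-1}\int_0^\infty e^{-t}t^{-1/2}e^{-tA}\,dt$. For $\alpha\le1/2$,
interpolation of (A) with the $L^2$ contraction leaves a convergent integral. For $\alpha>1/2$ the
same integral diverges logarithmically at the endpoint $2p=4\alpha/(2\alpha-1)$. There a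
Marcinkiewicz argument takes over (`exists_lintegral_bessel_critical`): at each level $s$ the time
integral is cut at a time $T(s)$ and $f$ is cut at a height $s^\gamma$, and the bounds (B) are used
for one exponent below $2$ and one above.

The functional calculus is built from the positive measures $d\|E(\lambda)f\|^2$ alone, by
polarization; its main tools are multiplicativity (`Bdd.op_mul`) and the isometry `Bdd.norm_op_sq`.
-/

theorem inner_proj_left (a : ℝ) (f h : H) : ⟪E.proj a f, h⟫_ℝ = ⟪f, E.proj a h⟫_ℝ := by
  have h1 := (E.isStarProjection a).isSelfAdjoint
  rw [← ContinuousLinearMap.adjoint_inner_right, ← ContinuousLinearMap.star_eq_adjoint, h1.star_eq]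

theorem proj_proj (a b : ℝ) (f : H) : E.proj a (E.proj b f) = E.proj (min a b) f := by
  rcases le_total a b with h | h
  · rw [min_eq_left h]
    exact congrArg (fun T : H →L[ℝ] H => T f) (E.proj_mul_proj a b h)
  · rw [min_eq_right h]
    have h1 := congrArg star (E.proj_mul_proj b a h)
    rw [star_mul, (E.isStarProjection a).isSelfAdjoint.star_eq,
      (E.isStarProjection b).isSelfAdjoint.star_eq] at h1
    exact congrArg (fun T : H →L[ℝ] H => T f) h1

theorem tendsto_distribution_atBot (f : H) :
    Tendsto (E.distribution f) atBot (𝓝 0) := by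
  have h := ((E.tendsto_atBot f).norm).pow 2
  rwa [norm_zero, zero_pow two_ne_zero] at h

theorem tendsto_distribution_atTop (f : H) :
    Tendsto (E.distribution f) atTop (𝓝 (‖f‖ ^ 2)) :=
  ((E.tendsto_atTop f).norm).pow 2

theorem measure_Iic (f : H) (a : ℝ) :
    E.measure f (Iic a) = ENNReal.ofReal (‖E.proj a f‖ ^ 2) := by
  rw [measure, StieltjesFunction.measure_Iic _ (E.tendsto_distribution_atBot f), sub_zero]
  rfl

theorem measure_univ (f : H) : E.measure f univ = ENNReal.ofReal (‖f‖ ^ 2) := by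
  rw [measure, StieltjesFunction.measure_univ _ (E.tendsto_distribution_atBot f)
    (E.tendsto_distribution_atTop f), sub_zero]

instance isFiniteMeasure_measure (f : H) : IsFiniteMeasure (E.measure f) :=
  ⟨by rw [measure_univ]; exact ENNReal.ofReal_lt_top⟩

theorem real_measure_univ (f : H) : (E.measure f).real univ = ‖f‖ ^ 2 := by
  rw [Measure.real, measure_univ, ENNReal.toReal_ofReal (by positivity)]

theorem real_measure_Iic (f : H) (a : ℝ) : (E.measure f).real (Iic a) = ‖E.proj a f‖ ^ 2 := by
  rw [Measure.real, measure_Iic, ENNReal.toReal_ofReal (by positivity)]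

/-- Finite measures on the line are determined by their distribution functions. Hence every
algebraic identity between the quadratic forms $\|E(a)f\|^2$, $a\in\mathbb R$, becomes an identity
between spectral measures. -/
theorem measure_eq_of_real_Iic {m₁ m₂ : Measure ℝ} [IsFiniteMeasure m₁] [IsFiniteMeasure m₂]
    (h : ∀ a, m₁.real (Iic a) = m₂.real (Iic a)) : m₁ = m₂ := by
  refine Measure.ext_of_Iic _ _ fun a => ?_
  have := h a
  rwa [Measure.real, Measure.real, ENNReal.toReal_eq_toReal_iff' (measure_ne_top _ _)
    (measure_ne_top _ _)] at this

theorem measure_neg (f : H) : E.measure (-f) = E.measure f :=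
  measure_eq_of_real_Iic fun a => by simp [real_measure_Iic]

theorem measure_sub_comm (f h : H) : E.measure (f - h) = E.measure (h - f) := by
  rw [← neg_sub, measure_neg]

theorem measure_zero : E.measure (0 : H) = 0 :=
  measure_eq_of_real_Iic fun a => by simp [real_measure_Iic]

theorem measure_smul (c : ℝ) (f : H) :
    E.measure (c • f) = ENNReal.ofReal (c ^ 2) • E.measure f := by
  have : IsFiniteMeasure (ENNReal.ofReal (c ^ 2) • E.measure f) :=
    Measure.smul_finite _ ENNReal.ofReal_ne_top
  refine measure_eq_of_real_Iic fun a => ?_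
  rw [measureReal_ennreal_smul_apply, ENNReal.toReal_ofReal (sq_nonneg c)]
  simp [real_measure_Iic, norm_smul, mul_pow]

theorem measure_add_add_sub (f h : H) :
    E.measure (f + h) + E.measure (f - h) = (2 : ℝ≥0∞) • (E.measure f + E.measure h) := by
  have : IsFiniteMeasure ((2 : ℝ≥0∞) • (E.measure f + E.measure h)) :=
    Measure.smul_finite _ (by simp)
  refine measure_eq_of_real_Iic fun a => ?_
  rw [measureReal_ennreal_smul_apply, measureReal_add_apply, measureReal_add_apply]
  simp only [real_measure_Iic, map_add, map_sub, norm_add_sq_real, norm_sub_sq_real]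
  simp
  ring

theorem measure_add_le (f h : H) :
    E.measure (f + h) ≤ (2 : ℝ≥0∞) • (E.measure f + E.measure h) := by
  rw [← measure_add_add_sub]
  exact Measure.le_add_right le_rfl

theorem measure_sub_le (f h : H) :
    E.measure (f - h) ≤ (2 : ℝ≥0∞) • (E.measure f + E.measure h) := by
  rw [← measure_add_add_sub]
  exact Measure.le_add_left le_rfl

/-- Additivity of the polarized form in its first argument, with all negative terms moved across so
that only positive measures occur. The next two identities do the same for scaling and for spectral
projections. -/
theorem measure_add_identity (f g h : H) :
    E.measure (f + g + h) + (E.measure (f - h) + E.measure (g - h)) =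
      E.measure (f + g - h) + (E.measure (f + h) + E.measure (g + h)) := by
  refine measure_eq_of_real_Iic fun a => ?_
  rw [measureReal_add_apply, measureReal_add_apply, measureReal_add_apply, measureReal_add_apply]
  simp only [real_measure_Iic, map_add, map_sub, norm_add_sq_real, norm_sub_sq_real,
    inner_add_left]
  ring

theorem measure_smul_identity {c : ℝ} (hc : 0 ≤ c) (f h : H) :
    E.measure (c • f + h) + ENNReal.ofReal c • E.measure (f - h) =
      E.measure (c • f - h) + ENNReal.ofReal c • E.measure (f + h) := by
  have h1 : ∀ k, IsFiniteMeasure (ENNReal.ofReal c • E.measure k) := fun k =>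
    Measure.smul_finite _ ENNReal.ofReal_ne_top
  refine measure_eq_of_real_Iic fun a => ?_
  rw [measureReal_add_apply, measureReal_add_apply]
  simp only [measureReal_ennreal_smul_apply, ENNReal.toReal_ofReal hc,
    real_measure_Iic, map_add, map_sub, map_smul, norm_add_sq_real,
    norm_sub_sq_real, real_inner_smul_left]
  ring

theorem measure_proj_identity (a : ℝ) (f h : H) :
    E.measure (E.proj a f + h) + (E.measure (f - h)).restrict (Iic a) =
      E.measure (E.proj a f - h) + (E.measure (f + h)).restrict (Iic a) := by
  refine measure_eq_of_real_Iic fun b => ?_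
  rw [measureReal_add_apply, measureReal_add_apply]
  simp only [measureReal_restrict_apply measurableSet_Iic, Iic_inter_Iic,
    real_measure_Iic, map_add, map_sub, proj_proj, norm_add_sq_real, norm_sub_sq_real]
  have h1 : ∀ c, c = min b a → ⟪E.proj c f, E.proj b h⟫_ℝ = ⟪E.proj c f, E.proj c h⟫_ℝ := by
    rintro c rfl
    rw [← inner_proj_left, proj_proj, ← inner_proj_left, proj_proj, min_self]
    congr 3
    rw [min_eq_right (min_le_left _ _)]
  rw [h1 _ rfl]
  ring

/-- The function `φ` is measurable and bounded almost everywhere for every spectral measure, with a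
common bound. -/
def Bdd (φ : ℝ → ℝ) : Prop :=
  Measurable φ ∧ ∃ C, ∀ f, ∀ᵐ l ∂(E.measure f), |φ l| ≤ C

variable {E} {φ ψ : ℝ → ℝ}

theorem Bdd.of_forall (hφ : Measurable φ) {C : ℝ} (h : ∀ l, |φ l| ≤ C) : E.Bdd φ :=
  ⟨hφ, C, fun _ => Eventually.of_forall h⟩

theorem Bdd.const (c : ℝ) : E.Bdd fun _ => c :=
  .of_forall measurable_const fun _ => le_rfl

theorem Bdd.indicator_Iic (a : ℝ) : E.Bdd ((Iic a).indicator 1) := by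
  refine .of_forall (C := 1) (measurable_one.indicator measurableSet_Iic) fun l => ?_
  by_cases h : l ∈ Iic a <;> simp [h]

theorem Bdd.add (hφ : E.Bdd φ) (hψ : E.Bdd ψ) : E.Bdd fun l => φ l + ψ l := by
  obtain ⟨h1, C, hC⟩ := hφ
  obtain ⟨h2, D, hD⟩ := hψ
  refine ⟨h1.add h2, C + D, fun f => ?_⟩
  filter_upwards [hC f, hD f] with l h3 h4
  exact (abs_add_le _ _).trans (add_le_add h3 h4)

theorem Bdd.mul (hφ : E.Bdd φ) (hψ : E.Bdd ψ) : E.Bdd fun l => φ l * ψ l := by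
  obtain ⟨h1, C, hC⟩ := hφ
  obtain ⟨h2, D, hD⟩ := hψ
  refine ⟨h1.mul h2, C * D, fun f => ?_⟩
  filter_upwards [hC f, hD f] with l h3 h4
  rw [abs_mul]
  exact mul_le_mul h3 h4 (abs_nonneg _) ((abs_nonneg _).trans h3)

theorem Bdd.neg (hφ : E.Bdd φ) : E.Bdd fun l => -φ l :=
  ⟨hφ.1.neg, by simpa using hφ.2⟩

theorem Bdd.sub (hφ : E.Bdd φ) (hψ : E.Bdd ψ) : E.Bdd fun l => φ l - ψ l := by
  simpa only [sub_eq_add_neg] using hφ.add hψ.neg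

theorem Bdd.integrable (hφ : E.Bdd φ) (f : H) : Integrable φ (E.measure f) := by
  obtain ⟨h1, C, hC⟩ := hφ
  exact Integrable.of_bound h1.aestronglyMeasurable C (hC f)

theorem Bdd.memDom (hφ : E.Bdd φ) (f : H) : E.MemDom φ f := by
  have h := (hφ.mul hφ).integrable f
  have h2 := h.lintegral_lt_top
  simpa only [MemDom, sq] using h2

theorem weakIntegral_comm (φ : ℝ → ℝ) (f h : H) :
    E.weakIntegral φ f h = E.weakIntegral φ h f := by
  rw [weakIntegral, weakIntegral, add_comm f h, measure_sub_comm]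

theorem weakIntegral_add_left {f g h : H}
    (hφ : ∀ k ∈ ({f + g + h, f - h, g - h, f + g - h, f + h, g + h} : Set H),
      Integrable φ (E.measure k)) :
    E.weakIntegral φ (f + g) h = E.weakIntegral φ f h + E.weakIntegral φ g h := by
  simp only [mem_insert_iff, mem_singleton_iff, forall_eq_or_imp, forall_eq] at hφ
  obtain ⟨h1, h2, h3, h4, h5, h6⟩ := hφ
  have key := congrArg (fun m => ∫ l, φ l ∂m) (E.measure_add_identity f g h)
  rw [integral_add_measure h1 (h2.add_measure h3), integral_add_measure h2 h3,
    integral_add_measure h4 (h5.add_measure h6), integral_add_measure h5 h6] at key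
  simp only [weakIntegral]
  linarith

theorem weakIntegral_neg_left (f h : H) :
    E.weakIntegral φ (-f) h = -E.weakIntegral φ f h := by
  have h1 : E.measure (-f + h) = E.measure (f - h) := by rw [← measure_neg]; congr 1; abel
  have h2 : E.measure (-f - h) = E.measure (f + h) := by rw [← measure_neg]; congr 1; abel
  rw [weakIntegral, weakIntegral, h1, h2]
  ring

theorem Bdd.weakIntegral_smul_left (hφ : E.Bdd φ) (c : ℝ) (f h : H) :
    E.weakIntegral φ (c • f) h = c * E.weakIntegral φ f h := by
  have pos : ∀ c : ℝ, 0 ≤ c → E.weakIntegral φ (c • f) h = c * E.weakIntegral φ f h := by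
    intro c hc
    have key := congrArg (fun m => ∫ l, φ l ∂m) (E.measure_smul_identity hc f h)
    rw [integral_add_measure (hφ.integrable _)
        ((hφ.integrable _).smul_measure ENNReal.ofReal_ne_top),
      integral_add_measure (hφ.integrable _)
        ((hφ.integrable _).smul_measure ENNReal.ofReal_ne_top), integral_smul_measure,
      integral_smul_measure, ENNReal.toReal_ofReal hc, smul_eq_mul, smul_eq_mul] at key
    simp only [weakIntegral]
    linarith
  rcases le_total 0 c with hc | hc
  · exact pos c hc
  · have := pos (-c) (by linarith)
    rw [neg_smul, weakIntegral_neg_left] at this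
    linarith

theorem weakIntegral_self (φ : ℝ → ℝ) (f : H) :
    E.weakIntegral φ f f = ∫ l, φ l ∂(E.measure f) := by
  rw [weakIntegral, sub_self, measure_zero, ← two_smul ℝ f, measure_smul, integral_smul_measure]
  norm_num
  ring

theorem abs_integral_le {C : ℝ} (hC : ∀ f, ∀ᵐ l ∂(E.measure f), |φ l| ≤ C) (f : H) :
    |∫ l, φ l ∂(E.measure f)| ≤ C * ‖f‖ ^ 2 := by
  have h := norm_integral_le_of_norm_le_const (μ := E.measure f) (f := φ) (C := C) (hC f)
  rwa [real_measure_univ] at h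

/-- Polarization and the parallelogram law give the bound $\frac C2(\|f\|^2+\|h\|^2)$; normalizing
both vectors turns it into a product bound. -/
theorem Bdd.abs_weakIntegral_le (hφ : E.Bdd φ) {C : ℝ}
    (hC : ∀ f, ∀ᵐ l ∂(E.measure f), |φ l| ≤ C) (f h : H) :
    |E.weakIntegral φ f h| ≤ C * ‖f‖ * ‖h‖ := by
  have quad : ∀ f h : H, |E.weakIntegral φ f h| ≤ C / 2 * (‖f‖ ^ 2 + ‖h‖ ^ 2) := by
    intro f h
    have h1 := abs_le.1 (abs_integral_le hC (f + h))
    have h2 := abs_le.1 (abs_integral_le hC (f - h))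
    rw [norm_add_sq_real] at h1
    rw [norm_sub_sq_real] at h2
    rw [weakIntegral, abs_le]
    constructor <;> linarith
  rcases eq_or_ne f 0 with rfl | hf
  · have := hφ.weakIntegral_smul_left 0 0 h
    simp only [zero_smul, zero_mul] at this
    simp [this]
  rcases eq_or_ne h 0 with rfl | hh
  · have := hφ.weakIntegral_smul_left 0 0 f
    simp only [zero_smul, zero_mul] at this
    simp [weakIntegral_comm φ f 0, this]
  have hf' := norm_pos_iff.2 hf
  have hh' := norm_pos_iff.2 hh
  have h1 := quad (‖f‖⁻¹ • f) (‖h‖⁻¹ • h)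
  rw [hφ.weakIntegral_smul_left, weakIntegral_comm, hφ.weakIntegral_smul_left, weakIntegral_comm,
    norm_smul, norm_smul, norm_inv, norm_inv, norm_norm, norm_norm, inv_mul_cancel₀ hf'.ne',
    inv_mul_cancel₀ hh'.ne', abs_mul, abs_mul, abs_of_pos (inv_pos.2 hf'),
    abs_of_pos (inv_pos.2 hh')] at h1
  have h2 : ‖f‖⁻¹ * (‖h‖⁻¹ * |E.weakIntegral φ f h|) ≤ C := by linarith
  rw [inv_mul_le_iff₀ hf', inv_mul_le_iff₀ hh'] at h2
  linarith

theorem Bdd.weakIntegral_add (hφ : E.Bdd φ) (f g h : H) :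
    E.weakIntegral φ (f + g) h = E.weakIntegral φ f h + E.weakIntegral φ g h :=
  weakIntegral_add_left fun k _ => hφ.integrable k

theorem Bdd.exists_op (hφ : E.Bdd φ) {C : ℝ} (hC : ∀ f, ∀ᵐ l ∂(E.measure f), |φ l| ≤ C) :
    ∃ T : H →L[ℝ] H, (∀ f h, ⟪T f, h⟫_ℝ = E.weakIntegral φ f h) := by
  let B : H →ₗ[ℝ] H →ₗ[ℝ] ℝ := LinearMap.mk₂ ℝ (E.weakIntegral φ) hφ.weakIntegral_add
    hφ.weakIntegral_smul_left
    (fun f g h => by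
      rw [weakIntegral_comm, hφ.weakIntegral_add, weakIntegral_comm φ g, weakIntegral_comm φ h])
    (fun c f g => by
      rw [weakIntegral_comm, hφ.weakIntegral_smul_left, weakIntegral_comm, smul_eq_mul])
  let B' : H →L[ℝ] H →L[ℝ] ℝ := B.mkContinuous₂ C fun f h => by
    simpa [B] using hφ.abs_weakIntegral_le hC f h
  let T : H →ₗ[ℝ] H :=
    { toFun := fun f => (InnerProductSpace.toDual ℝ H).symm (B' f)
      map_add' := fun f g => by simp
      map_smul' := fun c f => by simp }
  refine ⟨T.mkContinuous ‖B'‖ fun f => ?_, fun f h => ?_⟩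
  · simpa [T] using B'.le_opNorm f
  · simp [T, InnerProductSpace.toDual_symm_apply, B', B]

open Classical in
variable (E) in
/-- The bounded operator `∫ φ(l) dE(l)` (and `0` for a function without a common bound). -/
def op (φ : ℝ → ℝ) : H →L[ℝ] H :=
  if h : ∃ T : H →L[ℝ] H, (∀ f h, ⟪T f, h⟫_ℝ = E.weakIntegral φ f h) then h.choose else 0

theorem Bdd.inner_op (hφ : E.Bdd φ) (f h : H) : ⟪E.op φ f, h⟫_ℝ = E.weakIntegral φ f h := by
  obtain ⟨C, hC⟩ := hφ.2
  have := hφ.exists_op hC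
  rw [op, dif_pos this]
  exact this.choose_spec f h

theorem Bdd.op_eq (hφ : E.Bdd φ) {T : H →L[ℝ] H}
    (hT : ∀ f h, ⟪T f, h⟫_ℝ = E.weakIntegral φ f h) : E.op φ = T := by
  ext1 f
  refine ext_inner_right ℝ fun h => ?_
  rw [hφ.inner_op, hT]

theorem weakIntegral_congr (h : ∀ f, φ =ᵐ[E.measure f] ψ) (f g : H) :
    E.weakIntegral φ f g = E.weakIntegral ψ f g := by
  rw [weakIntegral, weakIntegral, integral_congr_ae (h _), integral_congr_ae (h _)]

theorem op_congr (h : ∀ f, φ =ᵐ[E.measure f] ψ) : E.op φ = E.op ψ := by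
  have e : E.weakIntegral φ = E.weakIntegral ψ :=
    funext fun f => funext fun g => weakIntegral_congr h f g
  unfold op
  rw [e]

theorem Bdd.inner_op_left (hφ : E.Bdd φ) (f h : H) : ⟪E.op φ f, h⟫_ℝ = ⟪f, E.op φ h⟫_ℝ := by
  rw [hφ.inner_op, weakIntegral_comm, ← hφ.inner_op, real_inner_comm]

theorem Bdd.op_add (hφ : E.Bdd φ) (hψ : E.Bdd ψ) :
    E.op (fun l => φ l + ψ l) = E.op φ + E.op ψ := by
  refine (hφ.add hψ).op_eq fun f h => ?_
  rw [add_apply, inner_add_left, hφ.inner_op, hψ.inner_op, weakIntegral,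
    weakIntegral, weakIntegral, integral_add (hφ.integrable _) (hψ.integrable _),
    integral_add (hφ.integrable _) (hψ.integrable _)]
  ring

theorem Bdd.op_neg (hφ : E.Bdd φ) : E.op (fun l => -φ l) = -E.op φ := by
  refine hφ.neg.op_eq fun f h => ?_
  rw [neg_apply, inner_neg_left, hφ.inner_op, weakIntegral,
    weakIntegral, integral_neg, integral_neg]
  ring

theorem Bdd.op_sub (hφ : E.Bdd φ) (hψ : E.Bdd ψ) :
    E.op (fun l => φ l - ψ l) = E.op φ - E.op ψ := by
  simp only [sub_eq_add_neg]
  rw [hφ.op_add hψ.neg, hψ.op_neg]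

theorem op_indicator_Iic (a : ℝ) : E.op ((Iic a).indicator 1) = E.proj a := by
  refine (Bdd.indicator_Iic a).op_eq fun f h => ?_
  have h1 : ⟪E.proj a f, h⟫_ℝ = ⟪E.proj a f, E.proj a h⟫_ℝ := by
    rw [← inner_proj_left, proj_proj, min_self]
  rw [weakIntegral, integral_indicator_one measurableSet_Iic,
    integral_indicator_one measurableSet_Iic, real_measure_Iic, real_measure_Iic, map_add, map_sub,
    norm_add_sq_real, norm_sub_sq_real, h1]
  ring

/-- Integrability is required only at the four vectors that occur, so that the unbounded function
$\varphi(\lambda)=\lambda$ is covered. -/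
theorem weakIntegral_proj_left (a : ℝ) (f h : H)
    (hφ : ∀ k ∈ ({E.proj a f + h, f - h, E.proj a f - h, f + h} : Set H),
      Integrable φ (E.measure k)) :
    E.weakIntegral φ (E.proj a f) h = E.weakIntegral ((Iic a).indicator φ) f h := by
  simp only [mem_insert_iff, mem_singleton_iff, forall_eq_or_imp, forall_eq] at hφ
  obtain ⟨h1, h2, h3, h4⟩ := hφ
  have key := congrArg (fun m => ∫ l, φ l ∂m) (E.measure_proj_identity a f h)
  rw [integral_add_measure h1 h2.restrict, integral_add_measure h3 h4.restrict] at key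
  simp only [weakIntegral, integral_indicator measurableSet_Iic]
  linarith

theorem Bdd.indicator (hφ : E.Bdd φ) {s : Set ℝ} (hs : MeasurableSet s) :
    E.Bdd (s.indicator φ) := by
  obtain ⟨h1, C, hC⟩ := hφ
  refine ⟨h1.indicator hs, C, fun f => ?_⟩
  filter_upwards [hC f] with l hl
  by_cases h : l ∈ s <;> simp only [h, indicator_of_mem, not_false_eq_true, indicator_of_notMem]
  · exact hl
  · simpa using (abs_nonneg _).trans hl

theorem Bdd.op_proj (hφ : E.Bdd φ) (a : ℝ) (f : H) :
    E.op φ (E.proj a f) = E.op ((Iic a).indicator φ) f := by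
  refine ext_inner_right ℝ fun h => ?_
  rw [hφ.inner_op, (hφ.indicator measurableSet_Iic).inner_op, weakIntegral_proj_left]
  exact fun k _ => hφ.integrable k

theorem Bdd.proj_op (hφ : E.Bdd φ) (a : ℝ) (f : H) :
    E.proj a (E.op φ f) = E.op ((Iic a).indicator φ) f := by
  refine ext_inner_right ℝ fun h => ?_
  rw [inner_proj_left, hφ.inner_op_left, hφ.op_proj,
    (hφ.indicator measurableSet_Iic).inner_op_left]

/-- For $\varphi\ge0$ the weighted spectral measures $\varphi\,d\|E f\|^2$ are again positive
measures. Comparison on half-lines shows that the polarized measure of $\varphi(A)f$ and $h$ is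
$\varphi$ times that of $f$ and $h$; integrating $\psi$ against both gives the product rule. -/
theorem Bdd.op_mul_of_nonneg (hφ : E.Bdd φ) (hψ : E.Bdd ψ) (h0 : ∀ l, 0 ≤ φ l) (f : H) :
    E.op ψ (E.op φ f) = E.op (fun l => ψ l * φ l) f := by
  refine ext_inner_right ℝ fun h => ?_
  set m : H → Measure ℝ := fun k => (E.measure k).withDensity fun l => ENNReal.ofReal (φ l)
  have hm : ∀ k, IsFiniteMeasure (m k) := fun k =>
    isFiniteMeasure_withDensity_ofReal (hφ.integrable k).2
  have hreal : ∀ k a, (m k).real (Iic a) = ∫ l, (Iic a).indicator φ l ∂(E.measure k) := by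
    intro k a
    rw [Measure.real, withDensity_apply _ measurableSet_Iic, integral_indicator measurableSet_Iic,
      integral_eq_lintegral_of_nonneg_ae (Eventually.of_forall h0)
        hφ.1.aestronglyMeasurable]
  have hint : ∀ k, ∫ l, ψ l ∂(m k) = ∫ l, ψ l * φ l ∂(E.measure k) := by
    intro k
    rw [integral_withDensity_eq_integral_toReal_smul hφ.1.ennreal_ofReal
      (Eventually.of_forall fun _ => ENNReal.ofReal_lt_top)]
    refine integral_congr_ae (Eventually.of_forall fun l => ?_)
    simp only [ENNReal.toReal_ofReal (h0 l), smul_eq_mul, mul_comm]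
  have hψm : ∀ k, Integrable ψ (m k) := by
    intro k
    obtain ⟨C, hC⟩ := hψ.2
    exact Integrable.of_bound hψ.1.aestronglyMeasurable C
      ((withDensity_absolutelyContinuous _ _).ae_le (hC k))
  have hmeas : E.measure (E.op φ f + h) + m (f - h) = E.measure (E.op φ f - h) + m (f + h) := by
    refine measure_eq_of_real_Iic fun a => ?_
    rw [measureReal_add_apply, measureReal_add_apply, hreal, hreal, real_measure_Iic,
      real_measure_Iic, map_add, map_sub, norm_add_sq_real, norm_sub_sq_real]
    have h1 : ⟪E.proj a (E.op φ f), E.proj a h⟫_ℝ =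
        E.weakIntegral ((Iic a).indicator φ) f h := by
      rw [← inner_proj_left, proj_proj, min_self, hφ.proj_op,
        (hφ.indicator measurableSet_Iic).inner_op]
    rw [h1, weakIntegral]
    ring
  have key := congrArg (fun m => ∫ l, ψ l ∂m) hmeas
  rw [integral_add_measure (hψ.integrable _) (hψm _),
    integral_add_measure (hψ.integrable _) (hψm _), hint, hint] at key
  rw [hψ.inner_op, (hψ.mul hφ).inner_op, weakIntegral, weakIntegral]
  linarith

/-- Split $\varphi$ into its positive and negative parts. -/
theorem Bdd.op_mul (hψ : E.Bdd ψ) (hφ : E.Bdd φ) (f : H) :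
    E.op ψ (E.op φ f) = E.op (fun l => ψ l * φ l) f := by
  have bdd_max : ∀ {χ : ℝ → ℝ}, E.Bdd χ → E.Bdd fun l => max (χ l) 0 := by
    rintro χ ⟨h1, C, hC⟩
    refine ⟨h1.max measurable_const, C, fun f => ?_⟩
    filter_upwards [hC f] with l hl
    rw [abs_of_nonneg (le_max_right _ _)]
    exact max_le ((le_abs_self _).trans hl) ((abs_nonneg _).trans hl)
  have hp := bdd_max hφ
  have hn := bdd_max hφ.neg
  have e : ∀ l, φ l = max (φ l) 0 - max (-φ l) 0 := fun l => by
    rcases le_total 0 (φ l) with h | h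
    · rw [max_eq_left h, max_eq_right (by linarith)]; ring
    · rw [max_eq_right h, max_eq_left (by linarith)]; ring
  have h1 : E.op φ = E.op (fun l => max (φ l) 0) - E.op (fun l => max (-φ l) 0) := by
    rw [← hp.op_sub hn]
    congr 1
    exact funext e
  have h2 : E.op (fun l => ψ l * φ l) =
      E.op (fun l => ψ l * max (φ l) 0) - E.op (fun l => ψ l * max (-φ l) 0) := by
    rw [← (hψ.mul hp).op_sub (hψ.mul hn)]
    congr 1
    funext l
    rw [← mul_sub, ← e]
  rw [h1, h2, sub_apply, sub_apply, map_sub,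
    hp.op_mul_of_nonneg hψ fun l => le_max_right _ _,
    hn.op_mul_of_nonneg hψ fun l => le_max_right _ _]

theorem op_one : E.op (fun _ => 1) = 1 := by
  refine (Bdd.const 1).op_eq fun f h => ?_
  rw [weakIntegral, integral_const, integral_const, real_measure_univ, real_measure_univ,
    norm_add_sq_real, norm_sub_sq_real]
  simp
  ring

/-- Symmetry and multiplicativity reduce the left side to the quadratic form of $\varphi^2$.
Operator bounds and strong limits below all come from this isometry. -/
theorem Bdd.norm_op_sq (hφ : E.Bdd φ) (f : H) :
    ‖E.op φ f‖ ^ 2 = ∫ l, φ l ^ 2 ∂(E.measure f) := by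
  rw [← real_inner_self_eq_norm_sq, hφ.inner_op_left, hφ.op_mul hφ, real_inner_comm,
    (hφ.mul hφ).inner_op, weakIntegral_self]
  simp only [sq]

theorem Bdd.norm_op_le (hφ : E.Bdd φ) {C : ℝ} (h0 : 0 ≤ C)
    (hC : ∀ f, ∀ᵐ l ∂(E.measure f), |φ l| ≤ C) : ‖E.op φ‖ ≤ C := by
  refine ContinuousLinearMap.opNorm_le_bound _ h0 fun f => ?_
  refine abs_le_of_sq_le_sq' ?_ (by positivity) |>.2
  rw [hφ.norm_op_sq, mul_pow, ← real_measure_univ E]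
  refine (Real.le_norm_self _).trans (norm_integral_le_of_norm_le_const ?_)
  filter_upwards [hC f] with l hl
  rw [norm_pow, Real.norm_eq_abs]
  exact pow_le_pow_left₀ (abs_nonneg _) hl 2

theorem Bdd.measure_op (hφ : E.Bdd φ) (f : H) :
    E.measure (E.op φ f) = (E.measure f).withDensity fun l => ENNReal.ofReal (φ l ^ 2) := by
  have hφ2 : E.Bdd fun l => φ l ^ 2 := by simpa only [sq] using hφ.mul hφ
  have : IsFiniteMeasure ((E.measure f).withDensity fun l => ENNReal.ofReal (φ l ^ 2)) :=
    isFiniteMeasure_withDensity_ofReal (hφ2.integrable f).2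
  refine measure_eq_of_real_Iic fun a => ?_
  rw [real_measure_Iic, hφ.proj_op, (hφ.indicator measurableSet_Iic).norm_op_sq, Measure.real,
    withDensity_apply _ measurableSet_Iic]
  rw [← integral_eq_lintegral_of_nonneg_ae (Eventually.of_forall fun l => sq_nonneg _)
    hφ2.1.aestronglyMeasurable, ← integral_indicator measurableSet_Iic]
  congr 1
  funext l
  by_cases h : l ∈ Iic a <;> simp [h]

end ResolutionOfIdentity

/-! ### Resolutions supported in the half-line; the energy space as the range of $(I+A)^{-1/2}$ -/

namespace ResolutionOfIdentity

variable {H : Type*} [NormedAddCommGroup H] [InnerProductSpace ℝ H] [CompleteSpace H]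
  {E : ResolutionOfIdentity H} {φ ψ : ℝ → ℝ}

theorem MemDom.memLp (hφ : Measurable φ) {f : H} (h : E.MemDom φ f) : MemLp φ 2 (E.measure f) := by
  refine ⟨hφ.aestronglyMeasurable, ?_⟩
  rw [eLpNorm_lt_top_iff_lintegral_rpow_enorm_lt_top two_ne_zero ENNReal.ofNat_ne_top]
  refine lt_of_le_of_lt (le_of_eq ?_) h
  refine lintegral_congr fun l => ?_
  rw [← sq_abs, ENNReal.ofReal_pow (abs_nonneg _), ← Real.norm_eq_abs, ofReal_norm]
  simp

theorem MemDom.integrable (hφ : Measurable φ) {f : H} (h : E.MemDom φ f) :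
    Integrable φ (E.measure f) :=
  (h.memLp hφ).integrable (by norm_num)

theorem MemDom.of_measure_le {f g h : H} (hf : E.MemDom φ f) (hg : E.MemDom φ g)
    (hle : E.measure h ≤ (2 : ℝ≥0∞) • (E.measure f + E.measure g)) : E.MemDom φ h := by
  refine lt_of_le_of_lt (lintegral_mono' hle le_rfl) ?_
  rw [lintegral_smul_measure, lintegral_add_measure]
  exact ENNReal.mul_lt_top (by simp) (ENNReal.add_lt_top.2 ⟨hf, hg⟩)

theorem MemDom.add {f g : H} (hf : E.MemDom φ f) (hg : E.MemDom φ g) : E.MemDom φ (f + g) :=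
  hf.of_measure_le hg (E.measure_add_le f g)

theorem MemDom.sub {f g : H} (hf : E.MemDom φ f) (hg : E.MemDom φ g) : E.MemDom φ (f - g) :=
  hf.of_measure_le hg (E.measure_sub_le f g)

theorem Bdd.hasValue_iff (hφ : E.Bdd φ) {f g : H} : E.HasValue φ f g ↔ g = E.op φ f := by
  constructor
  · intro h
    refine ext_inner_right ℝ fun k => ?_
    rw [h.2 k (hφ.memDom k), hφ.inner_op]
  · rintro rfl
    exact ⟨hφ.memDom f, fun h _ => hφ.inner_op f h⟩

variable (E) in
/-- The resolution of the identity is supported in `[0, ∞)`. -/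
def Nonneg : Prop := ∀ a < 0, E.proj a = 0

theorem Nonneg.ae_nonneg (hE : E.Nonneg) (f : H) : ∀ᵐ l ∂(E.measure f), 0 ≤ l := by
  rw [ae_iff]
  refine measure_mono_null (t := ⋃ n : ℕ, Iic (-(1 / ((n : ℝ) + 1)))) ?_ ?_
  · intro l hl
    simp only [not_le, mem_ofPred_eq] at hl
    obtain ⟨n, hn⟩ := exists_nat_one_div_lt (neg_pos.2 hl)
    exact mem_iUnion.2 ⟨n, by simp only [mem_Iic]; linarith⟩
  · refine measure_iUnion_null fun n => ?_
    rw [measure_Iic, hE _ (neg_neg_of_pos (by positivity))]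
    simp

theorem Nonneg.bdd (hE : E.Nonneg) (hφ : Measurable φ) {C : ℝ} (h : ∀ l, 0 ≤ l → |φ l| ≤ C) :
    E.Bdd φ :=
  ⟨hφ, C, fun f => (hE.ae_nonneg f).mono h⟩

theorem Nonneg.norm_op_le (hE : E.Nonneg) (hφ : Measurable φ) {C : ℝ}
    (h : ∀ l, 0 ≤ l → |φ l| ≤ C) : ‖E.op φ‖ ≤ C :=
  (hE.bdd hφ h).norm_op_le ((abs_nonneg _).trans (h 0 le_rfl))
    fun f => (hE.ae_nonneg f).mono h

theorem Nonneg.op_congr (hE : E.Nonneg) (h : ∀ l, 0 ≤ l → φ l = ψ l) : E.op φ = E.op ψ :=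
  ResolutionOfIdentity.op_congr fun f => (hE.ae_nonneg f).mono h

theorem measure_proj_sub_compl (a b : ℝ) (g : H) (hab : a ≤ b) :
    ∀ᵐ l ∂(E.measure (E.proj b g - E.proj a g)), l ∈ Ioc a b := by
  have h1 : E.measure (E.proj b g - E.proj a g) (Iic a) = 0 := by
    rw [measure_Iic, map_sub, proj_proj, proj_proj, min_eq_left hab, min_self]
    simp
  have h2 : E.measure (E.proj b g - E.proj a g) (Ioi b) = 0 := by
    rw [← compl_Iic, measure_compl measurableSet_Iic (measure_ne_top _ _), measure_Iic, measure_univ,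
      map_sub, proj_proj, proj_proj, min_eq_right hab, min_self, tsub_self]
  rw [ae_iff]
  refine measure_mono_null (t := Iic a ∪ Ioi b) ?_ (measure_union_null h1 h2)
  intro l hl
  simp only [mem_Ioc, not_and_or, not_lt, not_le, mem_ofPred_eq] at hl
  simpa using hl

/-- On the spectral subspace of a bounded interval the symbol $\lambda$ agrees with a bounded
truncation. The value has to be tested against every vector $h$ of the unbounded domain, so the
truncation must be produced inside the polarized integral over $f\pm h$. -/
theorem hasValue_id_proj_sub (a b : ℝ) (g : H) (hab : a ≤ b) :
    ∃ k, E.HasValue (fun l => l) (E.proj b g - E.proj a g) k := by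
  set f := E.proj b g - E.proj a g with hf
  have hbdd : E.Bdd ((Ioc a b).indicator fun l => l) := by
    refine .of_forall (C := max |a| |b|) (measurable_id.indicator measurableSet_Ioc) fun l => ?_
    by_cases h : l ∈ Ioc a b
    · rw [indicator_of_mem h]
      exact abs_le_max_abs_abs h.1.le h.2
    · rw [indicator_of_notMem h]
      simp
  have hdom : E.MemDom (fun l => l) f := by
    have h := hbdd.memDom f
    rw [MemDom] at h ⊢
    refine lt_of_le_of_lt (le_of_eq (lintegral_congr_ae ?_)) h
    filter_upwards [measure_proj_sub_compl a b g hab] with l hl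
    rw [indicator_of_mem hl]
  have hfb : E.proj b f = f := by
    rw [hf, map_sub, proj_proj, proj_proj, min_eq_right hab, min_self]
  have hfa : E.proj a f = 0 := by
    rw [hf, map_sub, proj_proj, proj_proj, min_eq_left hab, min_self, sub_self]
  refine ⟨E.op ((Ioc a b).indicator fun l => l) f, hdom, fun h hh => ?_⟩
  have hp := (hdom.add hh).integrable measurable_id'
  have hm := (hdom.sub hh).integrable measurable_id'
  have h0 := hh.integrable measurable_id'
  -- Using $f=E(b)f$ cuts the integral to $(-\infty,b]$; using $E(a)f=0$ shows that the part over
  -- $(-\infty,a]$ vanishes.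
  have e1 : E.weakIntegral (fun l => l) f h =
      E.weakIntegral ((Iic b).indicator fun l => l) f h := by
    conv_lhs => rw [← hfb]
    refine weakIntegral_proj_left b f h ?_
    rw [hfb]
    rintro k (rfl | rfl | rfl | rfl) <;> assumption
  have e2 : E.weakIntegral ((Iic a).indicator fun l => l) f h = 0 := by
    rw [← weakIntegral_proj_left a f h, hfa]
    · rw [weakIntegral, zero_add, zero_sub, measure_neg, sub_self, mul_zero]
    · rw [hfa, zero_add, zero_sub]
      rintro k (rfl | rfl | rfl | rfl)
      · exact h0
      · exact hm
      · rw [measure_neg]; exact h0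
      · exact hp
  have e3 : ((Ioc a b).indicator fun l => l) =
      fun l : ℝ => (Iic b).indicator (fun l => l) l - (Iic a).indicator (fun l => l) l := by
    funext l
    simp only [indicator, mem_Ioc, mem_Iic]
    grind
  rw [hbdd.inner_op, e1, ← sub_zero (E.weakIntegral ((Iic b).indicator fun l => l) f h), ← e2, e3,
    weakIntegral, weakIntegral, weakIntegral,
    integral_sub (hp.indicator measurableSet_Iic) (hp.indicator measurableSet_Iic),
    integral_sub (hm.indicator measurableSet_Iic) (hm.indicator measurableSet_Iic)]
  ring

/-- For $a\le b<0$ a vector $f$ in the range of $E(b)-E(a)$ satisfies $0\le\langle Af,f\rangle\le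
b\|f\|^2$, hence $f=0$. So $E$ is constant on $(-\infty,0)$, and letting $a\to-\infty$ gives zero.
-/
theorem IsResolutionOf.nonneg {A : H →ₗ.[ℝ] H} (hE : E.IsResolutionOf A) (hA : IsNonneg A) :
    E.Nonneg := by
  have step : ∀ a b g, a ≤ b → b < 0 → E.proj b g = E.proj a g := by
    intro a b g hab hb
    obtain ⟨k, hk⟩ := hasValue_id_proj_sub (E := E) a b g hab
    set f := E.proj b g - E.proj a g
    have hgr := (hE f k).2 hk
    obtain ⟨y, hy1, hy2⟩ := LinearPMap.mem_graph_iff A |>.1 hgr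
    have h1 := hA y
    rw [hy2, hy1, hk.2 f hk.1, weakIntegral_self] at h1
    have h2 : ∫ l, l ∂(E.measure f) ≤ ∫ _, b ∂(E.measure f) := by
      refine integral_mono_ae (hk.1.integrable measurable_id') (integrable_const b) ?_
      filter_upwards [measure_proj_sub_compl a b g hab] with l hl using hl.2
    rw [integral_const, real_measure_univ, smul_eq_mul] at h2
    have h3 : ‖f‖ ^ 2 ≤ 0 := by nlinarith [sq_nonneg ‖f‖]
    have h4 : ‖f‖ = 0 := by nlinarith [norm_nonneg f]
    exact sub_eq_zero.1 (norm_eq_zero.1 h4)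
  intro b hb
  ext1 g
  refine tendsto_nhds_unique (tendsto_const_nhds.congr' ?_) (E.tendsto_atBot g)
  filter_upwards [eventually_le_atBot b] with a ha
  exact step a b g ha hb

/-- The symbol of `(I + A)^{1/2}`. -/
def sobolevSymbol (l : ℝ) : ℝ := (1 + l) ^ ((1 : ℝ) / 2)

/-- The symbol of `(I + A)^{-1/2}`. -/
def besselSymbol (l : ℝ) : ℝ := (1 + l) ^ (-(1 / 2) : ℝ)

theorem measurable_sobolevSymbol : Measurable sobolevSymbol := by
  unfold sobolevSymbol
  fun_prop

theorem measurable_besselSymbol : Measurable besselSymbol := by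
  unfold besselSymbol
  fun_prop

theorem sobolevSymbol_pos {l : ℝ} (hl : 0 ≤ l) : 0 < sobolevSymbol l :=
  Real.rpow_pos_of_pos (by linarith) _

theorem sobolevSymbol_sq {l : ℝ} (hl : 0 ≤ l) : sobolevSymbol l ^ 2 = 1 + l := by
  rw [sobolevSymbol, ← Real.rpow_natCast, ← Real.rpow_mul (by linarith)]
  norm_num

theorem besselSymbol_eq {l : ℝ} (hl : 0 ≤ l) : besselSymbol l = (sobolevSymbol l)⁻¹ := by
  rw [besselSymbol, sobolevSymbol, Real.rpow_neg (by linarith)]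

theorem besselSymbol_mul_sobolevSymbol {l : ℝ} (hl : 0 ≤ l) :
    besselSymbol l * sobolevSymbol l = 1 := by
  rw [besselSymbol_eq hl, inv_mul_cancel₀ (sobolevSymbol_pos hl).ne']

theorem one_le_sobolevSymbol {l : ℝ} (hl : 0 ≤ l) : 1 ≤ sobolevSymbol l :=
  Real.one_le_rpow (by linarith) (by norm_num)

theorem abs_besselSymbol_le {l : ℝ} (hl : 0 ≤ l) : |besselSymbol l| ≤ 1 := by
  rw [besselSymbol_eq hl, abs_of_pos (inv_pos.2 (sobolevSymbol_pos hl))]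
  exact inv_le_one_of_one_le₀ (one_le_sobolevSymbol hl)

theorem Nonneg.bdd_bessel (hE : E.Nonneg) : E.Bdd besselSymbol :=
  hE.bdd measurable_besselSymbol fun _ => abs_besselSymbol_le

variable (E) in
/-- The bounded operator `(I + A)^{-1/2}`. -/
def bessel : H →L[ℝ] H := E.op besselSymbol

theorem Nonneg.bdd_truncated (hE : E.Nonneg) (a : ℝ) :
    E.Bdd ((Iic a).indicator sobolevSymbol) := by
  refine hE.bdd (C := |sobolevSymbol a|) (measurable_sobolevSymbol.indicator measurableSet_Iic)
    fun l hl => ?_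
  by_cases h : l ∈ Iic a
  · rw [indicator_of_mem h, abs_of_pos (sobolevSymbol_pos hl),
      abs_of_pos (sobolevSymbol_pos (hl.trans h))]
    have : l ≤ a := h
    exact Real.rpow_le_rpow (by linarith) (by linarith) (by norm_num)
  · rw [indicator_of_notMem h]
    simp

theorem Nonneg.bessel_truncated (hE : E.Nonneg) (a : ℝ) (f : H) :
    E.bessel (E.op ((Iic a).indicator sobolevSymbol) f) = E.proj a f := by
  rw [bessel, hE.bdd_bessel.op_mul (hE.bdd_truncated a), ← op_indicator_Iic]
  congr 1
  refine hE.op_congr fun l hl => ?_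
  by_cases h : l ∈ Iic a
  · simp [h, besselSymbol_mul_sobolevSymbol hl]
  · simp [h]

theorem Nonneg.truncated_bessel (hE : E.Nonneg) (a : ℝ) (f : H) :
    E.op ((Iic a).indicator sobolevSymbol) (E.bessel f) = E.proj a f := by
  rw [← hE.bessel_truncated, bessel, hE.bdd_bessel.op_mul (hE.bdd_truncated a),
    (hE.bdd_truncated a).op_mul hE.bdd_bessel]
  simp only [mul_comm]

theorem Nonneg.bessel_injective (hE : E.Nonneg) : Function.Injective E.bessel := by
  refine (injective_iff_map_eq_zero _).2 fun f hf => ?_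
  refine tendsto_nhds_unique (E.tendsto_atTop f) (tendsto_const_nhds.congr fun a => ?_)
  rw [← hE.truncated_bessel, hf, map_zero]

theorem Nonneg.memDom_bessel (hE : E.Nonneg) (g : H) : E.MemDom sobolevSymbol (E.bessel g) := by
  rw [MemDom, bessel, hE.bdd_bessel.measure_op,
    lintegral_withDensity_eq_lintegral_mul _ (by
      have := measurable_besselSymbol
      fun_prop) (by
      have := measurable_sobolevSymbol
      fun_prop)]
  refine lt_of_le_of_lt (le_of_eq (lintegral_congr_ae (g := fun _ => 1) ?_)) (by simp)
  filter_upwards [hE.ae_nonneg g] with l hl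
  rw [Pi.mul_apply, ← ENNReal.ofReal_mul (sq_nonneg _), ← mul_pow,
    besselSymbol_mul_sobolevSymbol hl]
  simp

/-- The vectors $(I+A)^{1/2}E(n)f$ are Cauchy, since their differences are controlled by the tails
of $\int(1+\lambda)\,d\|E f\|^2<\infty$. Their limit is the preimage. -/
theorem Nonneg.exists_bessel_eq (hE : E.Nonneg) {f : H} (hf : E.MemDom sobolevSymbol f) :
    ∃ g, E.bessel g = f := by
  have hint : Integrable (fun l => sobolevSymbol l ^ 2) (E.measure f) :=
    (hf.memLp measurable_sobolevSymbol).integrable_sq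
  set b : ℕ → ℝ := fun n => ∫ l, (Ioi (n : ℝ)).indicator (fun l => sobolevSymbol l ^ 2) l
    ∂(E.measure f) with hb
  have hb0 : Tendsto b atTop (𝓝 0) := by
    have h := tendsto_integral_of_dominated_convergence (μ := E.measure f)
      (F := fun (n : ℕ) l => (Ioi (n : ℝ)).indicator (fun l => sobolevSymbol l ^ 2) l)
      (f := fun _ => 0) (fun l => sobolevSymbol l ^ 2)
      (fun n => (hint.indicator measurableSet_Ioi).aestronglyMeasurable) hint
      (fun n => Eventually.of_forall fun l => by
        refine (norm_indicator_le_norm_self _ _).trans (le_of_eq ?_)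
        rw [Real.norm_eq_abs, abs_of_nonneg (sq_nonneg _)])
      (Eventually.of_forall fun l => by
        refine tendsto_const_nhds.congr' ?_
        obtain ⟨N, hN⟩ := exists_nat_ge l
        filter_upwards [eventually_ge_atTop N] with n hn
        rw [indicator_of_notMem]
        simp only [mem_Ioi, not_lt]
        exact hN.trans (by exact_mod_cast hn))
    simpa [hb] using h
  set g : ℕ → H := fun n => E.op ((Iic (n : ℝ)).indicator sobolevSymbol) f with hg
  have hcauchy : CauchySeq g := by
    refine cauchySeq_of_le_tendsto_0 (fun n => √(b n)) (fun n m N hn hm => ?_) (by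
      simpa only [Real.sqrt_zero] using! (Real.continuous_sqrt.tendsto 0).comp hb0)
    have hbd := (hE.bdd_truncated (n : ℝ)).sub (hE.bdd_truncated (m : ℝ))
    rw [dist_eq_norm, hg]
    refine Real.le_sqrt_of_sq_le ?_
    have e : E.op ((Iic (n : ℝ)).indicator sobolevSymbol) f -
        E.op ((Iic (m : ℝ)).indicator sobolevSymbol) f =
        E.op (fun l => (Iic (n : ℝ)).indicator sobolevSymbol l -
          (Iic (m : ℝ)).indicator sobolevSymbol l) f := by
      rw [(hE.bdd_truncated (n : ℝ)).op_sub (hE.bdd_truncated (m : ℝ)), sub_apply]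
    simp only [e]
    rw [hbd.norm_op_sq]
    refine integral_mono_of_nonneg (Eventually.of_forall fun l => sq_nonneg _)
      (hint.indicator measurableSet_Ioi) (Eventually.of_forall fun l => ?_)
    have hn' : (N : ℝ) ≤ n := by exact_mod_cast hn
    have hm' : (N : ℝ) ≤ m := by exact_mod_cast hm
    simp only [indicator, mem_Iic, mem_Ioi]
    split_ifs <;> nlinarith [sq_nonneg (sobolevSymbol l)]
  obtain ⟨k, hk⟩ := cauchySeq_tendsto_of_complete hcauchy
  refine ⟨k, tendsto_nhds_unique ((E.bessel.continuous.tendsto k).comp hk) ?_⟩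
  refine ((E.tendsto_atTop f).comp tendsto_natCast_atTop_atTop).congr fun n => ?_
  simp only [Function.comp, hg, hE.bessel_truncated]

/-- The spectral measure of $(I+A)^{-1/2}f$ has density $(1+\lambda)^{-1}$, and one factor
$(1+\lambda)^{1/2}$ cancels half of it. -/
theorem Nonneg.inner_eq_weakIntegral_bessel (hE : E.Nonneg) (g k : H) :
    ⟪g, E.bessel k⟫_ℝ = E.weakIntegral sobolevSymbol (E.bessel g) (E.bessel k) := by
  have key : ∀ f : H, ∫ l, sobolevSymbol l ∂(E.measure (E.bessel f)) =
      ∫ l, besselSymbol l ∂(E.measure f) := by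
    intro f
    rw [bessel, hE.bdd_bessel.measure_op, integral_withDensity_eq_integral_toReal_smul (by
      have := measurable_besselSymbol
      fun_prop) (Eventually.of_forall fun _ => ENNReal.ofReal_lt_top)]
    refine integral_congr_ae ?_
    filter_upwards [hE.ae_nonneg f] with l hl
    rw [ENNReal.toReal_ofReal (sq_nonneg _), smul_eq_mul, sq, mul_assoc,
      besselSymbol_mul_sobolevSymbol hl, mul_one]
  rw [bessel, ← hE.bdd_bessel.inner_op_left, hE.bdd_bessel.inner_op, weakIntegral, weakIntegral,
    ← bessel, ← map_add, ← map_sub, key, key]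

/-- The test vectors in the domain are exactly those of the form $(I+A)^{-1/2}k$. As this operator
is symmetric and injective, testing against them determines the value. -/
theorem Nonneg.hasValue_bessel_iff (hE : E.Nonneg) {g g' : H} :
    E.HasValue sobolevSymbol (E.bessel g) g' ↔ g' = g := by
  constructor
  · rintro ⟨-, h⟩
    refine hE.bessel_injective (ext_inner_right ℝ fun k => ?_)
    rw [bessel, hE.bdd_bessel.inner_op_left, hE.bdd_bessel.inner_op_left, ← bessel,
      h _ (hE.memDom_bessel k), hE.inner_eq_weakIntegral_bessel]
  · rintro rfl
    refine ⟨hE.memDom_bessel g', fun h hh => ?_⟩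
    obtain ⟨k, rfl⟩ := hE.exists_bessel_eq hh
    exact hE.inner_eq_weakIntegral_bessel g' k

end ResolutionOfIdentity

/-! ### From the chosen values of $\varphi(A)$ to bounded operators -/

section Operators

open ResolutionOfIdentity

variable {H : Type*} [NormedAddCommGroup H] [InnerProductSpace ℝ H] [CompleteSpace H]
  {A : H →ₗ.[ℝ] H} {φ : ℝ → ℝ}

/-- All operators `φ(A)` are defined through `spectralResolution A`, and the only property of `A`
needed below is that this resolution is supported in `[0, ∞)`. -/
theorem spectralResolution_nonneg (hA : IsNonneg A) : (spectralResolution A).Nonneg := by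
  unfold spectralResolution
  split_ifs with h
  · exact h.choose_spec.nonneg hA
  -- The default resolution is that of the zero operator, which also vanishes on $(-\infty,0)$.
  · intro a ha
    exact if_neg (not_le.2 ha)

theorem opFun_eq_op (hφ : (spectralResolution A).Bdd φ) (f : H) :
    opFun A φ f = (spectralResolution A).op φ f := by
  have h : ∃ g, (spectralResolution A).HasValue φ f g := ⟨_, hφ.hasValue_iff.2 rfl⟩
  rw [opFun, dif_pos h]
  exact hφ.hasValue_iff.1 h.choose_spec

theorem memSobolev_one_iff (hE : (spectralResolution A).Nonneg) {f : H} :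
    MemSobolev A 1 f ↔ ∃ g, (spectralResolution A).bessel g = f := by
  constructor
  · exact fun h => hE.exists_bessel_eq h
  · rintro ⟨g, rfl⟩
    exact hE.memDom_bessel g

theorem sobolevNorm_one_bessel (hE : (spectralResolution A).Nonneg) (g : H) :
    sobolevNorm A 1 ((spectralResolution A).bessel g) = ‖g‖ := by
  have h : ∃ k, (spectralResolution A).HasValue sobolevSymbol
      ((spectralResolution A).bessel g) k := ⟨g, hE.hasValue_bessel_iff.2 rfl⟩
  have e : opFun A sobolevSymbol ((spectralResolution A).bessel g) = g := by
    rw [opFun, dif_pos h]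
    exact hE.hasValue_bessel_iff.1 h.choose_spec
  exact congrArg norm e

end Operators

/-! ### Symbols of the propagator: differential equations, energy bound, addition formulas -/

section Symbols

/-- The function `e^{-t/2} cosh(t √(1/4 - l))`, continued to `l ≥ 1/4`. -/
def symbolC (t l : ℝ) : ℝ :=
  Real.exp (-t / 2) *
    if l < 1 / 4 then Real.cosh (t * √(1 / 4 - l)) else Real.cos (t * √(l - 1 / 4))

/-- The time derivative of `symbolD`. -/
def symbolDt (t l : ℝ) : ℝ := symbolC t l - symbolD t l / 2

theorem measurable_symbolD (t : ℝ) : Measurable (symbolD t) := by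
  unfold symbolD
  refine Measurable.ite measurableSet_Iio (by fun_prop) (Measurable.ite ?_ (by fun_prop)
    (by fun_prop))
  exact measurableSet_singleton (1 / 4 : ℝ)

theorem measurable_symbolC (t : ℝ) : Measurable (symbolC t) := by
  unfold symbolC
  exact measurable_const.mul (Measurable.ite measurableSet_Iio (by fun_prop) (by fun_prop))

theorem measurable_symbolDt (t : ℝ) : Measurable (symbolDt t) :=
  (measurable_symbolC t).sub ((measurable_symbolD t).div_const 2)

theorem hasDerivAt_exp_neg_half (t : ℝ) :
    HasDerivAt (fun t : ℝ => Real.exp (-t / 2)) (Real.exp (-t / 2) * (-1 / 2)) t :=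
  (((hasDerivAt_id t).neg).div_const 2).exp

theorem hasDerivAt_symbolD (t l : ℝ) :
    HasDerivAt (fun t => symbolD t l) (symbolDt t l) t := by
  unfold symbolDt symbolD symbolC
  have he := hasDerivAt_exp_neg_half t
  rcases lt_trichotomy l (1 / 4) with h | h | h
  · simp only [h, if_true]
    have hk : √(1 / 4 - l) ≠ 0 := (Real.sqrt_pos.2 (by linarith)).ne'
    have h1 := ((hasDerivAt_id t).mul_const √(1 / 4 - l)).sinh
    have h2 := (he.mul h1).div_const √(1 / 4 - l)
    refine h2.congr_deriv ?_
    generalize √(1 / 4 - l) = k at *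
    simp only [id]
    field_simp
    ring
  · simp only [h, lt_self_iff_false, if_false, if_true]
    refine ((hasDerivAt_id t).mul he).congr_deriv ?_
    simp
    ring
  · simp only [h.not_gt, h.ne', if_false]
    have hk : √(l - 1 / 4) ≠ 0 := (Real.sqrt_pos.2 (by linarith)).ne'
    have h1 := ((hasDerivAt_id t).mul_const √(l - 1 / 4)).sin
    have h2 := (he.mul h1).div_const √(l - 1 / 4)
    refine h2.congr_deriv ?_
    generalize √(l - 1 / 4) = k at *
    simp only [id]
    field_simp
    ring

theorem hasDerivAt_symbolC (t l : ℝ) :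
    HasDerivAt (fun t => symbolC t l) (-symbolC t l / 2 + (1 / 4 - l) * symbolD t l) t := by
  unfold symbolD symbolC
  have he := hasDerivAt_exp_neg_half t
  rcases lt_trichotomy l (1 / 4) with h | h | h
  · simp only [h, if_true]
    have hk : √(1 / 4 - l) ≠ 0 := (Real.sqrt_pos.2 (by linarith)).ne'
    have hs : √(1 / 4 - l) ^ 2 = 1 / 4 - l := Real.sq_sqrt (by linarith)
    have h1 := ((hasDerivAt_id t).mul_const √(1 / 4 - l)).cosh
    refine (he.mul h1).congr_deriv ?_
    generalize √(1 / 4 - l) = k at *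
    rw [← hs]
    simp only [id]
    field_simp
  · simp only [h, lt_self_iff_false, if_false, if_true, sub_self, Real.sqrt_zero, mul_zero,
      Real.cos_zero, mul_one, zero_mul, add_zero]
    refine he.congr_deriv ?_
    ring
  · simp only [h.not_gt, h.ne', if_false]
    have hk : √(l - 1 / 4) ≠ 0 := (Real.sqrt_pos.2 (by linarith)).ne'
    have hs : 1 / 4 - l = -√(l - 1 / 4) ^ 2 := by rw [Real.sq_sqrt (by linarith)]; ring
    have h1 := ((hasDerivAt_id t).mul_const √(l - 1 / 4)).cos
    refine (he.mul h1).congr_deriv ?_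
    generalize √(l - 1 / 4) = k at *
    rw [hs]
    simp only [id]
    field_simp

theorem hasDerivAt_symbolDt (t l : ℝ) :
    HasDerivAt (fun t => symbolDt t l) (-symbolDt t l - l * symbolD t l) t := by
  refine ((hasDerivAt_symbolC t l).sub ((hasDerivAt_symbolD t l).div_const 2)).congr_deriv ?_
  unfold symbolDt
  ring

theorem deriv_symbolD (t l : ℝ) : deriv (fun s => symbolD s l) t = symbolDt t l :=
  (hasDerivAt_symbolD t l).deriv

theorem symbolD_zero (l : ℝ) : symbolD 0 l = 0 := by
  unfold symbolD
  split_ifs <;> simp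

theorem symbolDt_zero (l : ℝ) : symbolDt 0 l = 1 := by
  rw [symbolDt, symbolD_zero, symbolC]
  split_ifs <;> simp

/-- The energy $e=z^2+(1+l)y^2$ satisfies $e'=-2z^2+2yz$, so $|e'|\le3e$ uniformly in $l\ge0$: a $2$
from the damping and a $1$ from $2|yz|\le y^2+z^2$. The weight $1+l$, rather than $l$, is what later
controls $(1+l)^{1/2}\mathcal D$; negative times are needed for the group. -/
theorem energy_le {y z : ℝ → ℝ} {l : ℝ} (hl : 0 ≤ l) (hy : ∀ t, HasDerivAt y (z t) t)
    (hz : ∀ t, HasDerivAt z (-z t - l * y t) t) (t : ℝ) :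
    z t ^ 2 + (1 + l) * y t ^ 2 ≤ Real.exp (3 * |t|) * (z 0 ^ 2 + (1 + l) * y 0 ^ 2) := by
  set e : ℝ → ℝ := fun t => z t ^ 2 + (1 + l) * y t ^ 2 with he
  have hde : ∀ t, HasDerivAt e (-2 * z t ^ 2 + 2 * y t * z t) t := fun t => by
    refine (((hz t).pow 2).add (((hy t).pow 2).const_mul (1 + l))).congr_deriv ?_
    simp
    ring
  have hexp : ∀ c t : ℝ, HasDerivAt (fun t => Real.exp (c * t) * e t)
      (Real.exp (c * t) * (c * e t + (-2 * z t ^ 2 + 2 * y t * z t))) t := fun c t => by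
    refine ((((hasDerivAt_id t).const_mul c).exp).mul (hde t)).congr_deriv ?_
    simp
    ring
  have hly : ∀ t, 0 ≤ l * y t ^ 2 := fun t => mul_nonneg hl (sq_nonneg _)
  rcases le_total 0 t with ht | ht
  · have hanti : Antitone fun t => Real.exp (-3 * t) * e t := by
      refine antitone_of_deriv_nonpos (fun t => (hexp (-3) t).differentiableAt) fun t => ?_
      rw [(hexp (-3) t).deriv]
      refine mul_nonpos_of_nonneg_of_nonpos (Real.exp_pos _).le ?_
      simp only [he]
      nlinarith [sq_nonneg (y t - z t), hly t, sq_nonneg (y t), sq_nonneg (z t)]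
    have h := hanti ht
    simp only [mul_zero, Real.exp_zero, one_mul] at h
    rw [abs_of_nonneg ht]
    calc e t = Real.exp (3 * t) * (Real.exp (-3 * t) * e t) := by
          rw [← mul_assoc, ← Real.exp_add]; simp
      _ ≤ _ := by gcongr
  · have hmono : Monotone fun t => Real.exp (3 * t) * e t := by
      refine monotone_of_deriv_nonneg (fun t => (hexp 3 t).differentiableAt) fun t => ?_
      rw [(hexp 3 t).deriv]
      refine mul_nonneg (Real.exp_pos _).le ?_
      simp only [he]
      nlinarith [sq_nonneg (y t + z t), hly t, sq_nonneg (y t), sq_nonneg (z t)]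
    have h := hmono ht
    simp only [mul_zero, Real.exp_zero, one_mul] at h
    rw [abs_of_nonpos ht]
    calc e t = Real.exp (3 * -t) * (Real.exp (3 * t) * e t) := by
          rw [← mul_assoc, ← Real.exp_add]; simp
      _ ≤ _ := by gcongr

theorem symbol_energy_le (t : ℝ) {l : ℝ} (hl : 0 ≤ l) :
    symbolDt t l ^ 2 + (1 + l) * symbolD t l ^ 2 ≤ Real.exp (3 * |t|) := by
  have h := energy_le hl (fun t => hasDerivAt_symbolD t l) (fun t => hasDerivAt_symbolDt t l) t
  simpa [symbolD_zero, symbolDt_zero] using h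

theorem abs_le_exp_of_sq_le {x t : ℝ} (h : x ^ 2 ≤ Real.exp (3 * |t|)) :
    |x| ≤ Real.exp (3 * |t|) := by
  refine abs_le_of_sq_le_sq (h.trans ?_) (Real.exp_pos _).le
  have : 1 ≤ Real.exp (3 * |t|) := Real.one_le_exp (by positivity)
  nlinarith

open ResolutionOfIdentity

theorem abs_symbolDt_le (t : ℝ) {l : ℝ} (hl : 0 ≤ l) :
    |symbolDt t l| ≤ Real.exp (3 * |t|) := by
  refine abs_le_exp_of_sq_le ?_
  nlinarith [symbol_energy_le t hl, mul_nonneg hl (sq_nonneg (symbolD t l)),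
    sq_nonneg (symbolD t l)]

theorem abs_sobolevSymbol_mul_symbolD_le (t : ℝ) {l : ℝ} (hl : 0 ≤ l) :
    |sobolevSymbol l * symbolD t l| ≤ Real.exp (3 * |t|) := by
  refine abs_le_exp_of_sq_le ?_
  rw [mul_pow, sobolevSymbol_sq hl]
  nlinarith [symbol_energy_le t hl, sq_nonneg (symbolDt t l)]

theorem abs_symbolD_le (t : ℝ) {l : ℝ} (hl : 0 ≤ l) :
    |symbolD t l| ≤ Real.exp (3 * |t|) := by
  refine abs_le_exp_of_sq_le ?_
  nlinarith [symbol_energy_le t hl, mul_nonneg hl (sq_nonneg (symbolD t l)),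
    sq_nonneg (symbolDt t l)]

/-- In the variable $t$ both sides solve the same linear system with the same values at $t=0$, so
their difference has zero energy. -/
theorem symbolD_add (t s : ℝ) {l : ℝ} (hl : 0 ≤ l) :
    symbolD (t + s) l =
      (symbolD t l + symbolDt t l) * symbolD s l + symbolD t l * symbolDt s l ∧
    symbolDt (t + s) l = symbolDt t l * symbolDt s l - l * symbolD t l * symbolD s l := by
  have h := energy_le (l := l)
    (y := fun t => symbolD (t + s) l -
      ((symbolD t l + symbolDt t l) * symbolD s l + symbolD t l * symbolDt s l))
    (z := fun t => symbolDt (t + s) l -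
      (symbolDt t l * symbolDt s l - l * symbolD t l * symbolD s l)) hl
    (fun t => by
      refine ((hasDerivAt_symbolD (t + s) l).comp_add_const t s |>.sub
        ((((hasDerivAt_symbolD t l).add (hasDerivAt_symbolDt t l)).mul_const _).add
          ((hasDerivAt_symbolD t l).mul_const _))).congr_deriv ?_
      ring)
    (fun t => by
      refine ((hasDerivAt_symbolDt (t + s) l).comp_add_const t s |>.sub
        (((hasDerivAt_symbolDt t l).mul_const _).sub
          (((hasDerivAt_symbolD t l).const_mul l).mul_const _))).congr_deriv ?_
      ring) t
  simp only [zero_add, symbolD_zero, symbolDt_zero, one_mul, zero_mul, mul_zero, sub_zero, add_zero,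
    sub_self, ne_eq, OfNat.ofNat_ne_zero, not_false_eq_true, zero_pow] at h
  set Y := symbolD (t + s) l -
    ((symbolD t l + symbolDt t l) * symbolD s l + symbolD t l * symbolDt s l)
  set Z := symbolDt (t + s) l - (symbolDt t l * symbolDt s l - l * symbolD t l * symbolD s l)
  have h2 : 0 ≤ l * Y ^ 2 := mul_nonneg hl (sq_nonneg _)
  have hY : Y ^ 2 = 0 := by nlinarith [sq_nonneg Y, sq_nonneg Z]
  have hZ : Z ^ 2 = 0 := by nlinarith [sq_nonneg Y, sq_nonneg Z]
  exact ⟨sub_eq_zero.1 (pow_eq_zero_iff two_ne_zero |>.1 hY),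
    sub_eq_zero.1 (pow_eq_zero_iff two_ne_zero |>.1 hZ)⟩

end Symbols

/-! ### Dependence of the functional calculus on a parameter -/

namespace ResolutionOfIdentity

variable {H : Type*} [NormedAddCommGroup H] [InnerProductSpace ℝ H] [CompleteSpace H]
  {E : ResolutionOfIdentity H}

/-- By the isometry the squared distance is $\int|\varphi_i-\psi|^2\,d\|E f\|^2$, which tends to $0$
by dominated convergence. -/
theorem Nonneg.tendsto_op (hE : E.Nonneg) {ι : Type*} {L : Filter ι} [L.IsCountablyGenerated]
    {φ : ι → ℝ → ℝ} {ψ : ℝ → ℝ} {C : ℝ} (hφ : ∀ i, Measurable (φ i)) (hψ : E.Bdd ψ)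
    (hφb : ∀ i, E.Bdd (φ i))
    (hC : ∀ᶠ i in L, ∀ l, 0 ≤ l → |φ i l| ≤ C)
    (hlim : ∀ l, 0 ≤ l → Tendsto (fun i => φ i l) L (𝓝 (ψ l))) (f : H) :
    Tendsto (fun i => E.op (φ i) f) L (𝓝 (E.op ψ f)) := by
  obtain ⟨D, hD⟩ := hψ.2
  have key : Tendsto (fun i => ∫ l, (φ i l - ψ l) ^ 2 ∂(E.measure f)) L
      (𝓝 (∫ _, 0 ∂(E.measure f))) := by
    refine tendsto_integral_filter_of_dominated_convergence (fun _ => (C + D) ^ 2)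
      (Eventually.of_forall fun i => (((hφ i).sub hψ.1).pow_const 2).aestronglyMeasurable)
      ?_ (integrable_const _) ?_
    · filter_upwards [hC] with i hi
      filter_upwards [hE.ae_nonneg f, hD f] with l hl hDl
      rw [norm_pow, Real.norm_eq_abs]
      exact pow_le_pow_left₀ (abs_nonneg _)
        ((abs_sub _ _).trans (add_le_add (hi l hl) hDl)) 2
    · filter_upwards [hE.ae_nonneg f] with l hl
      simpa using ((hlim l hl).sub_const (ψ l)).pow 2
  rw [tendsto_iff_norm_sub_tendsto_zero]
  have h2 := (Real.continuous_sqrt.tendsto _).comp key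
  rw [integral_zero, Real.sqrt_zero] at h2
  refine h2.congr fun i => ?_
  rw [Function.comp_apply, ← ((hφb i).sub hψ).norm_op_sq, (hφb i).op_sub hψ, sub_apply,
    Real.sqrt_sq (norm_nonneg _)]

theorem Nonneg.continuous_op (hE : E.Nonneg) {φ : ℝ → ℝ → ℝ} {K : ℝ}
    (hφ : ∀ t, Measurable (φ t)) (hK : ∀ t l, 0 ≤ l → |φ t l| ≤ K * Real.exp (3 * |t|))
    (hc : ∀ l, 0 ≤ l → Continuous fun t => φ t l) (f : H) :
    Continuous fun t => E.op (φ t) f := by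
  refine continuous_iff_continuousAt.2 fun t => ?_
  have hb : ∀ t, E.Bdd (φ t) := fun t => hE.bdd (hφ t) (hK t)
  refine hE.tendsto_op (C := K * Real.exp (3 * |t|) + 1) hφ (hb t) hb ?_
    (fun l hl => (hc l hl).continuousAt) f
  have hcont : Continuous fun s : ℝ => K * Real.exp (3 * |s|) := by fun_prop
  filter_upwards [hcont.continuousAt.eventually_lt_const (lt_add_one (K * Real.exp (3 * |t|)))]
    with s hs l hl
  exact (hK s l hl).trans hs.le

/-- The mean value inequality bounds the difference quotients of the symbols uniformly for
$|s-t|<1$, so they may be passed to the limit under the functional calculus. -/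
theorem Nonneg.hasDerivAt_op (hE : E.Nonneg) {φ φ' : ℝ → ℝ → ℝ} {K : ℝ} (h0 : 0 ≤ K)
    (hφ : ∀ t, E.Bdd (φ t)) (hφ' : ∀ t, Measurable (φ' t))
    (hK : ∀ t l, 0 ≤ l → |φ' t l| ≤ K * Real.exp (3 * |t|))
    (hd : ∀ t l, HasDerivAt (fun t => φ t l) (φ' t l) t) (f : H) (t : ℝ) :
    HasDerivAt (fun t => E.op (φ t) f) (E.op (φ' t) f) t := by
  rw [hasDerivAt_iff_tendsto_slope]
  have hb : ∀ s, E.Bdd fun l => (s - t)⁻¹ * (φ s l - φ t l) := fun s =>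
    (Bdd.const _).mul ((hφ s).sub (hφ t))
  have h := hE.tendsto_op (L := 𝓝[≠] t) (φ := fun s l => (s - t)⁻¹ * (φ s l - φ t l))
    (ψ := φ' t) (C := K * Real.exp (3 * (|t| + 1))) (fun s => (hb s).1) (hE.bdd (hφ' t) (hK t)) hb
    ?_ (fun l hl => by simpa [slope_fun_def] using (hasDerivAt_iff_tendsto_slope.1 (hd t l))) f
  · refine h.congr fun s => ?_
    have e : E.op (fun l => (s - t)⁻¹ * (φ s l - φ t l)) f =
        (s - t)⁻¹ • (E.op (φ s) f - E.op (φ t) f) := by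
      refine ext_inner_right ℝ fun k => ?_
      rw [(hb s).inner_op, real_inner_smul_left, ← sub_apply, ← (hφ s).op_sub (hφ t),
        ((hφ s).sub (hφ t)).inner_op, weakIntegral, weakIntegral, integral_const_mul,
        integral_const_mul]
      ring
    simp [slope_def_module, e]
  · refine eventually_nhdsWithin_of_eventually_nhds ?_
    filter_upwards [Metric.ball_mem_nhds t one_pos] with s hs l hl
    have hmv := (convex_ball t 1).norm_image_sub_le_of_norm_hasDerivWithin_le (𝕜 := ℝ)
      (f := fun t => φ t l) (f' := fun t => φ' t l) (C := K * Real.exp (3 * (|t| + 1)))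
      (fun x _ => (hd x l).hasDerivWithinAt) (fun x hx => ?_) (Metric.mem_ball_self one_pos) hs
    · rw [Real.norm_eq_abs, Real.norm_eq_abs] at hmv
      rw [abs_mul, abs_inv]
      -- At $s=t$ the quotient is $0$ because $0^{-1}=0$.
      rcases eq_or_ne s t with rfl | hst
      · simp only [sub_self, abs_zero, inv_zero, zero_mul]
        positivity
      · rw [inv_mul_le_iff₀ (abs_pos.2 (sub_ne_zero.2 hst))]
        linarith
    · refine (hK x l hl).trans ?_
      have hx' : |x| ≤ |t| + 1 := by
        have h1 : |x - t| < 1 := by simpa [Real.dist_eq] using hx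
        have h2 := abs_sub_abs_le_abs_sub x t
        linarith
      gcongr

end ResolutionOfIdentity

/-! ### $L^r$ balls in $L^2$ and Minkowski's inequality -/

section Minkowski

variable {X : Type*} [MeasurableSpace X] {μ : Measure X}

/-- Convergence in $L^2$ implies convergence in measure, under which the $L^r$ norm is lower
semicontinuous. -/
theorem isClosed_setOf_eLpNorm_le (r M : ℝ≥0∞) :
    IsClosed {g : Lp ℝ 2 μ | eLpNorm g r μ ≤ M} := by
  refine IsSeqClosed.isClosed fun u g hu hg => ?_
  exact eLpNorm_le_of_tendstoInMeasure (Eventually.of_forall hu) (tendstoInMeasure_of_tendsto_Lp hg)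
    fun n => Lp.aestronglyMeasurable _

theorem eLpNorm_coeFn_add_le {r : ℝ≥0∞} (hr : 1 ≤ r) (f g : Lp ℝ 2 μ) :
    eLpNorm (f + g : Lp ℝ 2 μ) r μ ≤ eLpNorm f r μ + eLpNorm g r μ := by
  rw [eLpNorm_congr_ae (Lp.coeFn_add f g)]
  exact eLpNorm_add_le (Lp.aestronglyMeasurable _) (Lp.aestronglyMeasurable _) hr

theorem eLpNorm_coeFn_smul (r : ℝ≥0∞) (c : ℝ) (f : Lp ℝ 2 μ) :
    eLpNorm (c • f : Lp ℝ 2 μ) r μ = ‖c‖ₑ * eLpNorm f r μ := by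
  rw [eLpNorm_congr_ae (Lp.coeFn_smul c f), eLpNorm_const_smul]

theorem convex_setOf_eLpNorm_le {r : ℝ≥0∞} (hr : 1 ≤ r) (M : ℝ≥0∞) :
    Convex ℝ {g : Lp ℝ 2 μ | eLpNorm g r μ ≤ M} := by
  intro f hf g hg a b ha hb hab
  simp only [mem_ofPred_eq] at hf hg ⊢
  calc eLpNorm (a • f + b • g : Lp ℝ 2 μ) r μ
      ≤ eLpNorm (a • f : Lp ℝ 2 μ) r μ + eLpNorm (b • g : Lp ℝ 2 μ) r μ :=
        eLpNorm_coeFn_add_le hr _ _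
    _ ≤ ‖a‖ₑ * M + ‖b‖ₑ * M := by
        rw [eLpNorm_coeFn_smul, eLpNorm_coeFn_smul]
        gcongr
    _ = M := by
        rw [← add_mul, Real.enorm_of_nonneg ha, Real.enorm_of_nonneg hb, ← ENNReal.ofReal_add ha hb,
          hab, ENNReal.ofReal_one, one_mul]

/-- Minkowski's integral inequality for a weighted integral of `L²`-functions that are uniformly
bounded in `L^r`. -/
theorem eLpNorm_setIntegral_smul_le {r M : ℝ≥0∞} (hr : 1 ≤ r) {s : Set ℝ} (hs : MeasurableSet s)
    {w : ℝ → ℝ} {G : ℝ → Lp ℝ 2 μ} (hw : ∀ t ∈ s, 0 ≤ w t) (hwi : IntegrableOn w s)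
    (hG : ∀ t ∈ s, eLpNorm (G t) r μ ≤ M) (hint : IntegrableOn (fun t => w t • G t) s) :
    eLpNorm (∫ t in s, w t • G t : Lp ℝ 2 μ) r μ ≤ ENNReal.ofReal (∫ t in s, w t) * M := by
  set m : Measure ℝ := (volume.restrict s).withDensity fun t => ENNReal.ofReal (w t) with hm
  have : IsFiniteMeasure m := isFiniteMeasure_withDensity_ofReal hwi.2
  have hwm : AEMeasurable (fun t => ENNReal.ofReal (w t)) (volume.restrict s) :=
    hwi.aestronglyMeasurable.aemeasurable.ennreal_ofReal
  have hw' : ∀ᵐ t ∂(volume.restrict s), 0 ≤ w t := (ae_restrict_iff' hs).2 (ae_of_all _ hw)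
  have hmuniv : m.real univ = ∫ t in s, w t := by
    rw [Measure.real, hm, withDensity_apply _ MeasurableSet.univ, Measure.restrict_univ,
      integral_eq_lintegral_of_nonneg_ae hw' hwi.aestronglyMeasurable]
  have hI : ∫ t in s, w t • G t = ∫ t, G t ∂m := by
    rw [hm, integral_withDensity_eq_integral_toReal_smul₀ hwm
      (Eventually.of_forall fun _ => ENNReal.ofReal_lt_top)]
    refine integral_congr_ae ?_
    filter_upwards [hw'] with t ht
    rw [ENNReal.toReal_ofReal ht]
  have hGm : Integrable G m := by
    rw [hm, integrable_withDensity_iff_integrable_smul₀' hwm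
      (Eventually.of_forall fun _ => ENNReal.ofReal_lt_top)]
    refine hint.congr ?_
    filter_upwards [hw'] with t ht
    rw [ENNReal.toReal_ofReal ht]
  have hGs : ∀ᵐ t ∂m, G t ∈ {g : Lp ℝ 2 μ | eLpNorm g r μ ≤ M} :=
    (withDensity_absolutelyContinuous _ _).ae_le ((ae_restrict_iff' hs).2 (ae_of_all _ hG))
  rcases eq_or_ne m 0 with h0 | h0
  · rw [hI, h0, integral_zero_measure, eLpNorm_congr_ae (Lp.coeFn_zero ℝ 2 μ)]
    simp
  · have : NeZero m := ⟨h0⟩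
    -- The integral is the total mass of $m=w\,dt$ times an average of $G$, and the average stays in
    -- the closed convex set that contains the values of $G$.
    have hav := (convex_setOf_eLpNorm_le hr M).average_mem (isClosed_setOf_eLpNorm_le r M) hGs hGm
    rw [hI, ← measure_smul_average, eLpNorm_coeFn_smul, hmuniv,
      Real.enorm_of_nonneg (setIntegral_nonneg hs hw)]
    gcongr
    exact hav

end Minkowski

/-! ### The heat semigroup and the subordination formula -/

namespace ResolutionOfIdentity

variable {H : Type*} [NormedAddCommGroup H] [InnerProductSpace ℝ H] [CompleteSpace H]
  {E : ResolutionOfIdentity H}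

variable (E) in
/-- The heat semigroup. -/
def heatOp (t : ℝ) : H →L[ℝ] H := E.op fun l => Real.exp (-(t * l))

theorem abs_exp_neg_mul_le {t l : ℝ} (ht : 0 ≤ t) (hl : 0 ≤ l) :
    |Real.exp (-(t * l))| ≤ 1 := by
  rw [Real.abs_exp]
  exact Real.exp_le_one_iff.2 (by nlinarith)

theorem Nonneg.bdd_heat (hE : E.Nonneg) {t : ℝ} (ht : 0 ≤ t) :
    E.Bdd fun l => Real.exp (-(t * l)) :=
  hE.bdd (by fun_prop) fun _ hl => abs_exp_neg_mul_le ht hl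

theorem Nonneg.norm_heatOp_apply_le (hE : E.Nonneg) {t : ℝ} (ht : 0 ≤ t) (f : H) :
    ‖E.heatOp t f‖ ≤ ‖f‖ := by
  have h : ‖E.heatOp t‖ ≤ 1 :=
    hE.norm_op_le (by fun_prop) fun _ hl => abs_exp_neg_mul_le ht hl
  simpa using (E.heatOp t).le_of_opNorm_le h f

theorem Nonneg.continuous_heatOp_max (hE : E.Nonneg) (f : H) :
    Continuous fun t => E.heatOp (max t 0) f := by
  refine hE.continuous_op (φ := fun t l => Real.exp (-(max t 0 * l))) (K := 1)
    (fun t => by fun_prop) (fun t l hl => ?_) (fun l hl => by fun_prop) f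
  refine (abs_exp_neg_mul_le (le_max_right t 0) hl).trans ?_
  rw [one_mul]
  exact Real.one_le_exp (by positivity)

theorem Nonneg.integrableOn_smul_heatOp (hE : E.Nonneg) {w : ℝ → ℝ} {s : Set ℝ} (hs : s ⊆ Ioi 0)
    (hsm : MeasurableSet s) (hw : IntegrableOn w s) (f : H) :
    IntegrableOn (fun t => w t • E.heatOp t f) s := by
  have h1 : AEStronglyMeasurable (fun t => E.heatOp t f) (volume.restrict s) := by
    refine (hE.continuous_heatOp_max f).aestronglyMeasurable.congr ?_
    filter_upwards [ae_restrict_mem hsm] with t ht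
    rw [max_eq_left (mem_Ioi.1 (hs ht)).le]
  refine Integrable.mono' (hw.norm.mul_const ‖f‖) (hw.aestronglyMeasurable.smul h1) ?_
  filter_upwards [ae_restrict_mem hsm] with t ht
  rw [norm_smul]
  exact mul_le_mul_of_nonneg_left (hE.norm_heatOp_apply_le (mem_Ioi.1 (hs ht)).le f)
    (norm_nonneg _)

/-- The weight of the subordination formula `(I + A)^{-1/2} = ∫₀^∞ w(t) e^{-tA} dt`. -/
def besselWeight (t : ℝ) : ℝ := (Real.Gamma (1 / 2))⁻¹ * (Real.exp (-t) * t ^ ((1 / 2 : ℝ) - 1))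

theorem gamma_half_pos : 0 < Real.Gamma (1 / 2) := Real.Gamma_pos_of_pos (by norm_num)

theorem besselWeight_nonneg {t : ℝ} (ht : 0 < t) : 0 ≤ besselWeight t := by
  have := gamma_half_pos
  unfold besselWeight
  positivity

theorem integrableOn_besselWeight : IntegrableOn besselWeight (Ioi 0) :=
  (Real.GammaIntegral_convergent (by norm_num)).const_mul _

theorem integral_besselWeight_mul_exp {l : ℝ} (hl : 0 ≤ l) :
    ∫ t in Ioi 0, besselWeight t * Real.exp (-(t * l)) = besselSymbol l := by
  have h := Real.integral_rpow_mul_exp_neg_mul_Ioi (a := 1 / 2) (r := 1 + l) (by norm_num)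
    (by linarith)
  have e : ∀ t : ℝ, besselWeight t * Real.exp (-(t * l)) =
      (Real.Gamma (1 / 2))⁻¹ * (t ^ ((1 / 2 : ℝ) - 1) * Real.exp (-((1 + l) * t))) := by
    intro t
    rw [besselWeight, show -((1 + l) * t) = -t + -(t * l) by ring, Real.exp_add]
    ring
  simp only [e]
  rw [integral_const_mul, h, mul_comm, mul_assoc, mul_inv_cancel₀ gamma_half_pos.ne', mul_one,
    besselSymbol, one_div, Real.inv_rpow (by linarith), Real.rpow_neg (by linarith)]

theorem integral_integral_besselWeight {m : Measure ℝ} [IsFiniteMeasure m]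
    (hm : ∀ᵐ l ∂m, 0 ≤ l) :
    Integrable (fun t => besselWeight t * ∫ l, Real.exp (-(t * l)) ∂m) (volume.restrict (Ioi 0)) ∧
    ∫ t in Ioi 0, besselWeight t * ∫ l, Real.exp (-(t * l)) ∂m = ∫ l, besselSymbol l ∂m := by
  have hint : Integrable (fun z : ℝ × ℝ => besselWeight z.1 * Real.exp (-(z.1 * z.2)))
      ((volume.restrict (Ioi 0)).prod m) := by
    have h1 := integrableOn_besselWeight.integrable.mul_prod (integrable_const (μ := m) (1 : ℝ))
    refine h1.mono ?_ ?_
    · refine AEStronglyMeasurable.mul ?_ ?_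
      · exact integrableOn_besselWeight.aestronglyMeasurable.comp_fst
      · exact (by fun_prop : Continuous fun z : ℝ × ℝ =>
          Real.exp (-(z.1 * z.2))).aestronglyMeasurable
    · have ha : ∀ᵐ z ∂((volume.restrict (Ioi (0 : ℝ))).prod m), z.1 ∈ Ioi (0 : ℝ) :=
        Measure.quasiMeasurePreserving_fst.ae (ae_restrict_mem measurableSet_Ioi)
      have hb : ∀ᵐ z ∂((volume.restrict (Ioi (0 : ℝ))).prod m), 0 ≤ z.2 :=
        Measure.quasiMeasurePreserving_snd.ae hm
      filter_upwards [ha, hb] with z hz1 hz2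
      rw [norm_mul, norm_mul, norm_one, Real.norm_eq_abs (Real.exp _)]
      gcongr
      exact abs_exp_neg_mul_le (mem_Ioi.1 hz1).le hz2
  refine ⟨?_, ?_⟩
  · have h := hint.integral_prod_left
    simpa only [integral_const_mul] using h
  · calc ∫ t in Ioi 0, besselWeight t * ∫ l, Real.exp (-(t * l)) ∂m
        = ∫ t in Ioi 0, ∫ l, besselWeight t * Real.exp (-(t * l)) ∂m := by
          simp only [integral_const_mul]
      _ = ∫ l, (∫ t in Ioi 0, besselWeight t * Real.exp (-(t * l))) ∂m :=
          integral_integral_swap hint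
      _ = ∫ l, besselSymbol l ∂m := by
          refine integral_congr_ae ?_
          filter_upwards [hm] with l hl using integral_besselWeight_mul_exp hl

/-- For each $\lambda\ge0$ this is the Gamma integral for $(1+\lambda)^{-1/2}$. Pairing with a
vector $h$, polarizing, and applying Fubini to each spectral measure transfers it to operators. -/
theorem Nonneg.bessel_eq_integral (hE : E.Nonneg) (f : H) :
    E.bessel f = ∫ t in Ioi 0, besselWeight t • E.heatOp t f := by
  have hint := hE.integrableOn_smul_heatOp Subset.rfl measurableSet_Ioi integrableOn_besselWeight f
  refine ext_inner_left ℝ fun h => ?_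
  rw [← integral_inner hint, real_inner_comm, bessel, hE.bdd_bessel.inner_op, weakIntegral]
  obtain ⟨i1, e1⟩ := integral_integral_besselWeight (hE.ae_nonneg (f + h))
  obtain ⟨i2, e2⟩ := integral_integral_besselWeight (hE.ae_nonneg (f - h))
  rw [← e1, ← e2, ← integral_sub i1 i2, ← integral_const_mul]
  refine setIntegral_congr_fun measurableSet_Ioi fun t ht => ?_
  simp only [real_inner_smul_right]
  rw [heatOp, real_inner_comm, (hE.bdd_heat (mem_Ioi.1 ht).le).inner_op, weakIntegral]
  ring

end ResolutionOfIdentity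

/-! ### Heat bounds, the subcritical embedding, and the one-dimensional integrals -/

section Sobolev

open ResolutionOfIdentity

variable {X : Type*} [MeasurableSpace X] {μ : Measure X} {A : Lp ℝ 2 μ →ₗ.[ℝ] Lp ℝ 2 μ}
  {E : ResolutionOfIdentity (Lp ℝ 2 μ)}

theorem heat_eq_heatOp (hE : (spectralResolution A).Nonneg) {t : ℝ} (ht : 0 ≤ t)
    (f : Lp ℝ 2 μ) : heat A t f = (spectralResolution A).heatOp t f :=
  opFun_eq_op (hE.bdd_heat ht) f

theorem eLpNorm_two_eq (f : Lp ℝ 2 μ) : eLpNorm f 2 μ = ENNReal.ofReal ‖f‖ := by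
  rw [← Lp.enorm_def, ofReal_norm]

/-- The singular factor $t^{-\kappa}$ is moved from the operator into the weight, so that
Minkowski's inequality applies to the uniformly bounded family $t^\kappa e^{-tA}f$. -/
theorem eLpNorm_setIntegral_besselWeight_le (hE : E.Nonneg) {r M : ℝ≥0∞} (hr : 1 ≤ r) {s : Set ℝ}
    (hs : MeasurableSet s) (hs0 : s ⊆ Ioi 0) {κ : ℝ}
    (hκ : IntegrableOn (fun t => besselWeight t * t ^ (-κ)) s) {f : Lp ℝ 2 μ}
    (hf : ∀ t ∈ s, eLpNorm (E.heatOp t f) r μ ≤ ENNReal.ofReal (t ^ (-κ)) * M) :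
    eLpNorm (∫ t in s, besselWeight t • E.heatOp t f : Lp ℝ 2 μ) r μ ≤
      ENNReal.ofReal (∫ t in s, besselWeight t * t ^ (-κ)) * M := by
  have hint := hE.integrableOn_smul_heatOp hs0 hs (integrableOn_besselWeight.mono_set hs0) f
  have e : ∀ t ∈ s, besselWeight t • E.heatOp t f =
      (besselWeight t * t ^ (-κ)) • (t ^ κ • E.heatOp t f) := by
    intro t ht
    have ht0 : 0 < t := hs0 ht
    rw [smul_smul, mul_assoc, ← Real.rpow_add ht0, neg_add_cancel, Real.rpow_zero, mul_one]
  rw [setIntegral_congr_fun hs e]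
  refine eLpNorm_setIntegral_smul_le hr hs (fun t ht => ?_) hκ (fun t ht => ?_)
    (hint.congr_fun e hs)
  · exact mul_nonneg (besselWeight_nonneg (hs0 ht)) (Real.rpow_nonneg (mem_Ioi.1 (hs0 ht)).le _)
  · have ht0 : 0 < t := hs0 ht
    rw [eLpNorm_coeFn_smul, Real.enorm_of_nonneg (Real.rpow_nonneg ht0.le _)]
    calc ENNReal.ofReal (t ^ κ) * eLpNorm (E.heatOp t f) r μ
        ≤ ENNReal.ofReal (t ^ κ) * (ENNReal.ofReal (t ^ (-κ)) * M) := by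
          gcongr
          exact hf t ht
      _ = M := by
          rw [← mul_assoc, ← ENNReal.ofReal_mul (Real.rpow_nonneg ht0.le _), ← Real.rpow_add ht0,
            add_neg_cancel, Real.rpow_zero, ENNReal.ofReal_one, one_mul]

theorem eLpNorm_interpolation_top {g : X → ℝ} (hg : AEMeasurable g μ) {q : ℝ} (hq : 2 ≤ q) :
    eLpNorm g (ENNReal.ofReal q) μ ≤ eLpNorm g ∞ μ ^ (1 - 2 / q) * eLpNorm g 2 μ ^ (2 / q) := by
  have hq0 : 0 < q := by linarith
  rw [eLpNorm_eq_lintegral_rpow_enorm_toReal (by simpa using hq0) ENNReal.ofReal_ne_top,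
    eLpNorm_eq_lintegral_rpow_enorm_toReal two_ne_zero ENNReal.ofNat_ne_top,
    ENNReal.toReal_ofReal hq0.le, ENNReal.toReal_ofNat]
  have h1 : ∫⁻ x, ‖g x‖ₑ ^ q ∂μ ≤ eLpNorm g ∞ μ ^ (q - 2) * ∫⁻ x, ‖g x‖ₑ ^ (2 : ℝ) ∂μ := by
    calc ∫⁻ x, ‖g x‖ₑ ^ q ∂μ
        ≤ ∫⁻ x, eLpNorm g ∞ μ ^ (q - 2) * ‖g x‖ₑ ^ (2 : ℝ) ∂μ := by
          refine lintegral_mono_ae ?_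
          filter_upwards [enorm_ae_le_eLpNormEssSup g μ] with x hx
          calc ‖g x‖ₑ ^ q = ‖g x‖ₑ ^ (q - 2) * ‖g x‖ₑ ^ (2 : ℝ) := by
                rw [← ENNReal.rpow_add_of_nonneg _ _ (by linarith) (by norm_num), sub_add_cancel]
            _ ≤ _ := by
                rw [eLpNorm_exponent_top]
                gcongr
      _ ≤ _ := by
          rw [lintegral_const_mul'' _ (hg.enorm.pow_const _)]
  calc (∫⁻ x, ‖g x‖ₑ ^ q ∂μ) ^ (1 / q)
      ≤ (eLpNorm g ∞ μ ^ (q - 2) * ∫⁻ x, ‖g x‖ₑ ^ (2 : ℝ) ∂μ) ^ (1 / q) := by gcongr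
    _ = _ := by
        rw [ENNReal.mul_rpow_of_nonneg _ _ (by positivity), ← ENNReal.rpow_mul, ← ENNReal.rpow_mul]
        congr 2
        · field_simp
        · field_simp

/-- Interpolation between the decay $L^2\to L^\infty$ and the contraction on $L^2$. -/
theorem eLpNorm_heat_le_rpow (hE : (spectralResolution A).Nonneg) {α C q t : ℝ} (hq : 2 ≤ q)
    (hC : 0 < C) (ht : 0 < t) {f : Lp ℝ 2 μ}
    (hf : eLpNorm (heat A t f : Lp ℝ 2 μ) ∞ μ ≤ ENNReal.ofReal (C * t ^ (-α)) * eLpNorm f 2 μ) :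
    eLpNorm ((spectralResolution A).heatOp t f) (ENNReal.ofReal q) μ ≤
      ENNReal.ofReal (t ^ (-(α * (1 - 2 / q)))) *
        (ENNReal.ofReal (C ^ (1 - 2 / q)) * eLpNorm f 2 μ) := by
  have hq0 : 0 < q := by linarith
  have hθ : 0 ≤ 1 - 2 / q := by
    rw [sub_nonneg, div_le_one hq0]
    exact hq
  rw [heat_eq_heatOp hE ht.le] at hf
  have h2 : eLpNorm ((spectralResolution A).heatOp t f) 2 μ ≤ eLpNorm f 2 μ := by
    rw [eLpNorm_two_eq, eLpNorm_two_eq]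
    exact ENNReal.ofReal_le_ofReal (hE.norm_heatOp_apply_le ht.le f)
  calc eLpNorm ((spectralResolution A).heatOp t f) (ENNReal.ofReal q) μ
      ≤ _ := eLpNorm_interpolation_top (Lp.aestronglyMeasurable _).aemeasurable hq
    _ ≤ (ENNReal.ofReal (C * t ^ (-α)) * eLpNorm f 2 μ) ^ (1 - 2 / q) *
          eLpNorm f 2 μ ^ (2 / q) := by gcongr
    _ = _ := by
        rw [ENNReal.mul_rpow_of_nonneg _ _ hθ, mul_assoc,
          ← ENNReal.rpow_add_of_nonneg _ _ hθ (by positivity), sub_add_cancel, ENNReal.rpow_one,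
          ENNReal.ofReal_rpow_of_nonneg (by positivity) hθ,
          Real.mul_rpow hC.le (by positivity), ← Real.rpow_mul ht.le,
          mul_comm (C ^ (1 - 2 / q)), ENNReal.ofReal_mul (by positivity), mul_assoc, neg_mul]

/-- Interpolated heat decay costs $t^{-\kappa}$ with $\kappa=\alpha(1-2/q)$. Against the weight
$t^{-1/2}e^{-t}$ this is integrable exactly when $\kappa<1/2$. -/
theorem exists_bessel_bound_subcritical (hE : (spectralResolution A).Nonneg) {α q : ℝ}
    (hdecay : HeatDecay A α) (hq : 2 ≤ q) (hαq : α * (1 - 2 / q) < 1 / 2) :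
    ∃ C : ℝ, 0 ≤ C ∧ ∀ f : Lp ℝ 2 μ,
      eLpNorm ((spectralResolution A).bessel f) (ENNReal.ofReal q) μ ≤
        ENNReal.ofReal (C * ‖f‖) := by
  obtain ⟨C, hC, hC'⟩ := hdecay
  set κ := α * (1 - 2 / q)
  have hint : IntegrableOn (fun t => besselWeight t * t ^ (-κ)) (Ioi 0) := by
    have h := (Real.GammaIntegral_convergent (s := 1 / 2 - κ) (by linarith)).const_mul
      (Real.Gamma (1 / 2))⁻¹
    refine IntegrableOn.congr_fun h (fun t ht => ?_) measurableSet_Ioi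
    simp only [besselWeight]
    rw [mul_assoc, mul_assoc, ← Real.rpow_add (mem_Ioi.1 ht)]
    congr 3
    ring
  refine ⟨(∫ t in Ioi 0, besselWeight t * t ^ (-κ)) * C ^ (1 - 2 / q), ?_, fun f => ?_⟩
  · refine mul_nonneg (setIntegral_nonneg measurableSet_Ioi fun t ht => ?_) (by positivity)
    exact mul_nonneg (besselWeight_nonneg ht) (Real.rpow_nonneg (mem_Ioi.1 ht).le _)
  · rw [hE.bessel_eq_integral]
    refine (eLpNorm_setIntegral_besselWeight_le hE (by
      rw [ENNReal.one_le_ofReal]; linarith) measurableSet_Ioi Subset.rfl hint fun t ht =>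
        eLpNorm_heat_le_rpow hE hq hC ht (hC' t ht f)).trans (le_of_eq ?_)
    rw [eLpNorm_two_eq, ← ENNReal.ofReal_mul (by positivity), ← ENNReal.ofReal_mul' (by positivity),
      mul_assoc]

theorem besselWeight_le {t : ℝ} (ht : 0 < t) :
    besselWeight t ≤ (Real.Gamma (1 / 2))⁻¹ * t ^ (-(1 / 2) : ℝ) := by
  have := gamma_half_pos
  have h : Real.exp (-t) ≤ 1 := Real.exp_le_one_iff.2 (by linarith)
  rw [besselWeight, show (1 / 2 : ℝ) - 1 = -(1 / 2) by norm_num]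
  gcongr
  exact mul_le_of_le_one_left (by positivity) h

theorem setIntegral_besselWeight_Ioc_le {T : ℝ} (hT : 0 < T) :
    ∫ t in Ioc 0 T, besselWeight t ≤ 2 * (Real.Gamma (1 / 2))⁻¹ * T ^ (1 / 2 : ℝ) := by
  have hi : IntervalIntegrable (fun t : ℝ => t ^ (-(1 / 2) : ℝ)) volume 0 T :=
    intervalIntegral.intervalIntegrable_rpow' (by norm_num)
  calc ∫ t in Ioc 0 T, besselWeight t
      ≤ ∫ t in Ioc 0 T, (Real.Gamma (1 / 2))⁻¹ * t ^ (-(1 / 2) : ℝ) := by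
        refine setIntegral_mono_on (integrableOn_besselWeight.mono_set Ioc_subset_Ioi_self)
          ((intervalIntegrable_iff_integrableOn_Ioc_of_le hT.le).1 (hi.const_mul _))
          measurableSet_Ioc fun t ht => besselWeight_le ht.1
    _ = _ := by
        rw [integral_const_mul, ← intervalIntegral.integral_of_le hT.le,
          integral_rpow (Or.inl (by norm_num)), Real.zero_rpow (by norm_num)]
        norm_num
        ring

/-- Dropping $e^{-t}$ leaves $t^{-1/2-\alpha}$, integrable at infinity because $\alpha>1/2$. The
resulting pure power of $T$ can be solved for $T$ in terms of the level $s$. -/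
theorem setIntegral_besselWeight_Ioi_le {T α : ℝ} (hT : 0 < T) (hα : 1 / 2 < α) :
    IntegrableOn (fun t => besselWeight t * t ^ (-α)) (Ioi T) ∧
    ∫ t in Ioi T, besselWeight t * t ^ (-α) ≤
      (Real.Gamma (1 / 2))⁻¹ * (α - 1 / 2)⁻¹ * T ^ (1 / 2 - α) := by
  have hi : IntegrableOn (fun t : ℝ => (Real.Gamma (1 / 2))⁻¹ * t ^ (-(1 / 2) - α)) (Ioi T) :=
    (integrableOn_Ioi_rpow_of_lt (by linarith) hT).const_mul _
  have hle : ∀ t ∈ Ioi T, besselWeight t * t ^ (-α) ≤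
      (Real.Gamma (1 / 2))⁻¹ * t ^ (-(1 / 2) - α) := by
    intro t ht
    have ht0 : 0 < t := hT.trans ht
    rw [sub_eq_add_neg, Real.rpow_add ht0, ← mul_assoc]
    exact mul_le_mul_of_nonneg_right (besselWeight_le ht0) (by positivity)
  have hi2 : IntegrableOn (fun t => besselWeight t * t ^ (-α)) (Ioi T) := by
    refine Integrable.mono' hi ?_ ?_
    · refine ((integrableOn_besselWeight.mono_set
        (Ioi_subset_Ioi hT.le)).aestronglyMeasurable).mul ?_
      exact (by fun_prop : Measurable fun t : ℝ => t ^ (-α)).aestronglyMeasurable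
    · filter_upwards [ae_restrict_mem measurableSet_Ioi] with t ht
      rw [Real.norm_of_nonneg (mul_nonneg (besselWeight_nonneg (hT.trans ht))
        (Real.rpow_nonneg (hT.trans ht).le _))]
      exact hle t ht
  refine ⟨hi2, (setIntegral_mono_on hi2 hi measurableSet_Ioi hle).trans (le_of_eq ?_)⟩
  rw [integral_const_mul, integral_Ioi_rpow_of_lt (by linarith) hT, mul_assoc]
  congr 1
  rw [show -(1 / 2) - α + 1 = -(α - 1 / 2) by ring, show 1 / 2 - α = -(α - 1 / 2) by ring,
    neg_div_neg_eq, div_eq_inv_mul]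

/-- The inner integral runs over $0<s<y^{1/\gamma}$ and gives $y^{2-r}/(\gamma(2-r))$, since $r<2$
makes the power integrable at $0$. The remaining $y^r$ restores $y^2$, whatever $r$ is. -/
theorem lintegral_Ioi_rpow_lt_le {y r γ : ℝ} (hy : 0 ≤ y) (hr : r < 2) (hγ : 0 < γ) :
    ∫⁻ s in Ioi (0 : ℝ), ENNReal.ofReal (s ^ (γ * (2 - r) - 1)) *
        (if s ^ γ < y then ENNReal.ofReal (y ^ r) else 0) ≤
      ENNReal.ofReal ((γ * (2 - r))⁻¹) * ENNReal.ofReal (y ^ (2 : ℝ)) := by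
  rcases hy.eq_or_lt with rfl | hy
  · refine le_of_eq_of_le ((setLIntegral_congr_fun measurableSet_Ioi (g := fun _ => 0)
      fun s hs => ?_).trans lintegral_zero) zero_le
    have : ¬ s ^ γ < 0 := not_lt.2 (Real.rpow_nonneg (mem_Ioi.1 hs).le _)
    simp [this]
  have ha : 0 < γ * (2 - r) := mul_pos hγ (by linarith)
  set m := y ^ γ⁻¹ with hm
  have hm0 : 0 < m := Real.rpow_pos_of_pos hy _
  have hi : IntegrableOn (fun t : ℝ => t ^ (γ * (2 - r) - 1)) (Ioc 0 m) :=
    (intervalIntegrable_iff_integrableOn_Ioc_of_le hm0.le).1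
      (intervalIntegral.intervalIntegrable_rpow' (by linarith))
  calc ∫⁻ s in Ioi (0 : ℝ), ENNReal.ofReal (s ^ (γ * (2 - r) - 1)) *
        (if s ^ γ < y then ENNReal.ofReal (y ^ r) else 0)
      ≤ ∫⁻ s in Ioi (0 : ℝ), (Ioc 0 m).indicator
          (fun s => ENNReal.ofReal (s ^ (γ * (2 - r) - 1)) * ENNReal.ofReal (y ^ r)) s := by
        refine setLIntegral_mono' measurableSet_Ioi fun s hs => ?_
        split_ifs with h
        · have : s ∈ Ioc 0 m := ⟨hs, by
            rw [hm]
            exact ((Real.lt_rpow_inv_iff_of_pos (mem_Ioi.1 hs).le hy.le hγ).2 h).le⟩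
          rw [indicator_of_mem this]
        · simp
    _ = (∫⁻ s in Ioc 0 m, ENNReal.ofReal (s ^ (γ * (2 - r) - 1))) * ENNReal.ofReal (y ^ r) := by
        rw [lintegral_indicator measurableSet_Ioc, Measure.restrict_restrict measurableSet_Ioc,
          inter_eq_left.2 Ioc_subset_Ioi_self, lintegral_mul_const' _ _ ENNReal.ofReal_ne_top]
    _ = _ := by
        rw [← ofReal_integral_eq_lintegral_ofReal hi ((ae_restrict_iff' measurableSet_Ioc).2
            (ae_of_all _ fun s hs => Real.rpow_nonneg hs.1.le _)),
          ← intervalIntegral.integral_of_le hm0.le, integral_rpow (Or.inl (by linarith)),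
          sub_add_cancel, Real.zero_rpow ha.ne', sub_zero, div_eq_inv_mul,
          ENNReal.ofReal_mul (by positivity), mul_assoc, ← ENNReal.ofReal_mul (by positivity), hm,
          ← Real.rpow_mul hy.le, ← Real.rpow_add hy]
        congr 3
        field_simp
        ring

/-- Mirror image of the preceding bound: now $s\ge y^{1/\gamma}$, and $r>2$ gives integrability at
infinity. -/
theorem lintegral_Ioi_rpow_ge_le {y r γ : ℝ} (hy : 0 ≤ y) (hr : 2 < r) (hγ : 0 < γ) :
    ∫⁻ s in Ioi (0 : ℝ), ENNReal.ofReal (s ^ (γ * (2 - r) - 1)) *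
        (if ¬ s ^ γ < y then ENNReal.ofReal (y ^ r) else 0) ≤
      ENNReal.ofReal ((γ * (r - 2))⁻¹) * ENNReal.ofReal (y ^ (2 : ℝ)) := by
  rcases hy.eq_or_lt with rfl | hy
  · simp [Real.zero_rpow (by linarith : r ≠ 0)]
  have ha : 0 < γ * (r - 2) := mul_pos hγ (by linarith)
  set m := y ^ γ⁻¹ with hm
  have hm0 : 0 < m := Real.rpow_pos_of_pos hy _
  have hi : IntegrableOn (fun t : ℝ => t ^ (γ * (2 - r) - 1)) (Ioi m) :=
    integrableOn_Ioi_rpow_of_lt (by nlinarith) hm0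
  calc ∫⁻ s in Ioi (0 : ℝ), ENNReal.ofReal (s ^ (γ * (2 - r) - 1)) *
        (if ¬ s ^ γ < y then ENNReal.ofReal (y ^ r) else 0)
      ≤ ∫⁻ s in Ioi (0 : ℝ), (Ici m).indicator
          (fun s => ENNReal.ofReal (s ^ (γ * (2 - r) - 1)) * ENNReal.ofReal (y ^ r)) s := by
        refine setLIntegral_mono' measurableSet_Ioi fun s hs => ?_
        split_ifs with h
        · simp
        · have : s ∈ Ici m := by
            rw [mem_Ici, hm]
            exact (Real.rpow_inv_le_iff_of_pos hy.le (mem_Ioi.1 hs).le hγ).2 (not_lt.1 h)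
          rw [indicator_of_mem this]
    _ = (∫⁻ s in Ioi m, ENNReal.ofReal (s ^ (γ * (2 - r) - 1))) * ENNReal.ofReal (y ^ r) := by
        rw [lintegral_indicator measurableSet_Ici, Measure.restrict_restrict measurableSet_Ici,
          inter_eq_left.2 (Ici_subset_Ioi.2 hm0), lintegral_mul_const' _ _ ENNReal.ofReal_ne_top,
          setLIntegral_congr Ioi_ae_eq_Ici]
    _ = _ := by
        rw [← ofReal_integral_eq_lintegral_ofReal hi ((ae_restrict_iff' measurableSet_Ioi).2
            (ae_of_all _ fun s hs => Real.rpow_nonneg (hm0.trans hs).le _)),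
          integral_Ioi_rpow_of_lt (by nlinarith) hm0,
          sub_add_cancel, show γ * (2 - r) = -(γ * (r - 2)) by ring, neg_div_neg_eq,
          div_eq_inv_mul, ENNReal.ofReal_mul (by positivity), mul_assoc,
          ← ENNReal.ofReal_mul (by positivity), hm, ← Real.rpow_mul hy.le, ← Real.rpow_add hy]
        congr 3
        field_simp
        ring

end Sobolev

/-! ### The critical Sobolev embedding -/

section CriticalSobolev

open ResolutionOfIdentity

variable {X : Type*} [MeasurableSpace X] {μ : Measure X} {A : Lp ℝ 2 μ →ₗ.[ℝ] Lp ℝ 2 μ}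
  {E : ResolutionOfIdentity (Lp ℝ 2 μ)}

variable (E) in
/-- The part `∫_{(0,T]} w(t) e^{-tA} f dt` of the subordination formula for small times. -/
def besselHead (T : ℝ) (f : Lp ℝ 2 μ) : Lp ℝ 2 μ :=
  ∫ t in Ioc 0 T, besselWeight t • E.heatOp t f

variable (E) in
/-- The part `∫_{(T,∞)} w(t) e^{-tA} f dt` of the subordination formula for large times. -/
def besselTail (T : ℝ) (f : Lp ℝ 2 μ) : Lp ℝ 2 μ :=
  ∫ t in Ioi T, besselWeight t • E.heatOp t f

theorem besselHead_add_besselTail (hE : E.Nonneg) {T : ℝ} (hT : 0 < T) (f : Lp ℝ 2 μ) :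
    E.bessel f = besselHead E T f + besselTail E T f := by
  have hint := hE.integrableOn_smul_heatOp Subset.rfl measurableSet_Ioi integrableOn_besselWeight f
  rw [hE.bessel_eq_integral, besselHead, besselTail, ← Ioc_union_Ioi_eq_Ioi hT.le,
    setIntegral_union Ioc_disjoint_Ioi_same measurableSet_Ioi
      (hint.mono_set Ioc_subset_Ioi_self) (hint.mono_set (Ioi_subset_Ioi hT.le))]

theorem besselHead_add (hE : E.Nonneg) (T : ℝ) (f g : Lp ℝ 2 μ) :
    besselHead E T (f + g) = besselHead E T f + besselHead E T g := by
  have hint := fun f : Lp ℝ 2 μ => hE.integrableOn_smul_heatOp (s := Ioc 0 T) Ioc_subset_Ioi_self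
    measurableSet_Ioc (integrableOn_besselWeight.mono_set Ioc_subset_Ioi_self) f
  simp only [besselHead, map_add, smul_add]
  exact integral_add (hint f) (hint g)

theorem exists_besselTail_bound (hE : (spectralResolution A).Nonneg) {α : ℝ} (hα : 1 / 2 < α)
    (hdecay : HeatDecay A α) :
    ∃ C : ℝ, 0 < C ∧ ∀ T, 0 < T → ∀ f : Lp ℝ 2 μ, ‖f‖ ≤ 1 →
      eLpNorm (besselTail (spectralResolution A) T f) ∞ μ ≤
        ENNReal.ofReal (C * T ^ (1 / 2 - α)) := by
  obtain ⟨C, hC, hC'⟩ := hdecay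
  have hΓ := gamma_half_pos
  have hα' : 0 < α - 1 / 2 := by linarith
  refine ⟨(Real.Gamma (1 / 2))⁻¹ * (α - 1 / 2)⁻¹ * C, by positivity, fun T hT f hf => ?_⟩
  obtain ⟨hi, hle⟩ := setIntegral_besselWeight_Ioi_le hT hα
  have h := eLpNorm_setIntegral_besselWeight_le hE (r := ∞) (M := ENNReal.ofReal C) (f := f) le_top
    measurableSet_Ioi (Ioi_subset_Ioi hT.le) hi (fun t ht => by
      have ht0 : 0 < t := hT.trans ht
      have h1 := hC' t ht0 f
      rw [heat_eq_heatOp hE ht0.le, eLpNorm_two_eq] at h1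
      refine h1.trans ?_
      rw [← ENNReal.ofReal_mul (by positivity), ← ENNReal.ofReal_mul (by positivity)]
      refine ENNReal.ofReal_le_ofReal ?_
      calc C * t ^ (-α) * ‖f‖ ≤ C * t ^ (-α) * 1 := by gcongr
        _ = _ := by ring)
  refine h.trans ?_
  rw [← ENNReal.ofReal_mul' hC.le]
  refine ENNReal.ofReal_le_ofReal ?_
  calc (∫ t in Ioi T, besselWeight t * t ^ (-α)) * C
      ≤ (Real.Gamma (1 / 2))⁻¹ * (α - 1 / 2)⁻¹ * T ^ (1 / 2 - α) * C := by gcongr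
    _ = _ := by ring

theorem exists_besselHead_bound (hE : (spectralResolution A).Nonneg) {α r : ℝ} (hα : 1 / 2 < α)
    (hLq : HeatLqBounds A α) (hr : 4 * α / (4 * α - 1) < r) (hr' : r < 4 * α) :
    ∃ C : ℝ, 0 < C ∧ ∀ T, 0 < T → ∀ f : Lp ℝ 2 μ,
      eLpNorm (besselHead (spectralResolution A) T f) (ENNReal.ofReal r) μ ≤
        ENNReal.ofReal (C * T ^ (1 / 2 : ℝ)) * eLpNorm f (ENNReal.ofReal r) μ := by
  obtain ⟨C, hC, hC'⟩ := hLq hα r hr hr'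
  have hΓ := gamma_half_pos
  have hr1 : 1 ≤ r := by
    refine le_trans ?_ hr.le
    rw [le_div_iff₀ (by linarith)]
    linarith
  refine ⟨2 * (Real.Gamma (1 / 2))⁻¹ * C, by positivity, fun T hT f => ?_⟩
  by_cases hf : eLpNorm f (ENNReal.ofReal r) μ = ∞
  · rw [hf, ENNReal.mul_top]
    · exact le_top
    · simp only [ne_eq, ENNReal.ofReal_eq_zero, not_le]
      positivity
  have hint := hE.integrableOn_smul_heatOp (s := Ioc 0 T) Ioc_subset_Ioi_self
    measurableSet_Ioc (integrableOn_besselWeight.mono_set Ioc_subset_Ioi_self) f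
  have h := eLpNorm_setIntegral_smul_le (r := ENNReal.ofReal r) (by rwa [ENNReal.one_le_ofReal])
    measurableSet_Ioc (fun t ht => besselWeight_nonneg ht.1)
    (integrableOn_besselWeight.mono_set Ioc_subset_Ioi_self)
    (M := ENNReal.ofReal C * eLpNorm f (ENNReal.ofReal r) μ) (fun t ht => by
      have h1 := (hC' t ht.1 f ⟨Lp.aestronglyMeasurable _, lt_top_iff_ne_top.2 hf⟩).1
      rwa [heat_eq_heatOp hE ht.1.le] at h1) hint
  refine h.trans ?_
  rw [← mul_assoc, ← ENNReal.ofReal_mul' hC.le]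
  refine mul_le_mul_left (ENNReal.ofReal_le_ofReal ?_) _
  calc (∫ t in Ioc 0 T, besselWeight t) * C
      ≤ 2 * (Real.Gamma (1 / 2))⁻¹ * T ^ (1 / 2 : ℝ) * C := by
        gcongr
        exact setIntegral_besselWeight_Ioc_le hT
    _ = _ := by ring

theorem eLpNorm_rpow_eq_lintegral (g : X → ℝ) {r : ℝ} (hr : 0 < r) :
    eLpNorm g (ENNReal.ofReal r) μ ^ r = ∫⁻ x, ENNReal.ofReal (|g x| ^ r) ∂μ := by
  rw [eLpNorm_eq_lintegral_rpow_enorm_toReal (by simpa using hr) ENNReal.ofReal_ne_top,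
    ENNReal.toReal_ofReal hr.le, ← ENNReal.rpow_mul, one_div, inv_mul_cancel₀ hr.ne',
    ENNReal.rpow_one]
  refine lintegral_congr fun x => ?_
  rw [← ENNReal.ofReal_rpow_of_nonneg (abs_nonneg _) hr.le, ← Real.norm_eq_abs, ofReal_norm]

/-- Chebyshev's inequality for the small-time part. -/
theorem measure_besselHead_ge_le {C r s T c γ : ℝ} {f : Lp ℝ 2 μ} (hr : 0 < r) (hs : 0 < s)
    (hC : 0 < C) (hc : 0 < c) (hT : T ^ (1 / 2 : ℝ) = c * s ^ (1 - γ))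
    (h : eLpNorm (besselHead E T f) (ENNReal.ofReal r) μ ≤
        ENNReal.ofReal (C * T ^ (1 / 2 : ℝ)) * eLpNorm f (ENNReal.ofReal r) μ) :
    μ {x | s / 4 ≤ |besselHead E T f x|} ≤
      ENNReal.ofReal ((4 * C * c) ^ r) *
        (ENNReal.ofReal (s ^ (-(γ * r))) * ∫⁻ x, ENNReal.ofReal (|f x| ^ r) ∂μ) := by
  have h1 := meas_ge_le_mul_pow_eLpNorm_enorm μ (p := ENNReal.ofReal r)
    (f := besselHead E T f) (by simpa using hr) ENNReal.ofReal_ne_top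
    (Lp.aestronglyMeasurable _) (ε := ENNReal.ofReal (s / 4)) (by simpa using hs)
    (fun h => absurd h ENNReal.ofReal_ne_top)
  have e1 : {x | s / 4 ≤ |besselHead E T f x|} =
      {x | ENNReal.ofReal (s / 4) ≤ ‖besselHead E T f x‖ₑ} := by
    ext x
    rw [mem_ofPred_eq, mem_ofPred_eq, ← ofReal_norm, Real.norm_eq_abs,
      ENNReal.ofReal_le_ofReal_iff (abs_nonneg _)]
  rw [e1]
  refine h1.trans ?_
  rw [ENNReal.toReal_ofReal hr.le]
  calc (ENNReal.ofReal (s / 4))⁻¹ ^ r * eLpNorm (besselHead E T f) (ENNReal.ofReal r) μ ^ r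
      ≤ (ENNReal.ofReal (s / 4))⁻¹ ^ r *
          (ENNReal.ofReal (C * T ^ (1 / 2 : ℝ)) * eLpNorm f (ENNReal.ofReal r) μ) ^ r := by gcongr
    _ = _ := by
        rw [ENNReal.mul_rpow_of_nonneg _ _ hr.le, eLpNorm_rpow_eq_lintegral _ hr, ← mul_assoc,
          ← mul_assoc, hT, ← ENNReal.ofReal_inv_of_pos (by positivity),
          ENNReal.ofReal_rpow_of_nonneg (by positivity) hr.le,
          ENNReal.ofReal_rpow_of_nonneg (by positivity) hr.le,
          ← ENNReal.ofReal_mul (by positivity), ← ENNReal.ofReal_mul (by positivity),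
          ← Real.mul_rpow (by positivity) (by positivity), ← neg_mul,
          Real.rpow_mul hs.le, ← Real.mul_rpow (by positivity) (by positivity)]
        congr 3
        rw [sub_eq_add_neg, Real.rpow_add hs, Real.rpow_one]
        field_simp

/-- Integration over the levels of the truncated moments of `f`. -/
theorem lintegral_level_truncation_le [SFinite μ] {r γ c : ℝ} {f : Lp ℝ 2 μ} (hf : ‖f‖ ≤ 1)
    {P : ℝ → ℝ → Prop} [∀ s y, Decidable (P s y)] (hP : MeasurableSet {z : ℝ × ℝ | P z.1 z.2})
    (h : ∀ y, 0 ≤ y → ∫⁻ s in Ioi (0 : ℝ), ENNReal.ofReal (s ^ (γ * (2 - r) - 1)) *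
        (if P s y then ENNReal.ofReal (y ^ r) else 0) ≤
      ENNReal.ofReal c * ENNReal.ofReal (y ^ (2 : ℝ))) :
    ∫⁻ s in Ioi (0 : ℝ), ENNReal.ofReal (s ^ (γ * (2 - r) - 1)) *
      ∫⁻ x, (if P s |f x| then ENNReal.ofReal (|f x| ^ r) else 0) ∂μ ≤ ENNReal.ofReal c := by
  have hfm : Measurable fun x => |f x| := (Lp.stronglyMeasurable f).measurable.abs
  have hmeas : Measurable fun z : ℝ × X => ENNReal.ofReal (z.1 ^ (γ * (2 - r) - 1)) *
      (if P z.1 |f z.2| then ENNReal.ofReal (|f z.2| ^ r) else 0) := by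
    refine Measurable.mul (by fun_prop) (Measurable.ite ?_ ?_ measurable_const)
    · exact (measurable_fst.prodMk (hfm.comp measurable_snd)) hP
    · exact ((hfm.comp measurable_snd).pow_const r).ennreal_ofReal
  calc _ = ∫⁻ s in Ioi (0 : ℝ), ∫⁻ x, ENNReal.ofReal (s ^ (γ * (2 - r) - 1)) *
          (if P s |f x| then ENNReal.ofReal (|f x| ^ r) else 0) ∂μ := by
        refine lintegral_congr fun s => ?_
        rw [lintegral_const_mul' _ _ ENNReal.ofReal_ne_top]
    _ = ∫⁻ x, (∫⁻ s in Ioi (0 : ℝ), ENNReal.ofReal (s ^ (γ * (2 - r) - 1)) *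
          (if P s |f x| then ENNReal.ofReal (|f x| ^ r) else 0)) ∂μ :=
        lintegral_lintegral_swap hmeas.aemeasurable
    _ ≤ ∫⁻ x, ENNReal.ofReal c * ENNReal.ofReal (|f x| ^ (2 : ℝ)) ∂μ :=
        lintegral_mono fun x => h _ (abs_nonneg _)
    _ = ENNReal.ofReal c * eLpNorm f 2 μ ^ (2 : ℝ) := by
        rw [lintegral_const_mul' _ _ ENNReal.ofReal_ne_top, ← eLpNorm_rpow_eq_lintegral _ two_pos]
        norm_num
    _ ≤ ENNReal.ofReal c * 1 ^ (2 : ℝ) := by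
        rw [eLpNorm_two_eq]
        gcongr
        rwa [ENNReal.ofReal_le_one]
    _ = ENNReal.ofReal c := by simp

/-- The decomposition of `f` into its parts on a measurable set and on the complement. -/
theorem exists_truncation (f : Lp ℝ 2 μ) {S : Set X} (hS : MeasurableSet S) :
    ∃ f₁ f₂ : Lp ℝ 2 μ, f = f₁ + f₂ ∧ f₁ =ᵐ[μ] S.indicator f ∧ f₂ =ᵐ[μ] Sᶜ.indicator f := by
  have h1 : MemLp (S.indicator f) 2 μ := (Lp.memLp f).indicator hS
  have h2 : MemLp (Sᶜ.indicator f) 2 μ := (Lp.memLp f).indicator hS.compl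
  refine ⟨h1.toLp _, h2.toLp _, ?_, h1.coeFn_toLp, h2.coeFn_toLp⟩
  refine Lp.ext ?_
  filter_upwards [Lp.coeFn_add (h1.toLp _) (h2.toLp _), h1.coeFn_toLp, h2.coeFn_toLp]
    with x e e1 e2
  rw [e, Pi.add_apply, e1, e2, indicator_self_add_compl_apply]

/-- Marcinkiewicz-type argument. With $\gamma=2\alpha/(2\alpha-1)$ and $\|f\|\le1$, the cut $T(s)$
makes the large-time part at most $s/2$, so $|(I+A)^{-1/2}f|>s$ forces the small-time part of $f_1$
or of $f_2$ to reach $s/4$, where $f_1$ and $f_2$ are the parts of $f$ above and below height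
$s^\gamma$. Chebyshev in $L^r$ for $f_1$ and in $L^q$ for $f_2$, with $r<2<q$, bounds the level
sets. Multiplying by $s^{2\gamma-1}$ and integrating in $s$ leaves $\int|f|^2$ in both cases. -/
theorem exists_lintegral_bessel_critical [SigmaFinite μ] (hE : (spectralResolution A).Nonneg)
    {α : ℝ} (hα : 1 / 2 < α) (hdecay : HeatDecay A α) (hLq : HeatLqBounds A α) :
    ∃ K : ℝ≥0∞, K ≠ ∞ ∧ ∀ f : Lp ℝ 2 μ, ‖f‖ ≤ 1 →
      ∫⁻ x, ENNReal.ofReal (|(spectralResolution A).bessel f x| ^ (2 * (2 * α / (2 * α - 1)))) ∂μ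
        ≤ K := by
  set E := spectralResolution A
  have hα1 : 0 < 2 * α - 1 := by linarith
  set γ := 2 * α / (2 * α - 1) with hγ
  have hγ1 : γ - 1 = 1 / (2 * α - 1) := by rw [hγ]; field_simp; ring
  have hγ0 : 0 < γ := by rw [hγ]; apply div_pos <;> linarith
  -- The interval of exponents in (B) contains $2$ in its interior precisely because $\alpha>1/2$.
  obtain ⟨r, hr, hr2⟩ : ∃ r, 4 * α / (4 * α - 1) < r ∧ r < 2 := by
    refine exists_between ?_
    rw [div_lt_iff₀ (by linarith)]
    linarith
  obtain ⟨q, hq2, hq⟩ : ∃ q, 2 < q ∧ q < 4 * α := exists_between (by linarith)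
  have hr0 : 0 < r := lt_trans (div_pos (by linarith) (by linarith)) hr
  obtain ⟨C, hC, hCtail⟩ := exists_besselTail_bound hE hα hdecay
  obtain ⟨B, hB, hBhead⟩ := exists_besselHead_bound hE hα hLq hr (by linarith)
  obtain ⟨D, hD, hDhead⟩ := exists_besselHead_bound hE hα hLq (r := q) (by linarith) hq
  set c : ℝ := (2 * C) ^ (γ - 1)
  have hc : 0 < c := by positivity
  refine ⟨ENNReal.ofReal (2 * γ) *
    (ENNReal.ofReal ((4 * B * c) ^ r) * ENNReal.ofReal ((γ * (2 - r))⁻¹) +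
      ENNReal.ofReal ((4 * D * c) ^ q) * ENNReal.ofReal ((γ * (q - 2))⁻¹)),
    by finiteness, fun f hf => ?_⟩
  have hlevel : ∀ s : ℝ, 0 < s → μ {x | s < |E.bessel f x|} * ENNReal.ofReal (s ^ (2 * γ - 1)) ≤
      ENNReal.ofReal ((4 * B * c) ^ r) * (ENNReal.ofReal (s ^ (γ * (2 - r) - 1)) *
        ∫⁻ x, (if s ^ γ < |f x| then ENNReal.ofReal (|f x| ^ r) else 0) ∂μ) +
      ENNReal.ofReal ((4 * D * c) ^ q) * (ENNReal.ofReal (s ^ (γ * (2 - q) - 1)) *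
        ∫⁻ x, (if ¬ s ^ γ < |f x| then ENNReal.ofReal (|f x| ^ q) else 0) ∂μ) := by
    intro s hs
    -- The solution of $CT^{1/2-\alpha}=s/2$, since $\gamma-1=1/(2\alpha-1)$. Then
    -- $T^{1/2}=c\,s^{1-\gamma}$ is the factor lost in the small-time bounds.
    set T : ℝ := (s / (2 * C)) ^ (2 * (1 - γ)) with hT
    have hT0 : 0 < T := by positivity
    have hTtail : C * T ^ (1 / 2 - α) = s / 2 := by
      rw [hT, ← Real.rpow_mul (by positivity),
        show 2 * (1 - γ) * (1 / 2 - α) = (γ - 1) * (2 * α - 1) by ring, hγ1,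
        one_div_mul_cancel hα1.ne', Real.rpow_one]
      field_simp
    have hThead : T ^ (1 / 2 : ℝ) = c * s ^ (1 - γ) := by
      rw [hT, ← Real.rpow_mul (by positivity), show 2 * (1 - γ) * (1 / 2) = 1 - γ by ring,
        Real.div_rpow hs.le (by positivity), div_eq_inv_mul, ← Real.rpow_neg (by positivity),
        neg_sub]
    have hS : MeasurableSet {x | s ^ γ < |f x|} :=
      measurableSet_lt measurable_const (Lp.stronglyMeasurable f).measurable.abs
    obtain ⟨f₁, f₂, hsum, hf₁, hf₂⟩ := exists_truncation f hS
    have e₁ : ∫⁻ x, ENNReal.ofReal (|f₁ x| ^ r) ∂μ =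
        ∫⁻ x, (if s ^ γ < |f x| then ENNReal.ofReal (|f x| ^ r) else 0) ∂μ := by
      refine lintegral_congr_ae ?_
      filter_upwards [hf₁] with x hx
      rw [hx]
      by_cases h : s ^ γ < |f x|
      · rw [indicator_of_mem (by exact h), if_pos h]
      · rw [indicator_of_notMem (by exact h), if_neg h, abs_zero, Real.zero_rpow hr0.ne',
          ENNReal.ofReal_zero]
    have e₂ : ∫⁻ x, ENNReal.ofReal (|f₂ x| ^ q) ∂μ =
        ∫⁻ x, (if ¬ s ^ γ < |f x| then ENNReal.ofReal (|f x| ^ q) else 0) ∂μ := by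
      refine lintegral_congr_ae ?_
      filter_upwards [hf₂] with x hx
      rw [hx]
      by_cases h : s ^ γ < |f x|
      · rw [indicator_of_notMem (by simpa using h), if_neg (not_not.2 h), abs_zero,
          Real.zero_rpow (by linarith), ENNReal.ofReal_zero]
      · rw [indicator_of_mem (by simpa using h), if_pos h]
    have hsub : μ {x | s < |E.bessel f x|} ≤ μ {x | s / 4 ≤ |besselHead E T f₁ x|} +
        μ {x | s / 4 ≤ |besselHead E T f₂ x|} := by
      refine le_trans (measure_mono_ae ?_) (measure_union_le _ _)
      have hdec : E.bessel f = besselHead E T f₁ + besselHead E T f₂ + besselTail E T f := by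
        rw [besselHead_add_besselTail hE hT0, ← besselHead_add hE, ← hsum]
      have htail := enorm_ae_le_eLpNormEssSup (besselTail E T f) μ
      rw [hdec]
      filter_upwards [htail, Lp.coeFn_add (besselHead E T f₁ + besselHead E T f₂)
        (besselTail E T f), Lp.coeFn_add (besselHead E T f₁) (besselHead E T f₂)]
        with x h1 h2 h3 (h4 : s < |_|)
      have h5 : |besselTail E T f x| ≤ s / 2 := by
        have := h1.trans ((eLpNorm_exponent_top (f := besselTail E T f) (μ := μ)).symm.le.trans
          (hCtail T hT0 f hf))
        rw [hTtail, ← ofReal_norm, ENNReal.ofReal_le_ofReal_iff (by positivity)] at this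
        exact this
      rw [h2, Pi.add_apply, h3, Pi.add_apply] at h4
      by_contra hcon
      have hcon' : ¬ (s / 4 ≤ |besselHead E T f₁ x| ∨ s / 4 ≤ |besselHead E T f₂ x|) := hcon
      rw [not_or, not_le, not_le] at hcon'
      have h6 := abs_add_three (besselHead E T f₁ x) (besselHead E T f₂ x) (besselTail E T f x)
      linarith
    have m₁ := measure_besselHead_ge_le hr0 hs hB hc hThead (hBhead T hT0 f₁)
    have m₂ := measure_besselHead_ge_le (by linarith) hs hD hc hThead (hDhead T hT0 f₂)
    rw [e₁] at m₁
    rw [e₂] at m₂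
    have hpow : ∀ r : ℝ, ENNReal.ofReal (s ^ (γ * (2 - r) - 1)) =
        ENNReal.ofReal (s ^ (-(γ * r))) * ENNReal.ofReal (s ^ (2 * γ - 1)) := by
      intro r
      rw [← ENNReal.ofReal_mul (by positivity), ← Real.rpow_add hs]
      congr 2
      ring
    calc μ {x | s < |E.bessel f x|} * ENNReal.ofReal (s ^ (2 * γ - 1))
        ≤ (_ + _) * ENNReal.ofReal (s ^ (2 * γ - 1)) :=
          mul_le_mul_left (hsub.trans (add_le_add m₁ m₂)) _
      _ = _ := by
          rw [hpow, hpow]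
          ring
  -- Layer-cake formula for the power $2\gamma$.
  rw [lintegral_rpow_eq_lintegral_meas_lt_mul μ (Eventually.of_forall fun x => abs_nonneg _)
    (Lp.stronglyMeasurable _).measurable.abs.aemeasurable (by positivity)]
  refine mul_le_mul_right ?_ _
  have hlt : MeasurableSet {z : ℝ × ℝ | z.1 ^ γ < z.2} :=
    measurableSet_lt (by fun_prop) (by fun_prop)
  have hfm : Measurable fun x => |f x| := (Lp.stronglyMeasurable f).measurable.abs
  have hmeas : Measurable fun s : ℝ => ENNReal.ofReal ((4 * B * c) ^ r) *
      (ENNReal.ofReal (s ^ (γ * (2 - r) - 1)) *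
        ∫⁻ x, (if s ^ γ < |f x| then ENNReal.ofReal (|f x| ^ r) else 0) ∂μ) := by
    refine measurable_const.mul (Measurable.mul (by fun_prop) ?_)
    refine Measurable.lintegral_prod_right' (f := fun z : ℝ × X =>
      if z.1 ^ γ < |f z.2| then ENNReal.ofReal (|f z.2| ^ r) else 0) ?_
    refine Measurable.ite ?_ ((hfm.comp measurable_snd).pow_const r).ennreal_ofReal
      measurable_const
    exact (measurable_fst.prodMk (hfm.comp measurable_snd)) hlt
  refine (setLIntegral_mono' measurableSet_Ioi hlevel).trans ?_
  rw [lintegral_add_left hmeas, lintegral_const_mul' _ _ ENNReal.ofReal_ne_top,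
    lintegral_const_mul' _ _ ENNReal.ofReal_ne_top]
  gcongr
  · exact lintegral_level_truncation_le (P := fun s y => s ^ γ < y) hf hlt
      fun y hy => lintegral_Ioi_rpow_lt_le hy hr2 hγ0
  · exact lintegral_level_truncation_le (P := fun s y => ¬ s ^ γ < y) hf hlt.compl
      fun y hy => lintegral_Ioi_rpow_ge_le hy hq2 hγ0

/-- The Sobolev embedding `H^1(A) ⊂ L^{2p}`. -/
theorem exists_bessel_bound [SigmaFinite μ] (hE : (spectralResolution A).Nonneg) {α p : ℝ}
    (hα : 0 < α) (hdecay : HeatDecay A α) (hLq : HeatLqBounds A α) (hp : 1 < p)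
    (hpα : 1 / 2 < α → p ≤ 2 * α / (2 * α - 1)) :
    ∃ C : ℝ, 0 ≤ C ∧ ∀ f : Lp ℝ 2 μ,
      eLpNorm ((spectralResolution A).bessel f) (ENNReal.ofReal (2 * p)) μ ≤
        ENNReal.ofReal (C * ‖f‖) := by
  -- For $\alpha\le1/2$ one has $\alpha(1-1/p)<1/2$ for every $p$, so interpolation suffices. For
  -- $\alpha>1/2$ one has $2\le2p\le2\gamma$, and $y^{2p}\le y^2+y^{2\gamma}$ reduces the claim to
  -- $L^2$ and the endpoint.
  rcases le_or_gt α (1 / 2) with h | h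
  · refine exists_bessel_bound_subcritical hE hdecay (by linarith) ?_
    have h1 : 0 < 2 / (2 * p) := by positivity
    nlinarith
  set E := spectralResolution A
  obtain ⟨K, hK, hK'⟩ := exists_lintegral_bessel_critical hE h hdecay hLq
  have hp0 : 0 < 2 * p := by linarith
  have hunit : ∀ f : Lp ℝ 2 μ, ‖f‖ ≤ 1 →
      eLpNorm (E.bessel f) (ENNReal.ofReal (2 * p)) μ ≤ (1 + K) ^ (2 * p)⁻¹ := by
    intro f hf
    rw [ENNReal.le_rpow_inv_iff hp0, eLpNorm_rpow_eq_lintegral _ hp0]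
    have hb : ‖E.bessel f‖ ≤ 1 := by
      have h1 : ‖E.bessel‖ ≤ 1 := hE.norm_op_le measurable_besselSymbol fun _ => abs_besselSymbol_le
      exact (E.bessel.le_of_opNorm_le h1 f).trans (by linarith)
    have h2 : ∫⁻ x, ENNReal.ofReal (|E.bessel f x| ^ (2 : ℝ)) ∂μ ≤ 1 := by
      rw [← eLpNorm_rpow_eq_lintegral _ two_pos, ENNReal.ofReal_ofNat, eLpNorm_two_eq]
      calc ENNReal.ofReal ‖E.bessel f‖ ^ (2 : ℝ) ≤ 1 ^ (2 : ℝ) := by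
            gcongr
            rwa [ENNReal.ofReal_le_one]
        _ = 1 := by simp
    calc ∫⁻ x, ENNReal.ofReal (|E.bessel f x| ^ (2 * p)) ∂μ
        ≤ ∫⁻ x, (ENNReal.ofReal (|E.bessel f x| ^ (2 : ℝ)) +
            ENNReal.ofReal (|E.bessel f x| ^ (2 * (2 * α / (2 * α - 1))))) ∂μ := by
          refine lintegral_mono fun x => ?_
          rcases le_total |E.bessel f x| 1 with hx | hx
          · refine le_add_right (ENNReal.ofReal_le_ofReal ?_)
            rcases (abs_nonneg (E.bessel f x)).eq_or_lt with h0 | h0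
            · rw [← h0, Real.zero_rpow hp0.ne']
              positivity
            · exact Real.rpow_le_rpow_of_exponent_ge h0 hx (by linarith)
          · refine le_add_left (ENNReal.ofReal_le_ofReal ?_)
            exact Real.rpow_le_rpow_of_exponent_le hx (by linarith [hpα h])
      _ ≤ 1 + K := by
          rw [lintegral_add_left]
          · exact add_le_add h2 (hK' f hf)
          · exact ((Lp.stronglyMeasurable _).measurable.abs.pow_const _).ennreal_ofReal
  have hfin : (1 + K) ^ (2 * p)⁻¹ ≠ ∞ := by finiteness
  refine ⟨((1 + K) ^ (2 * p)⁻¹).toReal, ENNReal.toReal_nonneg, fun f => ?_⟩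
  rcases eq_or_ne f 0 with rfl | hf
  · rw [map_zero, eLpNorm_congr_ae (Lp.coeFn_zero ℝ 2 μ)]
    simp
  have hf' := norm_pos_iff.2 hf
  have e : f = ‖f‖ • (‖f‖⁻¹ • f) := by rw [smul_smul, mul_inv_cancel₀ hf'.ne', one_smul]
  have h1 := hunit (‖f‖⁻¹ • f) (by
    rw [norm_smul, norm_inv, norm_norm, inv_mul_cancel₀ hf'.ne'])
  conv_lhs => rw [e, map_smul, eLpNorm_coeFn_smul]
  rw [ENNReal.ofReal_mul ENNReal.toReal_nonneg, ENNReal.ofReal_toReal hfin, mul_comm, enorm_norm,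
    ← ofReal_norm]
  gcongr

end CriticalSobolev

/-! ### The nonlinearity is Lipschitz on bounded sets of $H^1(A)$ -/

section Nonlinearity

open ResolutionOfIdentity

variable {X : Type*} [MeasurableSpace X] {μ : Measure X} {F : ℝ → ℝ} {p : ℝ}

/-- Hölder's inequality with $\frac12=\frac{p-1}{2p}+\frac1{2p}$; the factor $(|f|+|g|)^{p-1}$ in
$L^{2p/(p-1)}$ is the $(p-1)$-th power of an $L^{2p}$ norm. -/
theorem eLpNorm_comp_sub_comp_le (hp : 1 < p) {C : ℝ}
    (hF : ∀ z₁ z₂ : ℝ, |F z₁ - F z₂| ≤ C * (|z₁| + |z₂|) ^ (p - 1) * |z₁ - z₂|)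
    {f g : X → ℝ} (hf : AEStronglyMeasurable f μ) (hg : AEStronglyMeasurable g μ) :
    eLpNorm (fun x => F (f x) - F (g x)) 2 μ ≤ ENNReal.ofReal C *
      ((eLpNorm f (ENNReal.ofReal (2 * p)) μ + eLpNorm g (ENNReal.ofReal (2 * p)) μ) ^ (p - 1) *
        eLpNorm (f - g) (ENNReal.ofReal (2 * p)) μ) := by
  have hp1 : 0 < p - 1 := by linarith
  have hp0 : 0 < p := by linarith
  have htriple : ENNReal.HolderTriple (ENNReal.ofReal (2 * p / (p - 1)))
      (ENNReal.ofReal (2 * p)) 2 := ⟨by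
    rw [← ENNReal.ofReal_inv_of_pos (by positivity), ← ENNReal.ofReal_inv_of_pos (by positivity),
      ← ENNReal.ofReal_add (by positivity) (by positivity), ← ENNReal.ofReal_ofNat 2,
      ← ENNReal.ofReal_inv_of_pos (by norm_num)]
    congr 1
    field_simp
    ring⟩
  set h : X → ℝ := fun x => |f x| + |g x|
  have hh : AEStronglyMeasurable h μ := hf.norm.add hg.norm
  have hpow : AEStronglyMeasurable (fun x => ‖h x‖ ^ (p - 1)) μ :=
    (hh.norm.aemeasurable.pow_const _).aestronglyMeasurable
  have h1 : eLpNorm (fun x => F (f x) - F (g x)) 2 μ ≤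
      ENNReal.ofReal C * eLpNorm ((fun x => ‖h x‖ ^ (p - 1)) • (f - g)) 2 μ := by
    refine eLpNorm_le_mul_eLpNorm_of_ae_le_mul (Eventually.of_forall fun x => ?_) 2
    rw [Pi.smul_apply', Pi.sub_apply, norm_smul, Real.norm_eq_abs, Real.norm_eq_abs,
      abs_of_nonneg (Real.rpow_nonneg (norm_nonneg _) _), Real.norm_eq_abs (h x),
      abs_of_nonneg (show 0 ≤ h x from add_nonneg (abs_nonneg _) (abs_nonneg _)), ← mul_assoc]
    exact hF _ _
  refine h1.trans ?_
  gcongr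
  refine (eLpNorm_smul_le_mul_eLpNorm (p := ENNReal.ofReal (2 * p / (p - 1)))
    (q := ENNReal.ofReal (2 * p)) (hf.sub hg) hpow).trans ?_
  gcongr
  rw [eLpNorm_norm_rpow _ hp1, ← ENNReal.ofReal_mul (by positivity), div_mul_cancel₀ _ hp1.ne']
  gcongr
  have h2 := eLpNorm_add_le hf.norm hg.norm (p := ENNReal.ofReal (2 * p))
    (by rw [ENNReal.one_le_ofReal]; linarith)
  rw [eLpNorm_norm, eLpNorm_norm] at h2
  exact h2

variable {E : ResolutionOfIdentity (Lp ℝ 2 μ)}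

theorem memLp_comp_bessel (hp : 1 < p) (hF : IsNonlinearity F p) {B : ℝ}
    (hB : ∀ f : Lp ℝ 2 μ, eLpNorm (E.bessel f) (ENNReal.ofReal (2 * p)) μ ≤
      ENNReal.ofReal (B * ‖f‖)) (v : Lp ℝ 2 μ) : MemLp (fun x => F (E.bessel v x)) 2 μ := by
  obtain ⟨h0, hc, C, hC⟩ := hF
  refine ⟨hc.continuous.comp_aestronglyMeasurable (Lp.aestronglyMeasurable _), ?_⟩
  have h := eLpNorm_comp_sub_comp_le (μ := μ) hp hC (Lp.aestronglyMeasurable (E.bessel v))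
    (aestronglyMeasurable_const (b := (0 : ℝ)))
  simp only [h0, sub_zero] at h
  refine lt_of_le_of_lt h ?_
  have h1 : eLpNorm (E.bessel v) (ENNReal.ofReal (2 * p)) μ < ∞ :=
    (hB v).trans_lt ENNReal.ofReal_lt_top
  have h2 : ((E.bessel v : X → ℝ) - fun _ : X => (0 : ℝ)) = (E.bessel v : X → ℝ) := by
    funext x
    simp
  rw [h2, eLpNorm_zero', add_zero]
  exact ENNReal.mul_lt_top ENNReal.ofReal_lt_top
    (ENNReal.mul_lt_top (ENNReal.rpow_lt_top_of_nonneg (by linarith) h1.ne) h1)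

variable (E) in
/-- The nonlinearity `v ↦ F((I + A)^{-1/2} v)`. -/
def besselNonlinearity (F : ℝ → ℝ) (v : Lp ℝ 2 μ) : Lp ℝ 2 μ := superposition F (E.bessel v)

theorem exists_lipschitzOnWith_besselNonlinearity (hp : 1 < p) (hF : IsNonlinearity F p) {B : ℝ}
    (hB0 : 0 ≤ B) (hB : ∀ f : Lp ℝ 2 μ, eLpNorm (E.bessel f) (ENNReal.ofReal (2 * p)) μ ≤
      ENNReal.ofReal (B * ‖f‖)) (R : ℝ) :
    ∃ K : NNReal, LipschitzOnWith K (besselNonlinearity E F) (Metric.closedBall 0 R) := by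
  have hmem := memLp_comp_bessel hp hF hB
  obtain ⟨h0, hc, C, hC⟩ := hF
  rcases lt_or_ge R 0 with hR | hR
  · exact ⟨0, by simp [Metric.closedBall_eq_empty.2 hR]⟩
  have hp1 : 0 ≤ p - 1 := by linarith
  refine ⟨(|C| * ((B * R + B * R) ^ (p - 1) * B)).toNNReal, ?_⟩
  refine LipschitzOnWith.of_dist_le_mul fun v hv w hw => ?_
  rw [mem_closedBall_zero_iff] at hv hw
  rw [Real.coe_toNNReal _ (by positivity), dist_eq_norm, dist_eq_norm, besselNonlinearity,
    besselNonlinearity, superposition, superposition, dif_pos (hmem v), dif_pos (hmem w),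
    ← MemLp.toLp_sub, Lp.norm_toLp]
  refine ENNReal.toReal_le_of_le_ofReal (by positivity) ?_
  have h := eLpNorm_comp_sub_comp_le (μ := μ) hp
    (fun z₁ z₂ => (hC z₁ z₂).trans (show _ ≤ |C| * (|z₁| + |z₂|) ^ (p - 1) * |z₁ - z₂| by
      gcongr; exact le_abs_self C))
    (Lp.aestronglyMeasurable (E.bessel v)) (Lp.aestronglyMeasurable (E.bessel w))
  refine h.trans ?_
  have h3 : ∀ v : Lp ℝ 2 μ, ‖v‖ ≤ R → eLpNorm (E.bessel v) (ENNReal.ofReal (2 * p)) μ ≤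
      ENNReal.ofReal (B * R) := fun v hv =>
    (hB v).trans (ENNReal.ofReal_le_ofReal (by gcongr))
  have h4 : eLpNorm (⇑(E.bessel v) - ⇑(E.bessel w)) (ENNReal.ofReal (2 * p)) μ ≤
      ENNReal.ofReal (B * ‖v - w‖) := by
    rw [← eLpNorm_congr_ae (Lp.coeFn_sub _ _), ← map_sub]
    exact hB _
  have h5 : ENNReal.ofReal (|C| * ((B * R + B * R) ^ (p - 1) * B) * ‖v - w‖) =
      ENNReal.ofReal |C| * ((ENNReal.ofReal (B * R) + ENNReal.ofReal (B * R)) ^ (p - 1) *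
        ENNReal.ofReal (B * ‖v - w‖)) := by
    rw [← ENNReal.ofReal_add (by positivity) (by positivity),
      ENNReal.ofReal_rpow_of_nonneg (by positivity) hp1, ← ENNReal.ofReal_mul (by positivity),
      ← ENNReal.ofReal_mul (by positivity)]
    congr 1
    ring
  rw [h5]
  gcongr
  · exact h3 v hv
  · exact h3 w hw

end Nonlinearity

/-- A strongly continuous group of bounded operators. -/
structure StrongGroup (G : Type*) [NormedAddCommGroup G] [NormedSpace ℝ G] where
  op : ℝ → G →L[ℝ] G
  op_zero : ∀ x, op 0 x = x
  op_add : ∀ t s x, op (t + s) x = op t (op s x)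
  continuous_op : ∀ x, Continuous fun t => op t x
  exists_norm_le : ∀ T, ∃ M : ℝ, 0 < M ∧ ∀ t, |t| ≤ T → ‖op t‖ ≤ M

/-! ### The linear damped wave equation as a group on the energy space -/

namespace ResolutionOfIdentity

variable {H : Type*} [NormedAddCommGroup H] [InnerProductSpace ℝ H] [CompleteSpace H]
  {E : ResolutionOfIdentity H}

/-- Since $l(1+l)^{-1/2}\le(1+l)^{1/2}$, the energy bound for $(1+l)^{1/2}\mathcal D$ applies. -/
theorem abs_symbol_lower_left_le (t : ℝ) {l : ℝ} (hl : 0 ≤ l) :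
    |-(l * (besselSymbol l * symbolD t l))| ≤ Real.exp (3 * |t|) := by
  have h := abs_sobolevSymbol_mul_symbolD_le t hl
  have hs := sobolevSymbol_pos hl
  have h1 : |l * besselSymbol l| ≤ |sobolevSymbol l| := by
    rw [abs_mul, besselSymbol_eq hl, abs_of_nonneg hl, abs_of_pos (inv_pos.2 hs), abs_of_pos hs,
      mul_inv_le_iff₀ hs, ← sq, sobolevSymbol_sq hl]
    linarith
  rw [abs_neg, ← mul_assoc, abs_mul]
  rw [abs_mul] at h
  exact (mul_le_mul_of_nonneg_right h1 (abs_nonneg _)).trans h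

theorem measurable_symbol_lower_left (t : ℝ) :
    Measurable fun l => -(l * (besselSymbol l * symbolD t l)) :=
  (measurable_id.mul (measurable_besselSymbol.mul (measurable_symbolD t))).neg

theorem Nonneg.bdd_symbolD (hE : E.Nonneg) (t : ℝ) : E.Bdd (symbolD t) :=
  hE.bdd (measurable_symbolD t) fun _ => abs_symbolD_le t

theorem Nonneg.bdd_symbolDt (hE : E.Nonneg) (t : ℝ) : E.Bdd (symbolDt t) :=
  hE.bdd (measurable_symbolDt t) fun _ => abs_symbolDt_le t

theorem Nonneg.bdd_upper_left (hE : E.Nonneg) (t : ℝ) :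
    E.Bdd fun l => symbolD t l + symbolDt t l :=
  (hE.bdd_symbolD t).add (hE.bdd_symbolDt t)

theorem Nonneg.bdd_upper_right (hE : E.Nonneg) (t : ℝ) :
    E.Bdd fun l => sobolevSymbol l * symbolD t l :=
  hE.bdd (measurable_sobolevSymbol.mul (measurable_symbolD t))
    fun _ => abs_sobolevSymbol_mul_symbolD_le t

theorem Nonneg.bdd_lower_left (hE : E.Nonneg) (t : ℝ) :
    E.Bdd fun l => -(l * (besselSymbol l * symbolD t l)) :=
  hE.bdd (measurable_symbol_lower_left t) fun _ => abs_symbol_lower_left_le t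

variable (E) in
/-- The propagator of the linear damped wave equation, acting on `((I + A)^{1/2} u, ∂ₜu)`. -/
def waveOp (t : ℝ) : H × H →L[ℝ] H × H :=
  ((E.op fun l => symbolD t l + symbolDt t l).coprod
    (E.op fun l => sobolevSymbol l * symbolD t l)).prod
  ((E.op fun l => -(l * (besselSymbol l * symbolD t l))).coprod (E.op (symbolDt t)))

theorem waveOp_apply (t : ℝ) (x : H × H) : E.waveOp t x =
    (E.op (fun l => symbolD t l + symbolDt t l) x.1 +
        E.op (fun l => sobolevSymbol l * symbolD t l) x.2,
      E.op (fun l => -(l * (besselSymbol l * symbolD t l))) x.1 + E.op (symbolDt t) x.2) := rfl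

theorem waveOp_zero (x : H × H) : E.waveOp 0 x = x := by
  have z : E.op (fun _ => 0) = 0 := (Bdd.const 0).op_eq fun f h => by simp [weakIntegral]
  have e : symbolDt 0 = fun _ => 1 := funext symbolDt_zero
  rw [waveOp_apply]
  simp only [symbolD_zero, symbolDt_zero, zero_add, mul_zero, neg_zero, z, op_one, e]
  simp

theorem op_mul_add_op_mul {a b c d : ℝ → ℝ} (ha : E.Bdd a) (hb : E.Bdd b)
    (hc : E.Bdd c) (hd : E.Bdd d) (f : H) :
    E.op a (E.op b f) + E.op c (E.op d f) = E.op (fun l => a l * b l + c l * d l) f := by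
  rw [ha.op_mul hb, hc.op_mul hd, (ha.mul hb).op_add (hc.mul hd), add_apply]

/-- Entry by entry this is the pair of addition formulas for $\mathcal D$ and $\partial_t\mathcal
D$. The factors $(1+l)^{\pm1/2}$ of the off-diagonal entries cancel on the spectrum. -/
theorem Nonneg.waveOp_add (hE : E.Nonneg) (t s : ℝ) (x : H × H) :
    E.waveOp (t + s) x = E.waveOp t (E.waveOp s x) := by
  rw [waveOp_apply, waveOp_apply, waveOp_apply]
  simp only [map_add]
  have comb : ∀ {a b c d : H}, a + b + (c + d) = a + c + (b + d) := fun {a b c d} => by abel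
  refine Prod.ext ?_ ?_
  · simp only
    rw [comb, op_mul_add_op_mul (hE.bdd_upper_left t) (hE.bdd_upper_left s)
      (hE.bdd_upper_right t) (hE.bdd_lower_left s),
      op_mul_add_op_mul (hE.bdd_upper_left t) (hE.bdd_upper_right s)
      (hE.bdd_upper_right t) (hE.bdd_symbolDt s)]
    congr 1
    · congr 1
      refine hE.op_congr fun l hl => ?_
      rw [(symbolD_add t s hl).1, (symbolD_add t s hl).2]
      linear_combination l * symbolD t l * symbolD s l * besselSymbol_mul_sobolevSymbol hl
    · congr 1
      refine hE.op_congr fun l hl => ?_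
      rw [(symbolD_add t s hl).1]
      ring
  · simp only
    rw [comb, op_mul_add_op_mul (hE.bdd_lower_left t) (hE.bdd_upper_left s)
      (hE.bdd_symbolDt t) (hE.bdd_lower_left s),
      op_mul_add_op_mul (hE.bdd_lower_left t) (hE.bdd_upper_right s)
      (hE.bdd_symbolDt t) (hE.bdd_symbolDt s)]
    congr 1
    · congr 1
      refine hE.op_congr fun l hl => ?_
      rw [(symbolD_add t s hl).1]
      ring
    · congr 1
      refine hE.op_congr fun l hl => ?_
      rw [(symbolD_add t s hl).2]
      linear_combination l * symbolD t l * symbolD s l * besselSymbol_mul_sobolevSymbol hl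

theorem continuous_symbolD (l : ℝ) : Continuous fun t => symbolD t l :=
  continuous_iff_continuousAt.2 fun t => (hasDerivAt_symbolD t l).continuousAt

theorem continuous_symbolDt (l : ℝ) : Continuous fun t => symbolDt t l :=
  continuous_iff_continuousAt.2 fun t => (hasDerivAt_symbolDt t l).continuousAt

theorem abs_symbol_upper_left_le (t : ℝ) {l : ℝ} (hl : 0 ≤ l) :
    |symbolD t l + symbolDt t l| ≤ 2 * Real.exp (3 * |t|) := by
  have h := (abs_add_le _ _).trans (add_le_add (abs_symbolD_le t hl) (abs_symbolDt_le t hl))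
  linarith

theorem Nonneg.continuous_waveOp (hE : E.Nonneg) (x : H × H) :
    Continuous fun t => E.waveOp t x := by
  simp only [waveOp_apply]
  refine Continuous.prodMk (.add ?_ ?_) (.add ?_ ?_)
  · exact hE.continuous_op (φ := fun t l => symbolD t l + symbolDt t l)
      (fun t => (hE.bdd_upper_left t).1) (fun t l hl => abs_symbol_upper_left_le t hl)
      (fun l _ => (continuous_symbolD l).add (continuous_symbolDt l)) _
  · exact hE.continuous_op (φ := fun t l => sobolevSymbol l * symbolD t l) (K := 1)
      (fun t => (hE.bdd_upper_right t).1)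
      (fun t l hl => by simpa using abs_sobolevSymbol_mul_symbolD_le t hl)
      (fun l _ => continuous_const.mul (continuous_symbolD l)) _
  · exact hE.continuous_op (φ := fun t l => -(l * (besselSymbol l * symbolD t l))) (K := 1)
      (fun t => (hE.bdd_lower_left t).1)
      (fun t l hl => by simpa using abs_symbol_lower_left_le t hl)
      (fun l _ => (continuous_const.mul (continuous_const.mul (continuous_symbolD l))).neg) _
  · exact hE.continuous_op (φ := symbolDt) (K := 1) (fun t => (hE.bdd_symbolDt t).1)
      (fun t l hl => by simpa using abs_symbolDt_le t hl) (fun l _ => continuous_symbolDt l) _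

theorem Nonneg.norm_waveOp_le (hE : E.Nonneg) (t : ℝ) :
    ‖E.waveOp t‖ ≤ 3 * Real.exp (3 * |t|) := by
  have he := Real.exp_pos (3 * |t|)
  refine ContinuousLinearMap.opNorm_le_bound _ (by positivity) fun x => ?_
  have n1 : ‖E.op fun l => symbolD t l + symbolDt t l‖ ≤ 2 * Real.exp (3 * |t|) :=
    hE.norm_op_le (hE.bdd_upper_left t).1 fun l hl => abs_symbol_upper_left_le t hl
  have n2 : ‖E.op fun l => sobolevSymbol l * symbolD t l‖ ≤ Real.exp (3 * |t|) :=
    hE.norm_op_le (hE.bdd_upper_right t).1 fun l hl => abs_sobolevSymbol_mul_symbolD_le t hl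
  have n3 : ‖E.op fun l => -(l * (besselSymbol l * symbolD t l))‖ ≤ Real.exp (3 * |t|) :=
    hE.norm_op_le (hE.bdd_lower_left t).1 fun l hl => abs_symbol_lower_left_le t hl
  have n4 : ‖E.op (symbolDt t)‖ ≤ Real.exp (3 * |t|) :=
    hE.norm_op_le (hE.bdd_symbolDt t).1 fun l hl => abs_symbolDt_le t hl
  have x1 : ‖x.1‖ ≤ ‖x‖ := norm_fst_le x
  have x2 : ‖x.2‖ ≤ ‖x‖ := norm_snd_le x
  have hx := norm_nonneg x
  have bound : ∀ {S T : H →L[ℝ] H} {c d : ℝ}, ‖S‖ ≤ c → ‖T‖ ≤ d → 0 ≤ c → 0 ≤ d →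
      ‖S x.1 + T x.2‖ ≤ (c + d) * ‖x‖ := by
    intro S T c d hS hT hc hd
    refine (norm_add_le_of_le (S.le_of_opNorm_le hS _) (T.le_of_opNorm_le hT _)).trans ?_
    rw [add_mul]
    gcongr
  rw [waveOp_apply, Prod.norm_mk]
  refine max_le ((bound n1 n2 (by positivity) he.le).trans ?_)
    ((bound n3 n4 he.le he.le).trans ?_) <;> nlinarith

/-- The strongly continuous group of the linear damped wave equation on the energy space. -/
def Nonneg.waveGroup (hE : E.Nonneg) : StrongGroup (H × H) where
  op := E.waveOp
  op_zero := waveOp_zero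
  op_add := hE.waveOp_add
  continuous_op := hE.continuous_waveOp
  exists_norm_le T := ⟨3 * Real.exp (3 * T), by positivity, fun t ht =>
    (hE.norm_waveOp_le t).trans (by gcongr)⟩

theorem Nonneg.bessel_waveOp_fst (hE : E.Nonneg) (t : ℝ) (x : H × H) :
    E.bessel (E.waveOp t x).1 =
      E.op (fun l => besselSymbol l * (symbolD t l + symbolDt t l)) x.1 + E.op (symbolD t) x.2 := by
  rw [waveOp_apply]
  simp only [map_add]
  rw [bessel, hE.bdd_bessel.op_mul (hE.bdd_upper_left t),
    hE.bdd_bessel.op_mul (hE.bdd_upper_right t)]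
  congr 2
  refine hE.op_congr fun l hl => ?_
  rw [← mul_assoc, besselSymbol_mul_sobolevSymbol hl, one_mul]

/-- Orbits of the group are in general only continuous in the energy space, but $(I+A)^{-1/2}$ makes
the first component differentiable in $L^2$. On symbols, $\partial_t(\mathcal D+\partial_t\mathcal
D)=-l\mathcal D$, which yields the lower row of the matrix. -/
theorem Nonneg.hasDerivAt_bessel_waveOp_fst (hE : E.Nonneg) (x : H × H) (t : ℝ) :
    HasDerivAt (fun t => E.bessel (E.waveOp t x).1) (E.waveOp t x).2 t := by
  have e : (fun t => E.bessel (E.waveOp t x).1) = (fun t =>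
      E.op (fun l => besselSymbol l * (symbolD t l + symbolDt t l)) x.1) +
      fun t => E.op (symbolD t) x.2 :=
    funext fun t => hE.bessel_waveOp_fst t x
  rw [e, waveOp_apply]
  refine HasDerivAt.add ?_ ?_
  · refine hE.hasDerivAt_op (φ := fun t l => besselSymbol l * (symbolD t l + symbolDt t l))
      (φ' := fun t l => -(l * (besselSymbol l * symbolD t l))) zero_le_one
      (fun t => hE.bdd_bessel.mul (hE.bdd_upper_left t)) (fun t => (hE.bdd_lower_left t).1)
      (fun t l hl => by simpa using abs_symbol_lower_left_le t hl) (fun t l => ?_) _ t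
    refine (((hasDerivAt_symbolD t l).add (hasDerivAt_symbolDt t l)).const_mul _).congr_deriv ?_
    ring
  · exact hE.hasDerivAt_op (φ := symbolD) (φ' := symbolDt) zero_le_one hE.bdd_symbolD
      (fun t => (hE.bdd_symbolDt t).1) (fun t l hl => by simpa using abs_symbolDt_le t hl)
      (fun t l => hasDerivAt_symbolD t l) _ t

end ResolutionOfIdentity

/-! ### Semilinear equations for a strongly continuous group -/

theorem continuous_of_lipschitz_balls {G : Type*} [NormedAddCommGroup G] {Φ : G → G}
    (hΦ : ∀ R, ∃ K : NNReal, LipschitzOnWith K Φ (Metric.closedBall 0 R)) : Continuous Φ := by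
  refine continuous_iff_continuousAt.2 fun x => ?_
  obtain ⟨K, hK⟩ := hΦ (‖x‖ + 1)
  refine hK.continuousOn.continuousAt ?_
  filter_upwards [Metric.ball_mem_nhds x one_pos] with y hy
  rw [mem_closedBall_zero_iff]
  rw [mem_ball_iff_norm] at hy
  have := norm_sub_norm_le y x
  linarith

namespace StrongGroup

variable {G : Type*} [NormedAddCommGroup G] [NormedSpace ℝ G] (S : StrongGroup G) {Φ : G → G}

theorem op_neg_op (t : ℝ) (x : G) : S.op (-t) (S.op t x) = x := by
  rw [← S.op_add, neg_add_cancel, S.op_zero]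

theorem op_op_neg (t : ℝ) (x : G) : S.op t (S.op (-t) x) = x := by
  rw [← S.op_add, add_neg_cancel, S.op_zero]

/-- Joint continuity: strong continuity at a fixed vector plus local uniform boundedness of the
operators. -/
theorem continuous_op_apply : Continuous fun z : ℝ × G => S.op z.1 z.2 := by
  refine continuous_iff_continuousAt.2 fun ⟨t, x⟩ => ?_
  obtain ⟨M, hM, hM'⟩ := S.exists_norm_le (|t| + 1)
  rw [ContinuousAt, tendsto_iff_norm_sub_tendsto_zero]
  have h1 : Tendsto (fun z : ℝ × G => M * ‖z.2 - x‖ + ‖S.op z.1 x - S.op t x‖) (𝓝 (t, x))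
      (𝓝 (M * ‖x - x‖ + ‖S.op t x - S.op t x‖)) := by
    have hc : Continuous fun z : ℝ × G => M * ‖z.2 - x‖ + ‖S.op z.1 x - S.op t x‖ := by
      have := (S.continuous_op x).comp (continuous_fst (X := ℝ) (Y := G))
      simp only [Function.comp_def] at this
      fun_prop
    exact hc.tendsto (t, x)
  simp only [sub_self, norm_zero, mul_zero, add_zero] at h1
  refine squeeze_zero' (Eventually.of_forall fun z => norm_nonneg _) ?_ h1
  have h2 : ∀ᶠ z : ℝ × G in 𝓝 (t, x), |z.1| < |t| + 1 :=
    (continuous_fst.abs.tendsto (t, x)).eventually_lt_const (lt_add_one _)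
  filter_upwards [h2] with z hz
  calc ‖S.op z.1 z.2 - S.op t x‖ = ‖S.op z.1 (z.2 - x) + (S.op z.1 x - S.op t x)‖ := by
        rw [map_sub]; congr 1; abel
    _ ≤ _ := norm_add_le_of_le ((S.op z.1).le_of_opNorm_le (hM' _ hz.le) _) le_rfl

/-- The vector field of the semilinear equation in the moving frame of the group. -/
def field (Φ : G → G) (t : ℝ) (x : G) : G := S.op (-t) (Φ (S.op t x))

/-- `W` solves the semilinear equation with initial value `x₀` on `[0, T]`, in the moving frame of
the group. -/
def IsSolution (Φ : G → G) (x₀ : G) (T : ℝ) (W : ℝ → G) : Prop :=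
  W 0 = x₀ ∧ ∀ t ∈ Icc 0 T, HasDerivWithinAt W (S.field Φ t (W t)) (Icc 0 T) t

theorem exists_lipschitzOnWith_field
    (hΦ : ∀ R, ∃ K : NNReal, LipschitzOnWith K Φ (Metric.closedBall 0 R)) (T R : ℝ) :
    ∃ K : NNReal, ∀ t, |t| ≤ T → LipschitzOnWith K (S.field Φ t) (Metric.closedBall 0 R) := by
  obtain ⟨M, hM, hM'⟩ := S.exists_norm_le T
  obtain ⟨K, hK⟩ := hΦ (M * R)
  refine ⟨(M * (K * M)).toNNReal, fun t ht => LipschitzOnWith.of_dist_le_mul fun x hx y hy => ?_⟩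
  rw [Real.coe_toNNReal _ (by positivity), dist_eq_norm, dist_eq_norm, field, field, ← map_sub]
  have hmem : ∀ x ∈ Metric.closedBall (0 : G) R, S.op t x ∈ Metric.closedBall 0 (M * R) := by
    intro x hx
    rw [mem_closedBall_zero_iff] at hx ⊢
    exact ((S.op t).le_of_opNorm_le (hM' t ht) x).trans (by gcongr)
  have h1 := hK.dist_le_mul _ (hmem x hx) _ (hmem y hy)
  rw [dist_eq_norm, dist_eq_norm, ← map_sub] at h1
  have h2 := (S.op t).le_of_opNorm_le (hM' t ht) (x - y)
  refine ((S.op (-t)).le_of_opNorm_le (hM' _ (by rwa [abs_neg])) _).trans ?_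
  calc M * ‖Φ (S.op t x) - Φ (S.op t y)‖ ≤ M * (K * (M * ‖x - y‖)) := by
        gcongr
        exact h1.trans (by gcongr)
    _ = _ := by ring

theorem continuousOn_op_comp {W : ℝ → G} {s : Set ℝ} (hW : ContinuousOn W s) :
    ContinuousOn (fun t => S.op t (W t)) s :=
  S.continuous_op_apply.comp_continuousOn (continuousOn_id.prodMk hW)

theorem continuousOn_field (hΦ : Continuous Φ) {W : ℝ → G} {s : Set ℝ} (hW : ContinuousOn W s) :
    ContinuousOn (fun t => S.field Φ t (W t)) s :=
  S.continuous_op_apply.comp_continuousOn (continuousOn_id.neg.prodMk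
    (hΦ.comp_continuousOn (S.continuousOn_op_comp hW)))

/-- Picard-Lindelöf on a ball of radius $1$ around the initial value. The step is chosen before the
initial time and value; this uniformity gives both the existence time and the blow-up criterion. -/
theorem exists_local_solution [CompleteSpace G]
    (hΦ : ∀ R, ∃ K : NNReal, LipschitzOnWith K Φ (Metric.closedBall 0 R)) (T R : ℝ) :
    ∃ δ : ℝ, 0 < δ ∧ ∀ t₀ ∈ Icc 0 T, ∀ x₀ : G, ‖x₀‖ ≤ R → ∃ W : ℝ → G, W t₀ = x₀ ∧
      ∀ t ∈ Icc t₀ (t₀ + δ),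
        HasDerivWithinAt W (S.field Φ t (W t)) (Icc t₀ (t₀ + δ)) t := by
  obtain ⟨K, hK⟩ := S.exists_lipschitzOnWith_field hΦ (T + 1) (|R| + 1)
  obtain ⟨M, hM, hM'⟩ := S.exists_norm_le (T + 1)
  -- A bound for the field on all the balls in question. The step $1/(L+1)$ keeps solutions inside
  -- the unit ball around the initial value, and being at most $1$ it keeps times below $T+1$, where
  -- $K$ and $M$ are valid.
  set L : NNReal := ⟨K * (|R| + 1) + M * ‖Φ 0‖, by positivity⟩
  have hL : (L : ℝ) = K * (|R| + 1) + M * ‖Φ 0‖ := rfl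
  have hL0 : (0 : ℝ) ≤ L := L.2
  refine ⟨1 / (L + 1), by positivity, fun t₀ ht₀ x₀ hx₀ => ?_⟩
  have hδ : (1 : ℝ) / (L + 1) ≤ 1 := by
    rw [div_le_one (by positivity)]
    linarith
  have hδ0 : (0 : ℝ) < 1 / (L + 1) := by positivity
  have htime : ∀ t ∈ Icc t₀ (t₀ + 1 / (L + 1)), |t| ≤ T + 1 := fun t ht => by
    rw [abs_of_nonneg (ht₀.1.trans ht.1)]
    linarith [ht.2, ht₀.2]
  have hball : Metric.closedBall x₀ ((1 : NNReal) : ℝ) ⊆ Metric.closedBall 0 (|R| + 1) := by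
    intro x hx
    rw [mem_closedBall_iff_norm, NNReal.coe_one] at hx
    rw [mem_closedBall_zero_iff]
    have := norm_sub_norm_le x x₀
    linarith [le_abs_self R]
  have hPL : IsPicardLindelof (S.field Φ) (tmin := t₀) (tmax := t₀ + 1 / (L + 1))
      ⟨t₀, left_mem_Icc.2 (by linarith)⟩ x₀ 1 0 L K :=
    { lipschitzOnWith := fun t ht => (hK t (htime t ht)).mono hball
      continuousOn := fun x _ =>
        S.continuousOn_field (continuous_of_lipschitz_balls hΦ) continuousOn_const
      norm_le := fun t ht x hx => by
        have h0 : (0 : G) ∈ Metric.closedBall (0 : G) (|R| + 1) :=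
          Metric.mem_closedBall_self (by positivity)
        have h1 := (hK t (htime t ht)).dist_le_mul _ (hball hx) _ h0
        have h2 : ‖S.field Φ t 0‖ ≤ M * ‖Φ 0‖ := by
          rw [field, map_zero]
          exact (S.op (-t)).le_of_opNorm_le (hM' _ (by rw [abs_neg]; exact htime t ht)) _
        have h3 := mem_closedBall_zero_iff.1 (hball hx)
        rw [dist_eq_norm, dist_zero_right] at h1
        have h4 := norm_le_norm_sub_add (S.field Φ t x) (S.field Φ t 0)
        rw [hL]
        have h5 : (K : ℝ) * ‖x‖ ≤ K * (|R| + 1) := by gcongr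
        linarith
      mul_max_le := by
        simp only [add_sub_cancel_left, sub_self, NNReal.coe_one, NNReal.coe_zero, sub_zero]
        rw [max_eq_left hδ0.le, mul_one_div, div_le_one (by positivity)]
        linarith }
  exact hPL.exists_eq_forall_mem_Icc_hasDerivWithinAt₀

variable {S} {x₀ : G} {T T' : ℝ} {W W' : ℝ → G}

theorem IsSolution.continuousOn (hW : S.IsSolution Φ x₀ T W) : ContinuousOn W (Icc 0 T) :=
  fun t ht => (hW.2 t ht).continuousWithinAt

theorem IsSolution.mono (hW : S.IsSolution Φ x₀ T W) (hT : T' ≤ T) : S.IsSolution Φ x₀ T' W :=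
  ⟨hW.1, fun t ht => (hW.2 t ⟨ht.1, ht.2.trans hT⟩).mono (Icc_subset_Icc_right hT)⟩

/-- Both solutions are bounded on the compact interval, so the field is Lipschitz on a common ball
and Gronwall applies. -/
theorem IsSolution.eqOn
    (hΦ : ∀ R, ∃ K : NNReal, LipschitzOnWith K Φ (Metric.closedBall 0 R))
    (hW : S.IsSolution Φ x₀ T W) (hW' : S.IsSolution Φ x₀ T W') : EqOn W W' (Icc 0 T) := by
  obtain ⟨R, hR⟩ := isCompact_Icc.exists_bound_of_continuousOn hW.continuousOn
  obtain ⟨R', hR'⟩ := isCompact_Icc.exists_bound_of_continuousOn hW'.continuousOn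
  obtain ⟨K, hK⟩ := S.exists_lipschitzOnWith_field hΦ T (max R R')
  have hderiv : ∀ {W : ℝ → G}, S.IsSolution Φ x₀ T W →
      ∀ t ∈ Ico 0 T, HasDerivWithinAt W (S.field Φ t (W t)) (Ici t) t := fun hW t ht =>
    (hW.2 t (Ico_subset_Icc_self ht)).mono_of_mem_nhdsWithin
      (mem_of_superset (Icc_mem_nhdsGE ht.2) (Icc_subset_Icc_left ht.1))
  refine ODE_solution_unique_of_mem_Icc_right (v := S.field Φ) (K := K)
    (s := fun _ => Metric.closedBall 0 (max R R'))
    (fun t ht => hK t ?_) hW.continuousOn (hderiv hW) (fun t ht => ?_) hW'.continuousOn (hderiv hW')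
    (fun t ht => ?_) (hW.1.trans hW'.1.symm)
  · rw [abs_of_nonneg ht.1]
    exact ht.2.le
  · rw [mem_closedBall_zero_iff]
    exact (hR t (Ico_subset_Icc_self ht)).trans (le_max_left _ _)
  · rw [mem_closedBall_zero_iff]
    exact (hR' t (Ico_subset_Icc_self ht)).trans (le_max_right _ _)

theorem IsSolution.exists_extension (hW : S.IsSolution Φ x₀ T W) (hT : 0 ≤ T) {δ : ℝ} (hδ : 0 < δ)
    {V : ℝ → G} (hV0 : V T = W T)
    (hV : ∀ t ∈ Icc T (T + δ), HasDerivWithinAt V (S.field Φ t (V t)) (Icc T (T + δ)) t) :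
    ∃ U, S.IsSolution Φ x₀ (T + δ) U := by
  set U : ℝ → G := fun t => if t ≤ T then W t else V t with hU
  have hUW : ∀ t ≤ T, U t = W t := fun t ht => if_pos ht
  have hUV : ∀ t, T ≤ t → U t = V t := fun t ht => by
    rcases ht.eq_or_lt with rfl | h
    · rw [hUW T le_rfl, hV0]
    · exact if_neg (not_le.2 h)
  refine ⟨U, (hUW 0 hT).trans hW.1, fun t ht => ?_⟩
  have hl : t ≤ T → HasDerivWithinAt U (S.field Φ t (U t)) (Icc 0 T) t := fun h => by
    rw [hUW t h]
    exact (hW.2 t ⟨ht.1, h⟩).congr (fun s hs => hUW s hs.2) (hUW t h)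
  have hr : T ≤ t → HasDerivWithinAt U (S.field Φ t (U t)) (Icc T (T + δ)) t := fun h => by
    rw [hUV t h]
    exact (hV t ⟨h, ht.2⟩).congr (fun s hs => hUV s hs.1) (hUV t h)
  -- Only $t=T$ needs both pieces: the two one-sided derivatives are the field at the same point,
  -- hence equal, and the two intervals unite.
  rcases lt_trichotomy t T with h | h | h
  · refine (hl h.le).mono_of_mem_nhdsWithin ?_
    filter_upwards [self_mem_nhdsWithin, mem_nhdsWithin_of_mem_nhds (Iio_mem_nhds h)] with s hs hs'
    exact ⟨hs.1, (mem_Iio.1 hs').le⟩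
  · have := (hl h.le).union (hr h.ge)
    rwa [Icc_union_Icc_eq_Icc hT (by linarith)] at this
  · refine (hr h.le).mono_of_mem_nhdsWithin ?_
    filter_upwards [self_mem_nhdsWithin, mem_nhdsWithin_of_mem_nhds (Ioi_mem_nhds h)] with s hs hs'
    exact ⟨(mem_Ioi.1 hs').le, hs.2⟩

/-- Integrate $W'$, apply $S(t)$, and use $S(t)S(-\tau)=S(t-\tau)$. -/
theorem IsSolution.duhamel [CompleteSpace G] (hΦ : Continuous Φ) (hW : S.IsSolution Φ x₀ T W)
    {t : ℝ} (ht : t ∈ Icc 0 T) :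
    ContinuousOn (fun τ => S.op (t - τ) (Φ (S.op τ (W τ)))) (Icc 0 t) ∧
    S.op t (W t) = S.op t x₀ + ∫ τ in (0)..t, S.op (t - τ) (Φ (S.op τ (W τ))) := by
  have hsub : Icc 0 t ⊆ Icc 0 T := Icc_subset_Icc_right ht.2
  have hcont : ContinuousOn (fun τ => S.field Φ τ (W τ)) (Icc 0 t) :=
    (S.continuousOn_field hΦ hW.continuousOn).mono hsub
  have e : ∀ τ, S.op (t - τ) (Φ (S.op τ (W τ))) = S.op t (S.field Φ τ (W τ)) := fun τ => by
    rw [field, ← S.op_add, sub_eq_add_neg]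
  simp only [e]
  refine ⟨(S.op t).continuous.comp_continuousOn hcont, ?_⟩
  have hi : IntervalIntegrable (fun τ => S.field Φ τ (W τ)) volume 0 t :=
    hcont.intervalIntegrable_of_Icc ht.1
  have h := intervalIntegral.integral_eq_sub_of_hasDerivAt_of_le ht.1 (hW.continuousOn.mono hsub)
    (fun τ hτ => (hW.2 τ (hsub (Ioo_subset_Icc_self hτ))).hasDerivAt
      (Icc_mem_nhds hτ.1 (hτ.2.trans_le ht.2))) hi
  rw [(S.op t).intervalIntegral_comp_comm hi, h, hW.1, map_sub]
  abel

variable (S) in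
-- The linear problem with a known source; it serves to recover the velocity component of a given
-- mild solution.
theorem exists_duhamel [CompleteSpace G] {Ψ : ℝ → G} (hΨ : Continuous Ψ) (x₀ : G) :
    ∃ W : ℝ → G, W 0 = x₀ ∧ (∀ t, HasDerivAt W (S.op (-t) (Ψ t)) t) ∧
      ∀ t, Continuous (fun τ => S.op (t - τ) (Ψ τ)) ∧
        S.op t (W t) = S.op t x₀ + ∫ τ in (0)..t, S.op (t - τ) (Ψ τ) := by
  have hg : Continuous fun τ => S.op (-τ) (Ψ τ) :=
    S.continuous_op_apply.comp (continuous_neg.prodMk hΨ)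
  refine ⟨fun t => x₀ + ∫ τ in (0)..t, S.op (-τ) (Ψ τ), by simp,
    fun t => (hg.integral_hasStrictDerivAt 0 t).hasDerivAt.const_add _, fun t => ⟨?_, ?_⟩⟩
  · exact S.continuous_op_apply.comp ((continuous_const.sub continuous_id).prodMk hΨ)
  · have e : ∀ τ, S.op (t - τ) (Ψ τ) = S.op t (S.op (-τ) (Ψ τ)) := fun τ => by
      rw [← S.op_add, sub_eq_add_neg]
    simp only [e]
    rw [map_add, (S.op t).intervalIntegral_comp_comm (hg.intervalIntegrable _ _)]

end StrongGroup

/-! ### Mild solutions and solutions in the moving frame -/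

section Correspondence

open ResolutionOfIdentity

variable {X : Type*} [MeasurableSpace X] {μ : Measure X} {A : Lp ℝ 2 μ →ₗ.[ℝ] Lp ℝ 2 μ}
  {F : ℝ → ℝ} {p B T : ℝ} {v₀ u₁ : Lp ℝ 2 μ} {u : ℝ → Lp ℝ 2 μ}
  {W : ℝ → Lp ℝ 2 μ × Lp ℝ 2 μ}

theorem propD_eq_op (hE : (spectralResolution A).Nonneg) (t : ℝ) (f : Lp ℝ 2 μ) :
    propD A t f = (spectralResolution A).op (symbolD t) f :=
  opFun_eq_op (hE.bdd_symbolD t) f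

theorem propDtD_eq_op (hE : (spectralResolution A).Nonneg) (t : ℝ) (f : Lp ℝ 2 μ) :
    propDtD A t f = (spectralResolution A).op (symbolDt t) f := by
  have e : (fun l => deriv (fun s => symbolD s l) t) = symbolDt t := funext fun l => deriv_symbolD t l
  rw [propDtD, e]
  exact opFun_eq_op (hE.bdd_symbolDt t) f

theorem propD_eq_bessel_waveOp (hE : (spectralResolution A).Nonneg) (t : ℝ) (f : Lp ℝ 2 μ) :
    propD A t f = (spectralResolution A).bessel ((spectralResolution A).waveOp t (0, f)).1 := by
  rw [hE.bessel_waveOp_fst, propD_eq_op hE, map_zero, zero_add]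

theorem linearSolution_eq_bessel_waveOp (hE : (spectralResolution A).Nonneg)
    (v₀ u₁ : Lp ℝ 2 μ) (t : ℝ) :
    linearSolution A ((spectralResolution A).bessel v₀) u₁ t =
      (spectralResolution A).bessel ((spectralResolution A).waveOp t (v₀, u₁)).1 := by
  have e : (spectralResolution A).op
      (fun l => besselSymbol l * (symbolD t l + symbolDt t l)) v₀ =
      (spectralResolution A).op (symbolD t) ((spectralResolution A).bessel v₀) +
        (spectralResolution A).op (symbolDt t) ((spectralResolution A).bessel v₀) := by
    rw [bessel, ← add_apply, ← (hE.bdd_symbolD t).op_add (hE.bdd_symbolDt t),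
      (hE.bdd_upper_left t).op_mul hE.bdd_bessel]
    simp only [mul_comm]
  rw [hE.bessel_waveOp_fst, linearSolution, propD_eq_op hE, propDtD_eq_op hE, map_add, e]
  abel

variable (A F) in
/-- The nonlinearity of the first-order system for `((I + A)^{1/2} u, ∂ₜu)`. -/
def energyNonlinearity (x : Lp ℝ 2 μ × Lp ℝ 2 μ) : Lp ℝ 2 μ × Lp ℝ 2 μ :=
  (0, besselNonlinearity (spectralResolution A) F x.1)

theorem exists_lipschitzOnWith_energyNonlinearity (hp : 1 < p) (hF : IsNonlinearity F p)
    (hB0 : 0 ≤ B) (hB : ∀ f : Lp ℝ 2 μ, eLpNorm ((spectralResolution A).bessel f)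
      (ENNReal.ofReal (2 * p)) μ ≤ ENNReal.ofReal (B * ‖f‖)) (R : ℝ) :
    ∃ K : NNReal, LipschitzOnWith K (energyNonlinearity A F) (Metric.closedBall 0 R) := by
  obtain ⟨K, hK⟩ := exists_lipschitzOnWith_besselNonlinearity hp hF hB0 hB R
  refine ⟨K, LipschitzOnWith.of_dist_le_mul fun x hx y hy => ?_⟩
  have hmem : ∀ x ∈ Metric.closedBall (0 : Lp ℝ 2 μ × Lp ℝ 2 μ) R,
      x.1 ∈ Metric.closedBall 0 R := fun x hx => by
    rw [mem_closedBall_zero_iff] at hx ⊢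
    exact (norm_fst_le x).trans hx
  have h := hK.dist_le_mul _ (hmem x hx) _ (hmem y hy)
  rw [energyNonlinearity, energyNonlinearity, Prod.dist_eq]
  refine max_le (by simp only [dist_self]; positivity) (h.trans ?_)
  gcongr
  rw [Prod.dist_eq]
  exact le_max_left _ _

/-- Write $W(s)=W(t)+(W(s)-W(t))$. The first term is a free orbit, whose derivative is the velocity
component. The second has slope tending to the first component of $\Phi$, followed by
$(I+A)^{-1/2}$, and that component is zero. -/
theorem hasDerivWithinAt_bessel_waveOp (hE : (spectralResolution A).Nonneg)
    (hW : hE.waveGroup.IsSolution (energyNonlinearity A F) (v₀, u₁) T W) {t : ℝ}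
    (ht : t ∈ Icc 0 T) :
    HasDerivWithinAt
      (fun t => (spectralResolution A).bessel ((spectralResolution A).waveOp t (W t)).1)
      ((spectralResolution A).waveOp t (W t)).2 (Icc 0 T) t := by
  set E := spectralResolution A
  have h1 : HasDerivWithinAt (fun s => E.bessel (E.waveOp s (W t)).1) (E.waveOp t (W t)).2
      (Icc 0 T) t := (hE.hasDerivAt_bessel_waveOp_fst (W t) t).hasDerivWithinAt
  have h2 : HasDerivWithinAt (fun s => E.bessel (E.waveOp s (W s - W t)).1) 0 (Icc 0 T) t := by
    rw [hasDerivWithinAt_iff_tendsto_slope]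
    have hslope := hasDerivWithinAt_iff_tendsto_slope.1 (hW.2 t ht)
    have hjoint : Continuous fun z : ℝ × (Lp ℝ 2 μ × Lp ℝ 2 μ) =>
        E.bessel (E.waveOp z.1 z.2).1 :=
      E.bessel.continuous.comp (continuous_fst.comp hE.waveGroup.continuous_op_apply)
    have hid : Tendsto (fun s : ℝ => s) (𝓝[Icc 0 T \ {t}] t) (𝓝 t) :=
      tendsto_id.mono_left nhdsWithin_le_nhds
    have hlim := (hjoint.tendsto (t, hE.waveGroup.field (energyNonlinearity A F) t (W t))).comp
      (hid.prodMk_nhds hslope)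
    have hzero : E.bessel (E.waveOp t
        (hE.waveGroup.field (energyNonlinearity A F) t (W t))).1 = 0 := by
      have := hE.waveGroup.op_op_neg t (energyNonlinearity A F (hE.waveGroup.op t (W t)))
      rw [StrongGroup.field]
      change E.bessel (hE.waveGroup.op t _).1 = 0
      rw [this, energyNonlinearity, map_zero]
    simp only [hzero] at hlim
    refine hlim.congr fun s => ?_
    simp [slope_def_module]
  have h3 := h1.add h2
  rw [add_zero] at h3
  refine h3.congr (fun s _ => ?_) ?_
  · rw [Pi.add_apply, ← map_add, ← Prod.fst_add, ← map_add, add_sub_cancel]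
  · rw [Pi.add_apply, ← map_add, ← Prod.fst_add, ← map_add, add_sub_cancel]

/-- Continuity in $H^1(A)$ is continuity of the first component of $S(t)W(t)$, the $C^1$ property is
continuity of the second, and the mild equation is $(I+A)^{-1/2}$ applied to the first component of
Duhamel's formula. -/
theorem isMildSolution_of_isSolution (hE : (spectralResolution A).Nonneg) (hp : 1 < p)
    (hF : IsNonlinearity F p) (hB0 : 0 ≤ B) (hB : ∀ f : Lp ℝ 2 μ, eLpNorm
      ((spectralResolution A).bessel f) (ENNReal.ofReal (2 * p)) μ ≤ ENNReal.ofReal (B * ‖f‖))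
    (hT : 0 < T) (hW : hE.waveGroup.IsSolution (energyNonlinearity A F) (v₀, u₁) T W)
    (hu : EqOn u (fun t => (spectralResolution A).bessel
      ((spectralResolution A).waveOp t (W t)).1) (Icc 0 T)) :
    IsMildSolution A F ((spectralResolution A).bessel v₀) u₁ T u := by
  set E := spectralResolution A
  have hU : ContinuousOn (fun t => E.waveOp t (W t)) (Icc 0 T) :=
    hE.waveGroup.continuousOn_op_comp hW.continuousOn
  have hΦ : Continuous (energyNonlinearity A F) :=
    continuous_of_lipschitz_balls (exists_lipschitzOnWith_energyNonlinearity hp hF hB0 hB)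
  have hderiv : ∀ t ∈ Icc 0 T, HasDerivWithinAt u (E.waveOp t (W t)).2 (Icc 0 T) t :=
    fun t ht => (hasDerivWithinAt_bessel_waveOp hE hW ht).congr hu (hu ht)
  refine ⟨⟨fun t ht => ?_, fun t ht => ?_, ?_⟩, fun τ hτ => ?_, fun t ht => ?_⟩
  · exact (memSobolev_one_iff hE).2 ⟨_, (hu ht).symm⟩
  · have h1 : Tendsto (fun s => ‖(E.waveOp s (W s)).1 - (E.waveOp t (W t)).1‖) (𝓝[Icc 0 T] t)
        (𝓝 0) := tendsto_iff_norm_sub_tendsto_zero.1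
      ((continuous_fst.comp_continuousOn hU) t ht)
    refine h1.congr' ?_
    filter_upwards [self_mem_nhdsWithin] with s hs
    rw [hu hs, hu ht, ← map_sub, sobolevNorm_one_bessel hE]
  · rw [contDiffOn_one_iff_derivWithin (uniqueDiffOn_Icc hT)]
    refine ⟨fun t ht => (hderiv t ht).differentiableWithinAt, ?_⟩
    exact (continuous_snd.comp_continuousOn hU).congr fun t ht =>
      (hderiv t ht).derivWithin (uniqueDiffOn_Icc hT t ht)
  · rw [hu hτ]
    exact memLp_comp_bessel hp hF hB _
  · obtain ⟨hcont, hduh⟩ := hW.duhamel hΦ ht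
    have hintegrand : ∀ τ ∈ Icc 0 t, propD A (t - τ) (superposition F (u τ)) =
        E.bessel (hE.waveGroup.op (t - τ)
          (energyNonlinearity A F (hE.waveGroup.op τ (W τ)))).1 := by
      intro τ hτ
      rw [hu ⟨hτ.1, hτ.2.trans ht.2⟩, propD_eq_bessel_waveOp hE]
      rfl
    set L : Lp ℝ 2 μ × Lp ℝ 2 μ →L[ℝ] Lp ℝ 2 μ :=
      E.bessel.comp (ContinuousLinearMap.fst ℝ (Lp ℝ 2 μ) (Lp ℝ 2 μ))
    have hi := hcont.intervalIntegrable_of_Icc (μ := volume) ht.1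
    have heq : EqOn (fun τ => propD A (t - τ) (superposition F (u τ)))
        (fun τ => L (hE.waveGroup.op (t - τ)
          (energyNonlinearity A F (hE.waveGroup.op τ (W τ))))) (Icc 0 t) := hintegrand
    refine ⟨?_, ?_⟩
    · exact (((L.continuous.comp_continuousOn hcont)).congr heq).intervalIntegrable_of_Icc ht.1
    · have hset : ∫ τ in (0)..t, propD A (t - τ) (superposition F (u τ)) =
          ∫ τ in (0)..t, L (hE.waveGroup.op (t - τ)
          (energyNonlinearity A F (hE.waveGroup.op τ (W τ)))) := by
        refine intervalIntegral.integral_congr ?_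
        rwa [uIcc_of_le ht.1]
      rw [hset, L.intervalIntegral_comp_comm hi, linearSolution_eq_bessel_waveOp hE, hu ht]
      change L (hE.waveGroup.op t (W t)) = L (hE.waveGroup.op t (v₀, u₁)) + _
      rw [hduh, map_add]

/-- The mild equation prescribes only the first component. With $F(u)$ regarded as a known source,
the linear problem produces a pair whose first component must be $v$, by injectivity of
$(I+A)^{-1/2}$. As $\Phi$ depends only on that component, the known source is the nonlinear one. -/
theorem exists_isSolution_of_isMildSolution (hE : (spectralResolution A).Nonneg) (hp : 1 < p)
    (hF : IsNonlinearity F p) (hB0 : 0 ≤ B) (hB : ∀ f : Lp ℝ 2 μ, eLpNorm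
      ((spectralResolution A).bessel f) (ENNReal.ofReal (2 * p)) μ ≤ ENNReal.ofReal (B * ‖f‖))
    (hT : 0 < T) (hu : IsMildSolution A F ((spectralResolution A).bessel v₀) u₁ T u) :
    ∃ W, hE.waveGroup.IsSolution (energyNonlinearity A F) (v₀, u₁) T W ∧
      EqOn u (fun t => (spectralResolution A).bessel
        ((spectralResolution A).waveOp t (W t)).1) (Icc 0 T) := by
  set E := spectralResolution A
  obtain ⟨⟨hmem, hcont, -⟩, -, hduh⟩ := hu
  have hex : ∀ t : Icc 0 T, ∃ g, E.bessel g = u t := fun t =>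
    (memSobolev_one_iff hE).1 (hmem t t.2)
  choose v hv using hex
  have hvc : Continuous v := by
    refine continuous_iff_continuousAt.2 fun t => ?_
    rw [ContinuousAt, tendsto_iff_norm_sub_tendsto_zero]
    have h := (hcont t t.2).comp (tendsto_nhdsWithin_iff.2
      ⟨continuous_subtype_val.tendsto t, Eventually.of_forall fun s => s.2⟩)
    refine h.congr fun s => ?_
    rw [Function.comp_apply, ← hv, ← hv, ← map_sub, sobolevNorm_one_bessel hE]
  have hΦ : Continuous (energyNonlinearity A F) :=
    continuous_of_lipschitz_balls (exists_lipschitzOnWith_energyNonlinearity hp hF hB0 hB)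
  -- Constant extension beyond $[0,T]$ makes the source continuous on the whole line; the second
  -- slot is irrelevant to the nonlinearity.
  set Ψ : ℝ → Lp ℝ 2 μ × Lp ℝ 2 μ := fun τ => energyNonlinearity A F (IccExtend hT.le v τ, 0)
  have hΨ : Continuous Ψ := hΦ.comp ((hvc.Icc_extend' (h := hT.le)).prodMk continuous_const)
  have hΨv : ∀ t (ht : t ∈ Icc 0 T), Ψ t = (0, superposition F (u t)) := fun t ht => by
    simp only [Ψ, energyNonlinearity, besselNonlinearity, IccExtend_of_mem hT.le v ht, E, hv]
  obtain ⟨W, hW0, hWd, hWi⟩ := hE.waveGroup.exists_duhamel hΨ (v₀, u₁)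
  have hkey : ∀ t ∈ Icc 0 T, u t = E.bessel (E.waveOp t (W t)).1 := by
    intro t ht
    obtain ⟨hc, hi⟩ := hWi t
    have hL := (E.bessel.comp
      (ContinuousLinearMap.fst ℝ (Lp ℝ 2 μ) (Lp ℝ 2 μ))).intervalIntegral_comp_comm
        (hc.intervalIntegrable (μ := volume) 0 t)
    have hprop : ∫ τ in (0)..t, propD A (t - τ) (superposition F (u τ)) =
        E.bessel (∫ τ in (0)..t, hE.waveGroup.op (t - τ) (Ψ τ)).1 := by
      refine Eq.trans (intervalIntegral.integral_congr fun τ hτ => ?_) hL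
      rw [uIcc_of_le ht.1] at hτ
      simp only [hΨv τ ⟨hτ.1, hτ.2.trans ht.2⟩, propD_eq_bessel_waveOp hE]
      rfl
    have hi1 : E.waveOp t (W t) = E.waveOp t (v₀, u₁) +
      ∫ τ in (0)..t, hE.waveGroup.op (t - τ) (Ψ τ) := hi
    rw [(hduh t ht).2, hprop, linearSolution_eq_bessel_waveOp hE, hi1, Prod.fst_add, map_add]
  have hfst : ∀ t (ht : t ∈ Icc 0 T), (E.waveOp t (W t)).1 = v ⟨t, ht⟩ := by
    intro t ht
    refine hE.bessel_injective ?_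
    rw [hv]
    exact (hkey t ht).symm
  refine ⟨W, ⟨hW0, fun t ht => ?_⟩, hkey⟩
  have e : hE.waveGroup.field (energyNonlinearity A F) t (W t) =
      hE.waveGroup.op (-t) (Ψ t) := by
    have e1 : energyNonlinearity A F (E.waveOp t (W t)) = Ψ t := by
      simp only [Ψ, energyNonlinearity, hfst t ht, IccExtend_of_mem hT.le v ht]
    rw [← e1]
    rfl
  rw [e]
  exact (hWd t).hasDerivWithinAt

theorem existsUniqueMildSolution_iff (hE : (spectralResolution A).Nonneg) (hp : 1 < p)
    (hF : IsNonlinearity F p) (hB0 : 0 ≤ B) (hB : ∀ f : Lp ℝ 2 μ, eLpNorm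
      ((spectralResolution A).bessel f) (ENNReal.ofReal (2 * p)) μ ≤ ENNReal.ofReal (B * ‖f‖))
    (hT : 0 < T) : ExistsUniqueMildSolution A F ((spectralResolution A).bessel v₀) u₁ T ↔
      ∃ W, hE.waveGroup.IsSolution (energyNonlinearity A F) (v₀, u₁) T W := by
  constructor
  · rintro ⟨u, hu, -⟩
    obtain ⟨W, hW, -⟩ := exists_isSolution_of_isMildSolution hE hp hF hB0 hB hT hu
    exact ⟨W, hW⟩
  · rintro ⟨W, hW⟩
    refine ⟨_, isMildSolution_of_isSolution hE hp hF hB0 hB hT hW fun t _ => rfl, fun w hw => ?_⟩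
    obtain ⟨W', hW', hw'⟩ := exists_isSolution_of_isMildSolution hE hp hF hB0 hB hT hw
    intro t ht
    rw [hw' ht]
    simp only
    rw [hW'.eqOn (exists_lipschitzOnWith_energyNonlinearity hp hF hB0 hB) hW ht]

end Correspondence

/-! ### Local existence, the maximal solution and blow-up -/

section MaximalSolution

open ResolutionOfIdentity

variable {X : Type*} [MeasurableSpace X] {μ : Measure X} {A : Lp ℝ 2 μ →ₗ.[ℝ] Lp ℝ 2 μ}
  {F : ℝ → ℝ} {p B T : ℝ} {v₀ u₁ : Lp ℝ 2 μ} {u : ℝ → Lp ℝ 2 μ}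

theorem exists_local_existence_time (hE : (spectralResolution A).Nonneg) (hp : 1 < p)
    (hF : IsNonlinearity F p) (hB0 : 0 ≤ B) (hB : ∀ f : Lp ℝ 2 μ, eLpNorm
      ((spectralResolution A).bessel f) (ENNReal.ofReal (2 * p)) μ ≤ ENNReal.ofReal (B * ‖f‖)) :
    ∃ T : ℝ → ℝ → ℝ, (∀ a b, 0 < T a b) ∧ ∀ v₀ u₁ : Lp ℝ 2 μ,
      ExistsUniqueMildSolution A F ((spectralResolution A).bessel v₀) u₁ (T ‖v₀‖ ‖u₁‖) := by
  have hΦ := exists_lipschitzOnWith_energyNonlinearity hp hF hB0 hB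
  -- The maximum is the norm of the pair of data in the product space.
  choose δ hδ hsol using fun a b : ℝ => hE.waveGroup.exists_local_solution hΦ 0 (max a b)
  refine ⟨δ, hδ, fun v₀ u₁ => ?_⟩
  obtain ⟨W, hW0, hW⟩ := hsol ‖v₀‖ ‖u₁‖ 0 ⟨le_rfl, le_rfl⟩ (v₀, u₁) le_rfl
  rw [zero_add] at hW
  exact (existsUniqueMildSolution_iff hE hp hF hB0 hB (hδ _ _)).2 ⟨W, hW0, hW⟩

theorem exists_isSolution_of_lt_maximalTime (hE : (spectralResolution A).Nonneg) (hp : 1 < p)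
    (hF : IsNonlinearity F p) (hB0 : 0 ≤ B) (hB : ∀ f : Lp ℝ 2 μ, eLpNorm
      ((spectralResolution A).bessel f) (ENNReal.ofReal (2 * p)) μ ≤ ENNReal.ofReal (B * ‖f‖))
    (hT : ENNReal.ofReal T < maximalTime A F ((spectralResolution A).bessel v₀) u₁) :
    ∃ W, hE.waveGroup.IsSolution (energyNonlinearity A F) (v₀, u₁) T W := by
  obtain ⟨S, ⟨T', hT'0, hT', rfl⟩, hlt⟩ := lt_sSup_iff.1 hT
  obtain ⟨W, hW⟩ := (existsUniqueMildSolution_iff hE hp hF hB0 hB hT'0).1 hT'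
  exact ⟨W, hW.mono ((ENNReal.ofReal_lt_ofReal_iff hT'0).1 hlt).le⟩

/-- The value at $t$ is read off from some solution on $[0,t]$; uniqueness makes these choices
compatible. -/
theorem exists_isMaximalSolution (hE : (spectralResolution A).Nonneg) (hp : 1 < p)
    (hF : IsNonlinearity F p) (hB0 : 0 ≤ B) (hB : ∀ f : Lp ℝ 2 μ, eLpNorm
      ((spectralResolution A).bessel f) (ENNReal.ofReal (2 * p)) μ ≤ ENNReal.ofReal (B * ‖f‖))
    (v₀ u₁ : Lp ℝ 2 μ) :
    ∃ u, IsMaximalSolution A F ((spectralResolution A).bessel v₀) u₁ u := by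
  classical
  have hΦ := exists_lipschitzOnWith_energyNonlinearity hp hF hB0 hB
  choose! W hW using fun (T : ℝ) (hT : ENNReal.ofReal T <
    maximalTime A F ((spectralResolution A).bessel v₀) u₁) =>
      exists_isSolution_of_lt_maximalTime hE hp hF hB0 hB hT
  refine ⟨fun t => (spectralResolution A).bessel ((spectralResolution A).waveOp t (W t t)).1,
    fun T hT0 hT => ?_⟩
  refine isMildSolution_of_isSolution hE hp hF hB0 hB hT0 (hW T hT) fun t ht => ?_
  have hlt := (ENNReal.ofReal_le_ofReal ht.2).trans_lt hT
  simp only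
  rw [(hW t hlt).eqOn hΦ ((hW T hT).mono ht.2) ⟨ht.1, le_rfl⟩]

/-- For every $b$ there is a restart step $\delta$ valid for energy norms up to $b$ at all times up
to $T_{\max}$. A norm below $b$ at a single $t>T_{\max}-\delta$ would extend the solution to
$t+\delta>T_{\max}$. This excludes small values at all such times, so the limit, not merely the
upper limit, is infinite. -/
theorem IsMaximalSolution.blowUp (hE : (spectralResolution A).Nonneg) (hp : 1 < p)
    (hF : IsNonlinearity F p) (hB0 : 0 ≤ B) (hB : ∀ f : Lp ℝ 2 μ, eLpNorm
      ((spectralResolution A).bessel f) (ENNReal.ofReal (2 * p)) μ ≤ ENNReal.ofReal (B * ‖f‖))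
    (hu : IsMaximalSolution A F ((spectralResolution A).bessel v₀) u₁ u)
    (hpos : 0 < maximalTime A F ((spectralResolution A).bessel v₀) u₁)
    (hfin : maximalTime A F ((spectralResolution A).bessel v₀) u₁ < ∞) :
    Tendsto (fun t => sobolevNorm A 1 (u t) + ‖deriv u t‖)
      (𝓝[<] (maximalTime A F ((spectralResolution A).bessel v₀) u₁).toReal) atTop := by
  set τ := (maximalTime A F ((spectralResolution A).bessel v₀) u₁).toReal with hτ
  have hτ0 : 0 < τ := ENNReal.toReal_pos hpos.ne' hfin.ne
  have hτ' : maximalTime A F ((spectralResolution A).bessel v₀) u₁ = ENNReal.ofReal τ :=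
    (ENNReal.ofReal_toReal hfin.ne).symm
  have hΦ := exists_lipschitzOnWith_energyNonlinearity hp hF hB0 hB
  obtain ⟨M, hM, hM'⟩ := hE.waveGroup.exists_norm_le τ
  refine tendsto_atTop.2 fun b => ?_
  -- The restart takes place in the moving frame, where $W(t)=S(-t)U(t)$ costs the factor $M$.
  obtain ⟨δ, hδ, hloc⟩ := hE.waveGroup.exists_local_solution hΦ τ (M * b)
  filter_upwards [self_mem_nhdsWithin,
    mem_nhdsWithin_of_mem_nhds (Ioi_mem_nhds (show max 0 (τ - δ) < τ from
      max_lt hτ0 (by linarith)))] with t ht1 ht2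
  have htτ : t < τ := ht1
  have ht0 : 0 < t := (le_max_left _ _).trans_lt ht2
  have htδ : τ - δ < t := (le_max_right _ _).trans_lt ht2
  by_contra hcon
  rw [not_le] at hcon
  -- The midpoint keeps $t$ in the interior of an interval of existence, so that the two-sided
  -- derivative of $u$ is the velocity component.
  have hT0 : 0 < (t + τ) / 2 := by linarith
  have hTτ : ENNReal.ofReal ((t + τ) / 2) <
      maximalTime A F ((spectralResolution A).bessel v₀) u₁ := by
    rw [hτ', ENNReal.ofReal_lt_ofReal_iff hτ0]
    linarith
  obtain ⟨W, hW, huW⟩ := exists_isSolution_of_isMildSolution hE hp hF hB0 hB hT0 (hu _ hT0 hTτ)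
  have htmem : t ∈ Icc 0 ((t + τ) / 2) := ⟨ht0.le, by linarith⟩
  have hderiv : deriv u t = ((spectralResolution A).waveOp t (W t)).2 :=
    (((hasDerivWithinAt_bessel_waveOp hE hW htmem).congr huW (huW htmem)).hasDerivAt
      (Icc_mem_nhds ht0 (by linarith))).deriv
  have hnorm : ‖hE.waveGroup.op t (W t)‖ ≤ b := by
    change ‖(spectralResolution A).waveOp t (W t)‖ ≤ b
    rw [huW htmem, sobolevNorm_one_bessel hE, hderiv] at hcon
    rw [Prod.norm_def]
    exact max_le (by linarith [norm_nonneg ((spectralResolution A).waveOp t (W t)).2])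
      (by linarith [norm_nonneg ((spectralResolution A).waveOp t (W t)).1])
  have hWt : ‖W t‖ ≤ M * b := by
    rw [← hE.waveGroup.op_neg_op t (W t)]
    refine ((hE.waveGroup.op (-t)).le_of_opNorm_le (hM' _ ?_) _).trans (by gcongr)
    rw [abs_neg, abs_of_pos ht0]
    exact htτ.le
  obtain ⟨V, hV0, hV⟩ := hloc t ⟨ht0.le, htτ.le⟩ (W t) hWt
  have hext := (hW.mono htmem.2).exists_extension ht0.le hδ hV0 hV
  have hEU := (existsUniqueMildSolution_iff hE hp hF hB0 hB (by linarith)).2 hext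
  have hle : ENNReal.ofReal (t + δ) ≤
      maximalTime A F ((spectralResolution A).bessel v₀) u₁ :=
    le_sSup ⟨t + δ, by linarith, hEU, rfl⟩
  rw [hτ', ENNReal.ofReal_le_ofReal_iff hτ0.le] at hle
  linarith

end MaximalSolution

end DampedWave

end

theorem mainTheorem3 {X : Type*} [MeasurableSpace X] (μ : Measure X) [SigmaFinite μ]
    (A : Lp ℝ 2 μ →ₗ.[ℝ] Lp ℝ 2 μ) (hA : IsSelfAdjoint A) (hA₀ : DampedWave.IsNonneg A)
    (α : ℝ) (hα : 0 < α) (hdecay : DampedWave.HeatDecay A α)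
    (hLq : DampedWave.HeatLqBounds A α)
    (p : ℝ) (hp : 1 < p) (hpα : 1 / 2 < α → p ≤ 2 * α / (2 * α - 1))
    (F : ℝ → ℝ) (hF : DampedWave.IsNonlinearity F p) :
    (∃ T : ℝ → ℝ → ℝ, (∀ a b, 0 < T a b) ∧
      ∀ u₀ u₁ : Lp ℝ 2 μ, DampedWave.MemSobolev A 1 u₀ →
        DampedWave.ExistsUniqueMildSolution A F u₀ u₁
          (T (DampedWave.sobolevNorm A 1 u₀) ‖u₁‖)) ∧
    ∀ u₀ u₁ : Lp ℝ 2 μ, DampedWave.MemSobolev A 1 u₀ →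
      (∃ u : ℝ → Lp ℝ 2 μ, DampedWave.IsMaximalSolution A F u₀ u₁ u) ∧
      ∀ u : ℝ → Lp ℝ 2 μ, DampedWave.IsMaximalSolution A F u₀ u₁ u →
        DampedWave.maximalTime A F u₀ u₁ < ∞ →
        Tendsto (fun t => DampedWave.sobolevNorm A 1 (u t) + ‖deriv u t‖)
          (𝓝[<] (DampedWave.maximalTime A F u₀ u₁).toReal) atTop := by
  have hE := DampedWave.spectralResolution_nonneg hA₀
  obtain ⟨B, hB0, hB⟩ := DampedWave.exists_bessel_bound hE hα hdecay hLq hp hpα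
  obtain ⟨T, hT, hsol⟩ := DampedWave.exists_local_existence_time hE hp hF hB0 hB
  refine ⟨⟨T, hT, fun u₀ u₁ hu₀ => ?_⟩, fun u₀ u₁ hu₀ => ?_⟩
  · obtain ⟨v₀, rfl⟩ := (DampedWave.memSobolev_one_iff hE).1 hu₀
    rw [DampedWave.sobolevNorm_one_bessel hE]
    exact hsol v₀ u₁
  · obtain ⟨v₀, rfl⟩ := (DampedWave.memSobolev_one_iff hE).1 hu₀
    refine ⟨DampedWave.exists_isMaximalSolution hE hp hF hB0 hB v₀ u₁, fun u hu hfin => ?_⟩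
    refine hu.blowUp hE hp hF hB0 hB (lt_of_lt_of_le ?_
      (le_sSup ⟨T ‖v₀‖ ‖u₁‖, hT _ _, hsol v₀ u₁, rfl⟩)) hfin
    exact ENNReal.ofReal_pos.2 (hT _ _)
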